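/- Let $Q$ be a quiver of finite type, i.e. its underlying graph is a finite disjoint union of Dynkin diagrams of types $A,D,E$, with set of nodes $Q_0$ and set of arrows $Q_1$. Let $\sigma$ be a contravariant involution of $Q$: involutions of $Q_0$ and $Q_1$ such that $\alpha:i\to j$ gives $\sigma(\alpha):\sigma(j)\to\sigma(i)$ and every arrow $i\to\sigma(i)$ is fixed. Let $(s,\tau)$ be a duality structure: $s:Q_0\to\{\pm1\}$ is $\sigma$-invariant, $\tau:Q_1\to\{\pm1\}$, and $\tau_\alpha\tau_{\sigma(\alpha)}=s_is_j$ for $\alpha:i\to j$. Fix a finite field $\mathbb F_q$ of odd characteristic. All representations are finite-dimensional over $\mathbb F_q$. Let $\Lambda_Q^+=\mathbb Z_{\ge0}Q_0$, let $\Lambda_Q^{\sigma,+}$ be its $\sigma$-invariant part, and put $H(d)=d+\sigma(d)$. Let $\chi(d,d')=\sum_id_id'_i-\sum_{i\to j}d_id'_j$, $\langle d,d'\rangle=\chi(d,d')-\chi(d',d)$ and $$\mathcal E(d)=\sum_{i\in Q_0^\sigma}\tfrac{d_i(d_i-s_i)}2+\sum_{i\in Q_0^+}d_{\sigma(i)}d_i-\sum_{(\sigma(i)\xrightarrow{\alpha}i)\in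 Q_1^\sigma}\tfrac{d_i(d_i+\tau_\alpha s_i)}2-\sum_{(i\to j)\in Q_1^+}d_{\sigma(i)}d_j ,$$ where $Q_0^\sigma,Q_1^\sigma$ are the fixed nodes and arrows and $Q_0^+,Q_1^+$ contain one element of each two-element $\sigma$-orbit. A self-dual representation is a representation $M$ with a non-degenerate bilinear form on $\bigoplus_iM_i$ such that $M_i\perp M_j$ unless $i=\sigma(j)$, the form is $s_i$-symmetric on $M_i+M_{\sigma(i)}$, and $\langle m_\alpha x,x'\rangle=\tau_\alpha\langle x,m_{\sigma(\alpha)}x'\rangle$ for $\alpha:i\to j$, $x\in M_i$, $x'\in M_{\sigma(j)}$. Given $\theta\in\mathrm{Hom}(\mathbb Z Q_0,\mathbb Z)$, let $\mu(d)=\theta(d)/\sum_id_i$ for $d\neq0$. A representation is semistable if all its non-zero subrepresentations have slope at most its own; for a self-dual representation this is required of isotropic subrepresentations. Assume that $\theta$ is $\sigma$-generic: $\sigma^*\theta=-\theta$; $\langle d,d'\rangle=0$ whenever $d,d'$ are dimension vectors of non-zero semistable representations with $\mu(d)=\mu(d')$; and every dimension vector of a non-zero semistable representation of slope $0$ is $\sigma$-invariant.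 Consider formal series $\sum_{d\in\Lambda_Q^+}f_dx_d$ with $x_dx_{d'}=q^{\frac12\langle d,d'\rangle}x_{d+d'}$, acting on formal series $\sum_{e\in\Lambda_Q^{\sigma,+}}S_e\xi_e$ by $x_d\star\xi_e=q^{\frac12(\langle d,e\rangle+\mathcal E(\sigma(d))-\mathcal E(d))}\xi_{H(d)+e}$. Set $$A_\mu^\theta=\sum_U\frac{q^{\frac12\chi(\dim U,\dim U)}}{\#\mathrm{Aut}(U)}x_{\dim U},\qquad A^{\sigma,\theta}=\sum_M\frac{q^{\frac12\mathcal E(\dim M)}}{\#\mathrm{Aut}_S(M)}\xi_{\dim M},\qquad \mathbb E_q(x)=\sum_{n\ge0}\frac{q^{n^2/2}}{\prod_{j<n}(q^n-q^j)}x^n ,$$ the sums running over the isomorphism classes of semistable $U$ that are zero or of slope $\mu$, respectively over the isometry classes of semistable self-dual $M$ ($\mathrm{Aut}_S$ denotes the group of self-isometries). **Theorem.** There is a unique finitely supported family of integers $(\Omega_d^\theta)_{d\in\Lambda_Q^+\setminus\{0\}}$ with $A_\mu^\theta=\prod_{\mu(d)=\mu}\mathbb E_q(x_d)^{\Omega_d^\theta}$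 for every $\mu\in\mathbb Q$ (in any order of the factors). There is a unique family $(\Omega_e^{\sigma,\theta})_{e\in\Lambda_Q^{\sigma,+}}$ of real numbers with $$A^{\sigma,\theta}=\sum_{e\in\Lambda_Q^{\sigma,+}}\Bigl(\prod_{\mu(d)=0}\mathbb E_{q^2}\bigl(q^{\frac12-\chi(e,d)-\mathcal E(d)}x_d\bigr)^{\Omega_d^\theta}\Bigr)\star\Omega_e^{\sigma,\theta}\xi_e ,$$ and all $\Omega_e^{\sigma,\theta}$ are non-negative integers. Explicitly: 1. If the duality structure is hyperbolic, i.e. $s_i=-1$ at every fixed node $i$ and $\tau_\alpha s_i=-1$ at every fixed arrow $\alpha:\sigma(i)\to i$ (the $\sigma$-connected components are disjoint unions of a quiver with its opposite, of type $A_{2n+1}$ with symplectic duality, or of type $A_{2n}$ with orthogonal duality), then $\Omega_e^{\sigma,\theta}=\delta_{e,0}$. 2. If all $\sigma$-connected components of type $A$ are non-hyperbolic, i.e. $s_i=1$ at every fixed node and $\tau_\alpha s_i=1$ at every fixed arrow $\alpha:\sigma(i)\to i$, then $\Omega_e^{\sigma,\theta}=1$ if $e=0$ or $e=e_1+\dots+e_k$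 with pairwise distinct $e_l\in\Lambda_Q^{\sigma,+}$ such that $\Omega_{e_l}^\theta=1$, and $\Omega_e^{\sigma,\theta}=0$ otherwise. 3. For an arbitrary duality structure, $\Omega_e^{\sigma,\theta}=1$ if $e=0$ or $e=e_1+\dots+e_k$ with pairwise distinct $e_l\in\Lambda_Q^{\sigma,+}$ such that $\Omega_{e_l}^\theta=1$ and the support of each $e_l$ contains a fixed node $i$ with $s_i=1$ or the target $i$ of a fixed arrow $\alpha:\sigma(i)\to i$ with $\tau_\alpha s_i=1$; otherwise $\Omega_e^{\sigma,\theta}=0$. -/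

import Mathlib

namespace Orientifold

/-- Dimension vectors, the monoid `Λ_Q^+`. -/
abbrev DimVec (Q₀ : Type*) := Q₀ → ℕ

/-- A quiver with nodes `Q₀` and arrows `Q₁`, together with a contravariant involution `σ`. -/
structure InvolutiveQuiver (Q₀ Q₁ : Type*) where
  src : Q₁ → Q₀
  tgt : Q₁ → Q₀
  σ₀ : Q₀ → Q₀
  σ₁ : Q₁ → Q₁
  σ₀_σ₀ : ∀ i, σ₀ (σ₀ i) = i
  σ₁_σ₁ : ∀ a, σ₁ (σ₁ a) = a
  src_σ₁ : ∀ a, src (σ₁ a) = σ₀ (tgt a)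
  tgt_σ₁ : ∀ a, tgt (σ₁ a) = σ₀ (src a)
  fixed : ∀ a, tgt a = σ₀ (src a) → σ₁ a = a

/-- The simply laced Dynkin types.  In the low-rank cases `D 1 = A 1`, `D 2 = A 1 ⊔ A 1` and
`D 3 = A 3` up to relabelling, and `A 0`, `D 0` are empty, so no restriction on `n` is needed. -/
inductive DynkinType where
  | A (n : ℕ)
  | D (n : ℕ)
  | E₆
  | E₇
  | E₈

/-- Number of nodes of a Dynkin diagram. -/
def DynkinType.rank : DynkinType → ℕ
  | .A n => n
  | .D n => n
  | .E₆ => 6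
  | .E₇ => 7
  | .E₈ => 8

/-- Cartan matrix of a Dynkin diagram. -/
def DynkinType.cartan : (T : DynkinType) → Matrix (Fin T.rank) (Fin T.rank) ℤ
  | .A n => CartanMatrix.A n
  | .D n => CartanMatrix.D n
  | .E₆ => CartanMatrix.E₆
  | .E₇ => CartanMatrix.E₇
  | .E₈ => CartanMatrix.E₈

namespace InvolutiveQuiver

section Quiver

variable {Q₀ Q₁ : Type*} (Q : InvolutiveQuiver Q₀ Q₁)

/-- The underlying graph of the quiver is a disjoint union of Dynkin diagrams of types `A`, `D`,
`E`: its Cartan matrix `2 δ_{ij} - #{i → j} - #{j → i}` is, after relabelling the nodes, a block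
diagonal matrix of simply laced Cartan matrices. -/
def IsFiniteType [DecidableEq Q₀] [Fintype Q₁] : Prop :=
  ∃ (m : ℕ) (T : Fin m → DynkinType) (f : Q₀ ≃ Σ c, Fin (T c).rank), ∀ i j,
    (if i = j then (2 : ℤ) else 0)
        - (Finset.univ.filter fun a => Q.src a = i ∧ Q.tgt a = j).card
        - (Finset.univ.filter fun a => Q.src a = j ∧ Q.tgt a = i).card
      = Matrix.blockDiagonal' (fun c => (T c).cartan) (f i) (f j)

/-- The `σ`-invariant dimension vectors, `Λ_Q^{σ,+}`. -/
abbrev SDimVec := {e : DimVec Q₀ // ∀ i, e (Q.σ₀ i) = e i}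

/-- The zero dimension vector, as a `σ`-invariant one. -/
def zeroDim : Q.SDimVec := ⟨0, fun _ => rfl⟩

/-- The action of `σ` on dimension vectors. -/
def sigmaDim (d : DimVec Q₀) : DimVec Q₀ := fun i => d (Q.σ₀ i)

/-- The map `H(d) = d + σ(d)`. -/
def hyp (d : DimVec Q₀) : DimVec Q₀ := d + Q.sigmaDim d

/-- `f - H(d)`, only used when `H(d) ≤ f`. -/
def subHyp (f : Q.SDimVec) (d : DimVec Q₀) : Q.SDimVec :=
  ⟨fun i => f.1 i - Q.hyp d i, fun i => by
    simp only [hyp, sigmaDim, Pi.add_apply, Q.σ₀_σ₀, f.2 i, Nat.add_comm]⟩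

/-- `e` is a sum of pairwise distinct `σ`-invariant dimension vectors, each satisfying `P`.  The empty
sum is allowed, so this always holds for `e = 0`. -/
def IsDistinctSum (P : DimVec Q₀ → Prop) (e : Q.SDimVec) : Prop :=
  ∃ S : Finset Q.SDimVec, (∀ f ∈ S, P f.1) ∧ ∑ f ∈ S, f.1 = e.1

/-- The Euler form `χ`. -/
def euler [Fintype Q₀] [Fintype Q₁] (d d' : DimVec Q₀) : ℤ :=
  ∑ i, (d i : ℤ) * d' i - ∑ a, (d (Q.src a) : ℤ) * d' (Q.tgt a)

/-- The skew-symmetrized Euler form `⟨d, d'⟩`. -/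
def skew [Fintype Q₀] [Fintype Q₁] (d d' : DimVec Q₀) : ℤ :=
  Q.euler d d' - Q.euler d' d

/-! ### Representations and stability -/

/-- Representations of dimension vector `d` on the spaces `k^{d_i}`. -/
abbrev Rep (k : Type*) [Field k] (d : DimVec Q₀) :=
  ∀ a : Q₁, (Fin (d (Q.src a)) → k) →ₗ[k] (Fin (d (Q.tgt a)) → k)

/-- Isomorphisms of representations. -/
def RepIso {k : Type*} [Field k] {d : DimVec Q₀} (M N : Q.Rep k d) :=
  {φ : ∀ i, (Fin (d i) → k) ≃ₗ[k] (Fin (d i) → k) //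
    ∀ a x, φ (Q.tgt a) (M a x) = N a (φ (Q.src a) x)}

/-- The relation of being isomorphic. -/
def repSetoid (k : Type*) [Field k] (d : DimVec Q₀) : Setoid (Q.Rep k d) where
  r M N := Nonempty (Q.RepIso M N)
  iseqv :=
    { refl := fun _ => ⟨⟨fun _ => LinearEquiv.refl k _, fun _ _ => rfl⟩⟩
      symm := by
        rintro M N ⟨⟨φ, h⟩⟩
        refine ⟨⟨fun i => (φ i).symm, fun a x => ?_⟩⟩
        rw [LinearEquiv.symm_apply_eq, h, LinearEquiv.apply_symm_apply]
      trans := by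
        rintro M N P ⟨⟨φ, h⟩⟩ ⟨⟨ψ, h'⟩⟩
        exact ⟨⟨fun i => (φ i).trans (ψ i), fun a x => by simp [h, h']⟩⟩ }

/-- A family of subspaces `W_i ⊆ k^{d_i}` is a subrepresentation. -/
def IsSubrep {k : Type*} [Field k] {d : DimVec Q₀} (M : Q.Rep k d)
    (W : ∀ i, Submodule k (Fin (d i) → k)) : Prop :=
  ∀ a, ∀ x ∈ W (Q.src a), M a x ∈ W (Q.tgt a)

end Quiver

end InvolutiveQuiver

/-- The dimension vector of a graded subspace. -/
noncomputable def subDim {Q₀ k : Type*} [Field k] {d : DimVec Q₀}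
    (W : ∀ i, Submodule k (Fin (d i) → k)) : DimVec Q₀ :=
  fun i => Module.finrank k (W i)

/-- The slope `μ(d) = θ(d) / dim d` (meaningful for `d ≠ 0`). -/
def slope {Q₀ : Type*} [Fintype Q₀] (θ : Q₀ → ℤ) (d : DimVec Q₀) : ℚ :=
  (∑ i, (θ i : ℚ) * d i) / ∑ i, (d i : ℚ)

namespace InvolutiveQuiver

section Stability

variable {Q₀ Q₁ : Type*} [Fintype Q₀] (Q : InvolutiveQuiver Q₀ Q₁)

/-- Semistability of an ordinary representation.  (The zero representation is included.) -/
def IsSemistable {k : Type*} [Field k] (θ : Q₀ → ℤ) {d : DimVec Q₀} (M : Q.Rep k d) : Prop :=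
  ∀ W : ∀ i, Submodule k (Fin (d i) → k), Q.IsSubrep M W → subDim W ≠ 0 →
    slope θ (subDim W) ≤ slope θ d

/-- `d` is the dimension vector of a non-zero semistable representation. -/
def IsSemistableDim (k : Type*) [Field k] (θ : Q₀ → ℤ) (d : DimVec Q₀) : Prop :=
  d ≠ 0 ∧ ∃ M : Q.Rep k d, Q.IsSemistable θ M

/-- `σ`-generic stabilities. -/
structure IsSigmaGeneric [Fintype Q₁] (k : Type*) [Field k] (θ : Q₀ → ℤ) : Prop where
  /-- `θ` is `σ`-compatible: `σ^* θ = -θ`. -/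
  compatible : ∀ i, θ (Q.σ₀ i) = -θ i
  /-- Semistable dimension vectors of the same slope are orthogonal for the skew form. -/
  skew_eq_zero : ∀ d d', Q.IsSemistableDim k θ d → Q.IsSemistableDim k θ d' →
    slope θ d = slope θ d' → Q.skew d d' = 0
  /-- Semistable dimension vectors of slope zero are `σ`-invariant. -/
  invariant : ∀ d, Q.IsSemistableDim k θ d → slope θ d = 0 → Q.sigmaDim d = d

end Stability

/-! ### Duality structures and self-dual representations -/

/-- A duality structure `(s, τ)`. -/
structure DualityStructure {Q₀ Q₁ : Type*} (Q : InvolutiveQuiver Q₀ Q₁) where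
  s : Q₀ → ℤˣ
  τ : Q₁ → ℤˣ
  s_σ₀ : ∀ i, s (Q.σ₀ i) = s i
  τ_mul : ∀ a, τ a * τ (Q.σ₁ a) = s (Q.src a) * s (Q.tgt a)

namespace DualityStructure

section SelfDual

variable {Q₀ Q₁ : Type*} [DecidableEq Q₀] {Q : InvolutiveQuiver Q₀ Q₁} (D : Q.DualityStructure)

/-- Self-dual representations of dimension vector `d`: structure maps and a non-degenerate bilinear
form on the total space.  `Pi.single i x` is `x ∈ M_i` regarded as an element of the total space. -/
structure SelfDualRep (k : Type*) [Field k] (d : DimVec Q₀) where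
  maps : Q.Rep k d
  form : LinearMap.BilinForm k (∀ i, Fin (d i) → k)
  nondegenerate : form.Nondegenerate
  /-- `M_i` and `M_j` are orthogonal unless `i = σ(j)`. -/
  orthogonal : ∀ i j, i ≠ Q.σ₀ j → ∀ (x : Fin (d i) → k) (y : Fin (d j) → k),
    form (Pi.single i x) (Pi.single j y) = 0
  /-- The form is `s_i`-symmetric on `M_i + M_{σ(i)}`. -/
  symmetric : ∀ i (x : Fin (d i) → k) (y : Fin (d (Q.σ₀ i)) → k),
    form (Pi.single i x) (Pi.single (Q.σ₀ i) y)
      = ((D.s i : ℤ) : k) * form (Pi.single (Q.σ₀ i) y) (Pi.single i x)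
  /-- `⟨m_a x, y⟩ = τ_a ⟨x, m_{σ(a)} y⟩` for `a : i → j`, `x ∈ M_i`, `y ∈ M_{σ(j)}`. -/
  compatible : ∀ a (x : Fin (d (Q.src a)) → k) (y : Fin (d (Q.src (Q.σ₁ a))) → k),
    form (Pi.single (Q.tgt a) (maps a x)) (Pi.single (Q.src (Q.σ₁ a)) y)
      = ((D.τ a : ℤ) : k) *
        form (Pi.single (Q.src a) x) (Pi.single (Q.tgt (Q.σ₁ a)) (maps (Q.σ₁ a) y))

variable {D}

/-- Isometries of self-dual representations. -/
def Isometry {k : Type*} [Field k] {d : DimVec Q₀} (M N : D.SelfDualRep k d) :=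
  {φ : ∀ i, (Fin (d i) → k) ≃ₗ[k] (Fin (d i) → k) //
    (∀ a x, φ (Q.tgt a) (M.maps a x) = N.maps a (φ (Q.src a) x)) ∧
    ∀ x y : ∀ i, Fin (d i) → k,
      N.form (fun i => φ i (x i)) (fun i => φ i (y i)) = M.form x y}

variable (D)

/-- The relation of being isometric. -/
def isometrySetoid (k : Type*) [Field k] (d : DimVec Q₀) : Setoid (D.SelfDualRep k d) where
  r M N := Nonempty (Isometry M N)
  iseqv :=
    { refl := fun _ => ⟨⟨fun _ => LinearEquiv.refl k _, fun _ _ => rfl, fun _ _ => rfl⟩⟩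
      symm := by
        rintro M N ⟨⟨φ, h, h'⟩⟩
        refine ⟨⟨fun i => (φ i).symm, fun a x => ?_, fun x y => ?_⟩⟩
        · rw [LinearEquiv.symm_apply_eq, h, LinearEquiv.apply_symm_apply]
        · rw [← h']
          simp
      trans := by
        rintro M N P ⟨⟨φ, h, h'⟩⟩ ⟨⟨ψ, g, g'⟩⟩
        refine ⟨⟨fun i => (φ i).trans (ψ i), fun a x => by simp [h, g], fun x y => ?_⟩⟩
        rw [← h', ← g']
        rfl }

variable {D}

/-- A graded subspace is isotropic: `U ⊆ U^⊥`. -/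
def IsIsotropic {k : Type*} [Field k] {d : DimVec Q₀} (M : D.SelfDualRep k d)
    (W : ∀ i, Submodule k (Fin (d i) → k)) : Prop :=
  ∀ i j, ∀ x ∈ W i, ∀ y ∈ W j, M.form (Pi.single i x) (Pi.single j y) = 0

/-- `σ`-semistability: the slope condition is imposed on isotropic subrepresentations. -/
def IsSigmaSemistable [Fintype Q₀] {k : Type*} [Field k] (θ : Q₀ → ℤ) {d : DimVec Q₀}
    (M : D.SelfDualRep k d) : Prop :=
  ∀ W : ∀ i, Submodule k (Fin (d i) → k), Q.IsSubrep M.maps W → IsIsotropic M W →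
    subDim W ≠ 0 → slope θ (subDim W) ≤ slope θ d

variable (D)

/-- The function `𝓔`.  The sums over `Q₀^+` and `Q₁^+` are written as one half of the sums over all
nodes and arrows not fixed by `σ`; the numerator is even, see `two_mul_modEuler`. -/
def modEuler [Fintype Q₀] [Fintype Q₁] [DecidableEq Q₁] (d : DimVec Q₀) : ℤ :=
  ((∑ i with Q.σ₀ i = i, (d i : ℤ) * (d i - D.s i))
    + (∑ i with Q.σ₀ i ≠ i, (d (Q.σ₀ i) : ℤ) * d i)
    - (∑ a with Q.σ₁ a = a, (d (Q.tgt a) : ℤ) * (d (Q.tgt a) + D.τ a * D.s (Q.tgt a)))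
    - (∑ a with Q.σ₁ a ≠ a, (d (Q.σ₀ (Q.src a)) : ℤ) * d (Q.tgt a))) / 2

/-- A sum of an invariant function over the points moved by an involution is even. -/
theorem even_sum_moved {X : Type*} [Fintype X] [DecidableEq X] (σ : X → X)
    (hσ : ∀ x, σ (σ x) = x) (f : X → ℤ) (hf : ∀ x, f (σ x) = f x) :
    (2 : ℤ) ∣ ∑ x with σ x ≠ x, f x := by
  have h : ((∑ x with σ x ≠ x, f x : ℤ) : ZMod 2) = 0 := by
    push_cast
    refine Finset.sum_involution (fun x _ => σ x) ?_ ?_ ?_ ?_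
    · intro x _
      rw [hf x]
      exact CharTwo.add_self_eq_zero _
    · intro x hx _
      simpa using hx
    · intro x hx
      simp only [Finset.mem_filter, Finset.mem_univ, true_and, hσ] at hx ⊢
      exact fun h => hx h.symm
    · intro x _
      exact hσ x
  exact (ZMod.intCast_zmod_eq_zero_iff_dvd _ 2).mp h

/-- The division by two in the definition of `𝓔` is exact. -/
theorem two_mul_modEuler [Fintype Q₀] [Fintype Q₁] [DecidableEq Q₁] (d : DimVec Q₀) :
    2 * D.modEuler d =
      (∑ i with Q.σ₀ i = i, (d i : ℤ) * (d i - D.s i))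
      + (∑ i with Q.σ₀ i ≠ i, (d (Q.σ₀ i) : ℤ) * d i)
      - (∑ a with Q.σ₁ a = a, (d (Q.tgt a) : ℤ) * (d (Q.tgt a) + D.τ a * D.s (Q.tgt a)))
      - (∑ a with Q.σ₁ a ≠ a, (d (Q.σ₀ (Q.src a)) : ℤ) * d (Q.tgt a)) := by
  have key : ∀ (n : ℕ) (u : ℤˣ), (2 : ℤ) ∣ n * (n + u) := by
    intro n u
    rcases Int.units_eq_one_or u with rfl | rfl
    · simpa using (Int.even_mul_succ_self (n : ℤ)).two_dvd
    · simpa [sub_eq_add_neg] using (Int.even_mul_pred_self (n : ℤ)).two_dvd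
  unfold modEuler
  refine Int.mul_ediv_cancel' (dvd_sub (dvd_sub (dvd_add ?_ ?_) ?_) ?_)
  · refine Finset.dvd_sum fun i _ => ?_
    simpa [sub_eq_add_neg] using key (d i) (-D.s i)
  · refine even_sum_moved Q.σ₀ Q.σ₀_σ₀ _ fun i => ?_
    rw [Q.σ₀_σ₀, mul_comm]
  · refine Finset.dvd_sum fun a _ => ?_
    simpa using key (d (Q.tgt a)) (D.τ a * D.s (Q.tgt a))
  · refine even_sum_moved Q.σ₁ Q.σ₁_σ₁ _ fun a => ?_
    rw [Q.src_σ₁, Q.tgt_σ₁, Q.σ₀_σ₀, mul_comm]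

/-- Hyperbolic duality structures.  The duality type of a connected component of a finite type
quiver with involution is governed by its fixed node or fixed arrow, if there is one: a component
`A_{2n+1}` has one fixed node `i`, at which the sign is `s_i`; a component `A_{2n}` has one fixed
arrow `a : σ(i) → i`, and the map at `a` is a `τ_a s_i`-symmetric bilinear form; a disjoint union of
a quiver and its opposite has neither.  All signs are `-1` exactly when every component is a disjoint
union of a quiver and its opposite, of type `A_{2n+1}` with (a duality equivalent to) the symplectic
one (`s = -1`, `τ = -1`), or of type `A_{2n}` with the orthogonal one (`s = 1`, `τ = -1`). -/
def IsHyperbolic : Prop :=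
  (∀ i, Q.σ₀ i = i → D.s i = -1) ∧ ∀ a, Q.σ₁ a = a → D.τ a * D.s (Q.tgt a) = -1

/-- Duality structures none of whose `σ`-connected components of type `A` is hyperbolic, that is, all
of them are orthogonal of type `A_{2n+1}` or symplectic of type `A_{2n}`.  Components that are
disjoint unions of a quiver and its opposite carry no `σ`-invariant root and are unrestricted. -/
def IsNonHyperbolic : Prop :=
  (∀ i, Q.σ₀ i = i → D.s i = 1) ∧ ∀ a, Q.σ₁ a = a → D.τ a * D.s (Q.tgt a) = 1

/-- The support of `d` meets a fixed node or fixed arrow of a non-hyperbolic component. -/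
def MeetsNonHyperbolic (d : DimVec Q₀) : Prop :=
  (∃ i, Q.σ₀ i = i ∧ D.s i = 1 ∧ d i ≠ 0) ∨
    ∃ a, Q.σ₁ a = a ∧ D.τ a * D.s (Q.tgt a) = 1 ∧ d (Q.tgt a) ≠ 0

end SelfDual

end DualityStructure

/-! ### Quantum torus, its module, and the DT series -/

section Torus

variable {Q₀ Q₁ : Type*} [Fintype Q₀] [DecidableEq Q₀] [Fintype Q₁] (Q : InvolutiveQuiver Q₀ Q₁)

/-- Multiplication of the quantum torus, `x_d x_{d'} = r^{⟨d, d'⟩} x_{d + d'}` with `r = q^{1/2}`.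
A series `∑ f_d x_d` is represented by its coefficient function `f`. -/
noncomputable def torusMul (r : ℝ) (f g : DimVec Q₀ → ℝ) : DimVec Q₀ → ℝ :=
  fun d => ∑ a ∈ Finset.Iic d, f a * g (d - a) * r ^ Q.skew a (d - a)

/-- Ordered product of a list of elements of the quantum torus. -/
noncomputable def torusProd (r : ℝ) (l : List (DimVec Q₀ → ℝ)) : DimVec Q₀ → ℝ :=
  l.foldr (Q.torusMul r) (Pi.single 0 1)

end Torus

end InvolutiveQuiver

/-- For a one variable series `f = ∑ c_n x^n` and `d ≠ 0`, the element `f(x_d) = ∑ c_n x_{nd}` of the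
quantum torus; note `x_d^n = x_{nd}` since `⟨d, d⟩ = 0`. -/
noncomputable def evalAt {Q₀ : Type*} [Fintype Q₀] (f : PowerSeries ℝ) (d : DimVec Q₀) :
    DimVec Q₀ → ℝ :=
  open Classical in
  fun v => ∑ n ∈ Finset.range (∑ i, v i + 1), if v = n • d then PowerSeries.coeff n f else 0

/-- The quantum dilogarithm `𝔼_q(x) = ∑ q^{n²/2} x^n / ∏_{j<n} (q^n - q^j)`, as a function of
`r = q^{1/2}`.  So `𝔼_q` is `qDilog (√q)` and `𝔼_{q²}` is `qDilog q`. -/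
noncomputable def qDilog (r : ℝ) : PowerSeries ℝ :=
  PowerSeries.mk fun n => r ^ (n ^ 2) / ∏ j ∈ Finset.range n, (r ^ (2 * n) - r ^ (2 * j))

/-- Integer powers of a power series with non-zero constant term. -/
noncomputable def seriesZPow (f : PowerSeries ℝ) (c : ℤ) : PowerSeries ℝ :=
  f ^ c.toNat * f⁻¹ ^ (-c).toNat

namespace InvolutiveQuiver

section Series

variable {Q₀ Q₁ : Type*} [Fintype Q₀] [DecidableEq Q₀] [Fintype Q₁] (Q : InvolutiveQuiver Q₀ Q₁)

/-- The slope `μ` series `A_μ^θ` over the finite field `k` with `q` elements: the coefficient of `x_d`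
is the sum of `q^{χ(d,d)/2} / #Aut(U)` over isomorphism classes of semistable representations `U` of
dimension vector `d` if `d` has slope `μ`; the zero representation belongs to every slope. -/
noncomputable def slopeSeries (k : Type*) [Field k] (θ : Q₀ → ℤ) (μ : ℚ) : DimVec Q₀ → ℝ :=
  open Classical in
  fun d => if d = 0 ∨ slope θ d = μ then
      √(Nat.card k : ℝ) ^ Q.euler d d *
        ∑ᶠ U : Quotient (Q.repSetoid k d),
          if Q.IsSemistable θ U.out then 1 / (Nat.card (Q.RepIso U.out U.out) : ℝ) else 0
    else 0

/-- `Ω` is the family of DT invariants `Ω_d^θ`: for every slope `μ`,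
`A_μ^θ = ∏_{μ(d) = μ} 𝔼_q(x_d)^{Ω_d}`, the (finite) product being taken in any order. -/
structure IsDTInvariant (k : Type*) [Field k] (θ : Q₀ → ℤ) (Ω : DimVec Q₀ → ℤ) : Prop where
  zero : Ω 0 = 0
  finite : {d | Ω d ≠ 0}.Finite
  factorization : ∀ (μ : ℚ) (l : List (DimVec Q₀)), l.Nodup →
    (∀ d, d ∈ l ↔ Ω d ≠ 0 ∧ slope θ d = μ) →
    Q.slopeSeries k θ μ = Q.torusProd √(Nat.card k : ℝ)
      (l.map fun d => evalAt (seriesZPow (qDilog √(Nat.card k : ℝ)) (Ω d)) d)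

end Series

namespace DualityStructure

section Series

variable {Q₀ Q₁ : Type*} [Fintype Q₀] [DecidableEq Q₀] [Fintype Q₁] [DecidableEq Q₁]
  {Q : InvolutiveQuiver Q₀ Q₁} (D : Q.DualityStructure)

/-- The action of the quantum torus on its module `Ŝ_Q` of series `∑ S_e ξ_e`, `e` a `σ`-invariant
dimension vector: `x_d ⋆ ξ_e = r^{⟨d, e⟩ + 𝓔(σ(d)) - 𝓔(d)} ξ_{H(d) + e}` with `r = q^{1/2}`. -/
noncomputable def torusAct (r : ℝ) (P : DimVec Q₀ → ℝ) (S : Q.SDimVec → ℝ) : Q.SDimVec → ℝ :=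
  open Classical in
  fun f => ∑ d ∈ Finset.Iic f.1, if Q.hyp d ≤ f.1 then
      P d * S (Q.subHyp f d) *
        r ^ (Q.skew d (Q.subHyp f d).1 + D.modEuler (Q.sigmaDim d) - D.modEuler d)
    else 0

/-- The orientifold DT series `A^{σ,θ}` over the finite field `k` with `q` elements: the coefficient
of `ξ_e` is the sum of `q^{𝓔(e)/2} / #Aut_S(M)` over isometry classes of semistable self-dual
representations `M` of dimension vector `e`. -/
noncomputable def orientifoldSeries (k : Type*) [Field k] (θ : Q₀ → ℤ) : Q.SDimVec → ℝ :=
  open Classical in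
  fun e => √(Nat.card k : ℝ) ^ D.modEuler e.1 *
    ∑ᶠ M : Quotient (D.isometrySetoid k e.1),
      if IsSigmaSemistable θ M.out then 1 / (Nat.card (Isometry M.out M.out) : ℝ) else 0

/-- The factorization
`A^{σ,θ} = ∑_e (∏_{μ(d) = 0} 𝔼_{q²}(q^{1/2 - χ(e,d) - 𝓔(d)} x_d)^{Ω_d}) ⋆ ω_e ξ_e`,
the sum converging coefficientwise. -/
def IsOrientifoldFactorization (k : Type*) [Field k] (θ : Q₀ → ℤ) (Ω : DimVec Q₀ → ℤ)
    (ω : Q.SDimVec → ℝ) : Prop :=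
  ∀ l : List (DimVec Q₀), l.Nodup → (∀ d, d ∈ l ↔ Ω d ≠ 0 ∧ slope θ d = 0) →
    HasSum
      (fun e : Q.SDimVec => D.torusAct √(Nat.card k : ℝ)
        (Q.torusProd √(Nat.card k : ℝ) (l.map fun d => evalAt
          (seriesZPow
            (PowerSeries.rescale
              (√(Nat.card k : ℝ) ^ (1 - 2 * Q.euler e.1 d - 2 * D.modEuler d))
              (qDilog (Nat.card k : ℝ)))
            (Ω d)) d))
        (Pi.single e (ω e)))
      (D.orientifoldSeries k θ)

end Series

end DualityStructure

end InvolutiveQuiver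

end Orientifold

/-!
The semistable representations of a fixed slope `μ` form a semisimple category.  The Tits form of a
quiver of finite type is positive definite (`IsFiniteType.eulerZ_pos`), so that a stable
representation has one-dimensional endomorphism ring and no self-extensions, and genericity of `θ`
together with positivity excludes extensions between different stable representations of the same
slope (`exists_stableSystem`).  Hence the dimension vectors `d` of the stable representations `S_d`
of slope `μ` form a finite set `J`, orthonormal for the Euler form, and the semistable
representations are the sums `⨁ S_d ^ n_d`, with `n_d = χ(d, e)` determined by the dimension vector
`e` (`StableSystem.hasDecomp`).  Their automorphism groups are `∏ GL_{n_d}`, and the variables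
`x_d`, `d ∈ J`, commute, so `A_μ = ∏_{d ∈ J} 𝔼_q(x_d)`: the ordinary invariants form the indicator
function `stableInvariant` of the dimension vectors of stable representations.

At slope zero every `d ∈ J` is `σ`-invariant.  The bilinear pairings of `S_d` with itself form a
line, spanned by a non-degenerate pairing that is symmetric up to a sign `ε_d`.  The sign comes
from a trace.  Interchanging the arguments acts by signed permutations both on the graded bilinear
forms on the total space and on the adjunction equations that cut out the pairings among them;
these spaces have dimensions differing by `χ(d, d) = 1`, so `ε_d` is the difference of the traces,
which are signed numbers of fixed points, and this gives
`ε_d = ∑_{σ(i) = i} s_i d_i + ∑_{σ(a) = a} τ_a s_{t(a)} d_{t(a)}` (`exists_sign`).  The same formula with all signs equal to one shows that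
exactly one basis vector at a fixed node or fixed arrow contributes, so `ε_d = 1` exactly when the
support of `d` meets a fixed node or arrow of positive sign (`exists_dualSystem`); moreover
`2 𝓔(d) = χ(d, d) - ε_d`.

A self-dual representation is `σ`-semistable if and only if the underlying representation is
semistable (`isSigmaSemistable_iff`), and the self-dual structures on `⨁ S_d ^ n_d` are the
families of invertible `ε_d`-symmetric matrices of sizes `n_d` (`card_selfDual`).  Therefore the
coefficients of `A^σ` are products over `d ∈ J` of the masses of `ε_d`-symmetric forms
(`orientifoldSeries_eq`), which are computed by a recursion (`numForms_add_two`) and turn out to be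
coefficients of `𝔼_{q²}` (`localExp_mul_formMass`).  An alternating form has even rank, so an odd
multiplicity `n_d` requires `ε_d = 1`.  Splitting `n_d` into its parity and `2 ⌊n_d / 2⌋` exhibits
the factorization, with invariants the indicator function of the sums of distinct `d ∈ J` with
`ε_d = 1`.

Both families of invariants are unique because the factorizations are triangular with respect to
the total dimension (`IsDTInvariant.unique`, `isOrientifoldFactorization_unique`).
-/

namespace Orientifold

/-! ### Positivity of the Tits form -/

section CartanPositivity

/-- The `A`-form dominates the square of its last coordinate: it is the sum of that square, the
square of the first coordinate and the squares of the successive differences. -/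
theorem cartanA_form_sub_sq (n : ℕ) (x : Fin (n + 1) → ℤ) :
    0 ≤ (∑ i, ∑ j, CartanMatrix.A (n + 1) i j * x i * x j) - x (Fin.last n) ^ 2 ∧
      ((∑ i, ∑ j, CartanMatrix.A (n + 1) i j * x i * x j) - x (Fin.last n) ^ 2 = 0 → x = 0) := by
  induction n with
  | zero =>
    have e : (∑ i, ∑ j, CartanMatrix.A 1 i j * x i * x j) - x (Fin.last 0) ^ 2 = x 0 ^ 2 := by
      simp [CartanMatrix.A]; ring
    refine e.symm ▸ ⟨sq_nonneg _, fun h => ?_⟩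
    funext i
    obtain rfl : i = 0 := Fin.eq_zero i
    simpa using h
  | succ n ih =>
    obtain ⟨h1, h2⟩ := ih (fun i => x i.castSucc)
    have key : (∑ i, ∑ j, CartanMatrix.A (n + 1 + 1) i j * x i * x j) - x (Fin.last (n + 1)) ^ 2
        = ((∑ i, ∑ j, CartanMatrix.A (n + 1) i j * x i.castSucc * x j.castSucc)
            - x (Fin.last n).castSucc ^ 2)
          + (x (Fin.last (n + 1)) - x (Fin.last n).castSucc) ^ 2 := by
      have hA : ∀ i j : Fin (n + 1),
          CartanMatrix.A (n + 1 + 1) i.castSucc j.castSucc = CartanMatrix.A (n + 1) i j := by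
        intro i j
        simp [CartanMatrix.A]
      have hl : ∀ i : Fin (n + 1), CartanMatrix.A (n + 1 + 1) i.castSucc (Fin.last (n + 1))
          = if i = Fin.last n then -1 else 0 := by
        intro i
        simp only [CartanMatrix.A, Matrix.of_apply, Fin.ext_iff, Fin.val_castSucc, Fin.val_last]
        have := i.2
        split_ifs <;> omega
      have hr : ∀ i : Fin (n + 1), CartanMatrix.A (n + 1 + 1) (Fin.last (n + 1)) i.castSucc
          = if i = Fin.last n then -1 else 0 := by
        intro i
        simp only [CartanMatrix.A, Matrix.of_apply, Fin.ext_iff, Fin.val_castSucc, Fin.val_last]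
        have := i.2
        split_ifs <;> omega
      have hd : CartanMatrix.A (n + 1 + 1) (Fin.last (n + 1)) (Fin.last (n + 1)) = 2 := by
        simp [CartanMatrix.A]
      rw [Fin.sum_univ_castSucc]
      simp only [Fin.sum_univ_castSucc (n := n + 1), hA, hl, hr, hd, Finset.sum_add_distrib,
        ite_mul, zero_mul, Finset.sum_ite_eq', Finset.mem_univ, if_true]
      ring
    rw [key]
    refine ⟨add_nonneg h1 (sq_nonneg _), fun h => ?_⟩
    have h3 := sq_nonneg (x (Fin.last (n + 1)) - x (Fin.last n).castSucc)
    have h4 : (x (Fin.last (n + 1)) - x (Fin.last n).castSucc) ^ 2 = 0 := by linarith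
    have h5 := h2 (by linarith)
    have h6 : x (Fin.last (n + 1)) = x (Fin.last n).castSucc := by
      have := pow_eq_zero_iff (two_ne_zero) |>.mp h4
      linarith
    funext i
    refine Fin.lastCases ?_ (fun i => ?_) i
    · rw [h6]; exact congrFun h5 _
    · exact congrFun h5 i

theorem cartanA_form_pos (n : ℕ) (x : Fin n → ℤ) (hx : x ≠ 0) :
    0 < ∑ i, ∑ j, CartanMatrix.A n i j * x i * x j := by
  cases n with
  | zero => exact absurd (Subsingleton.elim _ _) hx
  | succ n =>
    obtain ⟨h1, h2⟩ := cartanA_form_sub_sq n x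
    have h3 := sq_nonneg (x (Fin.last n))
    have h4 : (∑ i, ∑ j, CartanMatrix.A (n + 1) i j * x i * x j) - x (Fin.last n) ^ 2 ≠ 0 :=
      fun h => hx (h2 h)
    have := lt_of_le_of_ne h1 h4.symm
    linarith

theorem cartanD_form_pos (n : ℕ) (x : Fin n → ℤ) (hx : x ≠ 0) :
    0 < ∑ i, ∑ j, CartanMatrix.D n i j * x i * x j := by
  match n, x, hx with
  | 0, x, hx => exact absurd (Subsingleton.elim _ _) hx
  | 1, x, hx => rw [CartanMatrix.D_one]; exact cartanA_form_pos 1 x hx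
  | 2, x, hx =>
    have e : ∑ i, ∑ j, CartanMatrix.D 2 i j * x i * x j = 2 * (x 0 ^ 2 + x 1 ^ 2) := by
      rw [CartanMatrix.D_two]; simp [Fin.sum_univ_two]; ring
    rw [e]
    by_contra h
    have h0 : x 0 = 0 := by nlinarith [sq_nonneg (x 0), sq_nonneg (x 1)]
    have h1 : x 1 = 0 := by nlinarith [sq_nonneg (x 0), sq_nonneg (x 1)]
    exact hx (by funext i; fin_cases i <;> simp [h0, h1])
  | n + 3, x, hx =>
    -- Removing the two end nodes of the fork leaves a diagram of type `A`.
    set y := x (Fin.last (n + 1)).castSucc with hy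
    set z := x (Fin.last (n + 2)) with hz
    obtain ⟨h1, h2⟩ := cartanA_form_sub_sq n (fun i => x i.castSucc.castSucc)
    have key : (∑ i, ∑ j, CartanMatrix.D (n + 3) i j * x i * x j)
        = ((∑ i, ∑ j, CartanMatrix.A (n + 1) i j * x i.castSucc.castSucc * x j.castSucc.castSucc)
            - x (Fin.last n).castSucc.castSucc ^ 2)
          + (x (Fin.last n).castSucc.castSucc - y - z) ^ 2 + (y - z) ^ 2 := by
      have e1 : ∀ i j : Fin (n + 1), CartanMatrix.D (n + 3) i.castSucc.castSucc j.castSucc.castSucc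
          = CartanMatrix.A (n + 1) i j := by
        intro i j
        have := i.2
        have := j.2
        simp only [CartanMatrix.A, CartanMatrix.D, Matrix.of_apply, Fin.ext_iff, Fin.val_castSucc]
        split_ifs <;> omega
      have e2 : ∀ i : Fin (n + 1), CartanMatrix.D (n + 3) i.castSucc.castSucc
          (Fin.last (n + 1)).castSucc = if i = Fin.last n then -1 else 0 := by
        intro i
        have := i.2
        simp only [CartanMatrix.D, Matrix.of_apply, Fin.ext_iff, Fin.val_castSucc, Fin.val_last]
        grind
      have e3 : ∀ i : Fin (n + 1), CartanMatrix.D (n + 3) (Fin.last (n + 1)).castSucc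
          i.castSucc.castSucc = if i = Fin.last n then -1 else 0 := by
        intro i
        have := i.2
        simp only [CartanMatrix.D, Matrix.of_apply, Fin.ext_iff, Fin.val_castSucc, Fin.val_last]
        grind
      have e4 : ∀ i : Fin (n + 1), CartanMatrix.D (n + 3) i.castSucc.castSucc
          (Fin.last (n + 2)) = if i = Fin.last n then -1 else 0 := by
        intro i
        have := i.2
        simp only [CartanMatrix.D, Matrix.of_apply, Fin.ext_iff, Fin.val_castSucc, Fin.val_last]
        grind
      have e5 : ∀ i : Fin (n + 1), CartanMatrix.D (n + 3) (Fin.last (n + 2))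
          i.castSucc.castSucc = if i = Fin.last n then -1 else 0 := by
        intro i
        have := i.2
        simp only [CartanMatrix.D, Matrix.of_apply, Fin.ext_iff, Fin.val_castSucc, Fin.val_last]
        grind
      have e6 : CartanMatrix.D (n + 3) (Fin.last (n + 2)) (Fin.last (n + 1)).castSucc = 0 := by
        simp only [CartanMatrix.D, Matrix.of_apply, Fin.ext_iff, Fin.val_castSucc, Fin.val_last]
        split_ifs <;> omega
      have e7 : CartanMatrix.D (n + 3) (Fin.last (n + 1)).castSucc (Fin.last (n + 2)) = 0 := by
        simp only [CartanMatrix.D, Matrix.of_apply, Fin.ext_iff, Fin.val_castSucc, Fin.val_last]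
        split_ifs <;> omega
      rw [Fin.sum_univ_castSucc, Fin.sum_univ_castSucc]
      simp only [Fin.sum_univ_castSucc (n := n + 2), Fin.sum_univ_castSucc (n := n + 1), e1, e2, e3,
        e4, e5, e6, e7, CartanMatrix.D_diag, Finset.sum_add_distrib,
        ite_mul, zero_mul, Finset.sum_ite_eq', Finset.mem_univ, if_true, ← hy, ← hz]
      ring
    rw [key]
    by_contra h
    have h3 := sq_nonneg (x (Fin.last n).castSucc.castSucc - y - z)
    have h4 := sq_nonneg (y - z)
    have h5 := h2 (by linarith)
    have h6 : (x (Fin.last n).castSucc.castSucc - y - z) ^ 2 = 0 := by linarith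
    have h7 : (y - z) ^ 2 = 0 := by linarith
    have h8 : x (Fin.last n).castSucc.castSucc = 0 := congrFun h5 (Fin.last n)
    rw [pow_eq_zero_iff two_ne_zero] at h6 h7
    apply hx
    funext i
    refine Fin.lastCases ?_ (fun i => Fin.lastCases ?_ (fun i => congrFun h5 i) i) i
    · show z = 0
      omega
    · show y = 0
      omega

/-- The `E₈`-form is positive: an explicit sum of squares, obtained by completing squares from the
three ends of the diagram towards the trivalent node. -/
theorem e8_form_pos (a b c d e f g h : ℤ)
    (H : a ^ 2 + b ^ 2 + c ^ 2 + d ^ 2 + e ^ 2 + f ^ 2 + g ^ 2 + h ^ 2 ≤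
      a * c + b * d + c * d + d * e + e * f + f * g + g * h) :
    a = 0 ∧ b = 0 ∧ c = 0 ∧ d = 0 ∧ e = 0 ∧ f = 0 ∧ g = 0 ∧ h = 0 := by
  have key : 30 * (2 * a - c) ^ 2 + 10 * (3 * c - 2 * d) ^ 2 + 30 * (2 * b - d) ^ 2
      + 30 * (2 * h - g) ^ 2 + 10 * (3 * g - 2 * f) ^ 2 + 5 * (4 * f - 3 * e) ^ 2
      + 3 * (5 * e - 4 * d) ^ 2 + 2 * d ^ 2 ≤ 0 := by nlinarith
  have p1 := sq_nonneg (2 * a - c)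
  have p2 := sq_nonneg (3 * c - 2 * d)
  have p3 := sq_nonneg (2 * b - d)
  have p4 := sq_nonneg (2 * h - g)
  have p5 := sq_nonneg (3 * g - 2 * f)
  have p6 := sq_nonneg (4 * f - 3 * e)
  have p7 := sq_nonneg (5 * e - 4 * d)
  have p8 := sq_nonneg d
  have q1 : (2 * a - c) ^ 2 = 0 := by linarith
  have q2 : (3 * c - 2 * d) ^ 2 = 0 := by linarith
  have q3 : (2 * b - d) ^ 2 = 0 := by linarith
  have q4 : (2 * h - g) ^ 2 = 0 := by linarith
  have q5 : (3 * g - 2 * f) ^ 2 = 0 := by linarith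
  have q6 : (4 * f - 3 * e) ^ 2 = 0 := by linarith
  have q7 : (5 * e - 4 * d) ^ 2 = 0 := by linarith
  have q8 : d ^ 2 = 0 := by linarith
  rw [pow_eq_zero_iff two_ne_zero] at q1 q2 q3 q4 q5 q6 q7 q8
  omega

theorem cartanE_form_pos :
    (∀ x : Fin 6 → ℤ, x ≠ 0 → 0 < ∑ i, ∑ j, CartanMatrix.E₆ i j * x i * x j) ∧
    (∀ x : Fin 7 → ℤ, x ≠ 0 → 0 < ∑ i, ∑ j, CartanMatrix.E₇ i j * x i * x j) ∧
    (∀ x : Fin 8 → ℤ, x ≠ 0 → 0 < ∑ i, ∑ j, CartanMatrix.E₈ i j * x i * x j) := by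
  refine ⟨fun x hx => ?_, fun x hx => ?_, fun x hx => ?_⟩
  · by_contra h
    refine hx ?_
    have e : ∑ i, ∑ j, CartanMatrix.E₆ i j * x i * x j
      = 2 * (x 0 ^ 2 + x 1 ^ 2 + x 2 ^ 2 + x 3 ^ 2 + x 4 ^ 2 + x 5 ^ 2
        - (x 0 * x 2 + x 1 * x 3 + x 2 * x 3 + x 3 * x 4 + x 4 * x 5)) := by
      simp [CartanMatrix.E₆, Fin.sum_univ_succ]; ring
    rw [e] at h
    obtain ⟨h0, h1, h2, h3, h4, h5, -, -⟩ :=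
      e8_form_pos (x 0) (x 1) (x 2) (x 3) (x 4) (x 5) 0 0 (by linarith)
    funext i
    fin_cases i <;> assumption
  · by_contra h
    refine hx ?_
    have e : ∑ i, ∑ j, CartanMatrix.E₇ i j * x i * x j
      = 2 * (x 0 ^ 2 + x 1 ^ 2 + x 2 ^ 2 + x 3 ^ 2 + x 4 ^ 2 + x 5 ^ 2 + x 6 ^ 2
        - (x 0 * x 2 + x 1 * x 3 + x 2 * x 3 + x 3 * x 4 + x 4 * x 5 + x 5 * x 6)) := by
      simp [CartanMatrix.E₇, Fin.sum_univ_succ]; ring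
    rw [e] at h
    obtain ⟨h0, h1, h2, h3, h4, h5, h6, -⟩ :=
      e8_form_pos (x 0) (x 1) (x 2) (x 3) (x 4) (x 5) (x 6) 0 (by linarith)
    funext i
    fin_cases i <;> assumption
  · by_contra h
    refine hx ?_
    have e : ∑ i, ∑ j, CartanMatrix.E₈ i j * x i * x j
      = 2 * (x 0 ^ 2 + x 1 ^ 2 + x 2 ^ 2 + x 3 ^ 2 + x 4 ^ 2 + x 5 ^ 2 + x 6 ^ 2 + x 7 ^ 2
        - (x 0 * x 2 + x 1 * x 3 + x 2 * x 3 + x 3 * x 4 + x 4 * x 5 + x 5 * x 6 + x 6 * x 7)) := by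
      simp [CartanMatrix.E₈, Fin.sum_univ_succ]; ring
    rw [e] at h
    obtain ⟨h0, h1, h2, h3, h4, h5, h6, h7⟩ :=
      e8_form_pos (x 0) (x 1) (x 2) (x 3) (x 4) (x 5) (x 6) (x 7) (by linarith)
    funext i
    fin_cases i <;> assumption

theorem DynkinType.cartan_form_pos (T : DynkinType) (x : Fin T.rank → ℤ) (hx : x ≠ 0) :
    0 < ∑ i, ∑ j, T.cartan i j * x i * x j := by
  cases T with
  | A n => exact cartanA_form_pos n x hx
  | D n => exact cartanD_form_pos n x hx
  | E₆ => exact cartanE_form_pos.1 x hx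
  | E₇ => exact cartanE_form_pos.2.1 x hx
  | E₈ => exact cartanE_form_pos.2.2 x hx

end CartanPositivity

namespace InvolutiveQuiver

variable {Q₀ Q₁ : Type*} [Fintype Q₀] [Fintype Q₁] (Q : InvolutiveQuiver Q₀ Q₁)

/-- The Euler form on the lattice `ℤ Q₀`. -/
def eulerZ (x y : Q₀ → ℤ) : ℤ := ∑ i, x i * y i - ∑ a, x (Q.src a) * y (Q.tgt a)

theorem eulerZ_add_left (x x' y : Q₀ → ℤ) :
    Q.eulerZ (x + x') y = Q.eulerZ x y + Q.eulerZ x' y := by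
  simp only [eulerZ, Pi.add_apply, add_mul, Finset.sum_add_distrib]; ring

theorem eulerZ_add_right (x y y' : Q₀ → ℤ) :
    Q.eulerZ x (y + y') = Q.eulerZ x y + Q.eulerZ x y' := by
  simp only [eulerZ, Pi.add_apply, mul_add, Finset.sum_add_distrib]; ring

theorem eulerZ_smul_left (c : ℤ) (x y : Q₀ → ℤ) : Q.eulerZ (c • x) y = c * Q.eulerZ x y := by
  simp only [eulerZ, Pi.smul_apply, smul_eq_mul, mul_sub, Finset.mul_sum, mul_assoc]

theorem eulerZ_smul_right (c : ℤ) (x y : Q₀ → ℤ) : Q.eulerZ x (c • y) = c * Q.eulerZ x y := by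
  simp only [eulerZ, Pi.smul_apply, smul_eq_mul, mul_sub, Finset.mul_sum]
  congr 1 <;> exact Finset.sum_congr rfl fun _ _ => by ring

theorem euler_eq_eulerZ (d d' : DimVec Q₀) :
    Q.euler d d' = Q.eulerZ (fun i => d i) (fun i => d' i) := rfl

theorem euler_add_left (x x' y : DimVec Q₀) :
    Q.euler (x + x') y = Q.euler x y + Q.euler x' y := by
  simp only [euler, Pi.add_apply, Nat.cast_add, add_mul, Finset.sum_add_distrib]; ring

theorem euler_add_right (x y y' : DimVec Q₀) :
    Q.euler x (y + y') = Q.euler x y + Q.euler x y' := by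
  simp only [euler, Pi.add_apply, Nat.cast_add, mul_add, Finset.sum_add_distrib]; ring

theorem euler_smul_left (c : ℕ) (x y : DimVec Q₀) : Q.euler (c • x) y = c * Q.euler x y := by
  simp only [euler, Pi.smul_apply, smul_eq_mul, Nat.cast_mul, mul_sub, Finset.mul_sum, mul_assoc]

theorem euler_smul_right (c : ℕ) (x y : DimVec Q₀) : Q.euler x (c • y) = c * Q.euler x y := by
  simp only [euler, Pi.smul_apply, smul_eq_mul, Nat.cast_mul, mul_sub, Finset.mul_sum]
  congr 1 <;> exact Finset.sum_congr rfl fun _ _ => by ring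

theorem euler_zero_left (y : DimVec Q₀) : Q.euler 0 y = 0 := by simp [euler]

theorem euler_zero_right (y : DimVec Q₀) : Q.euler y 0 = 0 := by simp [euler]

theorem euler_sum_left {ι : Type*} (s : Finset ι) (f : ι → DimVec Q₀) (y : DimVec Q₀) :
    Q.euler (∑ i ∈ s, f i) y = ∑ i ∈ s, Q.euler (f i) y := by
  classical
  induction s using Finset.induction_on with
  | empty => simp [euler_zero_left]
  | insert i s hi ih => rw [Finset.sum_insert hi, Finset.sum_insert hi, euler_add_left, ih]

theorem euler_sum_right {ι : Type*} (s : Finset ι) (f : ι → DimVec Q₀) (y : DimVec Q₀) :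
    Q.euler y (∑ i ∈ s, f i) = ∑ i ∈ s, Q.euler y (f i) := by
  classical
  induction s using Finset.induction_on with
  | empty => simp [euler_zero_right]
  | insert i s hi ih => rw [Finset.sum_insert hi, Finset.sum_insert hi, euler_add_right, ih]

variable {Q} in
/-- The Tits form of a finite type quiver is positive definite. -/
theorem IsFiniteType.eulerZ_pos [DecidableEq Q₀] (hQ : Q.IsFiniteType) (x : Q₀ → ℤ) (hx : x ≠ 0) :
    0 < Q.eulerZ x x := by
  obtain ⟨m, T, f, hf⟩ := hQ
  have h1 : 2 * Q.eulerZ x x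
      = ∑ i, ∑ j, Matrix.blockDiagonal' (fun c => (T c).cartan) (f i) (f j) * x i * x j := by
    have hs : ∀ (u v : Q₁ → Q₀),
        ∑ i, ∑ j, ((Finset.univ.filter fun a => u a = i ∧ v a = j).card : ℤ) * x i * x j
          = ∑ a, x (u a) * x (v a) := by
      intro u v
      simp only [Finset.card_filter, Nat.cast_sum, Finset.sum_mul]
      calc _ = ∑ i, ∑ a, ∑ j, ((if u a = i ∧ v a = j then 1 else 0 : ℕ) : ℤ) * x i * x j :=
            Finset.sum_congr rfl fun i _ => Finset.sum_comm
        _ = ∑ a, ∑ i, ∑ j, ((if u a = i ∧ v a = j then 1 else 0 : ℕ) : ℤ) * x i * x j :=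
            Finset.sum_comm
        _ = _ := by
            refine Finset.sum_congr rfl fun a _ => ?_
            simp [ite_and]
    have hs2 : ∑ i, ∑ j, ((Finset.univ.filter fun a => Q.src a = j ∧ Q.tgt a = i).card : ℤ)
        * x i * x j = ∑ a, x (Q.src a) * x (Q.tgt a) := by
      rw [← hs Q.src Q.tgt, Finset.sum_comm]
      exact Finset.sum_congr rfl fun i _ => Finset.sum_congr rfl fun j _ => by ring
    have hd : ∑ i, ∑ j, (if i = j then (2 : ℤ) else 0) * x i * x j = 2 * ∑ i, x i * x i := by
      simp [Finset.mul_sum, mul_assoc]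
    simp only [← hf, sub_mul, Finset.sum_sub_distrib, hs, hs2, hd]
    unfold eulerZ
    ring
  have h2 : ∑ i, ∑ j, Matrix.blockDiagonal' (fun c => (T c).cartan) (f i) (f j) * x i * x j
      = ∑ c, ∑ i, ∑ j, (T c).cartan i j * x (f.symm ⟨c, i⟩) * x (f.symm ⟨c, j⟩) := by
    have : ∑ i, ∑ j, Matrix.blockDiagonal' (fun c => (T c).cartan) (f i) (f j) * x i * x j
        = ∑ p, ∑ p', Matrix.blockDiagonal' (fun c => (T c).cartan) p p'
          * x (f.symm p) * x (f.symm p') := by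
      rw [← f.sum_comp]
      refine Finset.sum_congr rfl fun i _ => ?_
      rw [← f.sum_comp]
      simp
    rw [this, Fintype.sum_sigma]
    refine Finset.sum_congr rfl fun c _ => Finset.sum_congr rfl fun i _ => ?_
    rw [Fintype.sum_sigma, Finset.sum_eq_single c]
    · exact Finset.sum_congr rfl fun j _ => by rw [Matrix.blockDiagonal'_apply_eq]
    · intro c' _ hc
      refine Finset.sum_eq_zero fun j _ => ?_
      rw [Matrix.blockDiagonal'_apply_ne _ _ _ hc.symm, zero_mul, zero_mul]
    · simp
  have h3 : 0 < 2 * Q.eulerZ x x := by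
    rw [h1, h2]
    have hnn : ∀ c, 0 ≤ ∑ i, ∑ j, (T c).cartan i j * x (f.symm ⟨c, i⟩) * x (f.symm ⟨c, j⟩) := by
      intro c
      by_cases h : (fun i => x (f.symm ⟨c, i⟩)) = 0
      · have h' : ∀ i, x (f.symm ⟨c, i⟩) = 0 := fun i => congrFun h i
        simp [h']
      · exact ((T c).cartan_form_pos _ h).le
    obtain ⟨i, hi⟩ := Function.ne_iff.mp hx
    refine Finset.sum_pos' (fun c _ => hnn c) ⟨(f i).1, Finset.mem_univ _, ?_⟩
    refine (T (f i).1).cartan_form_pos (fun j => x (f.symm ⟨(f i).1, j⟩)) ?_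
    refine Function.ne_iff.mpr ⟨(f i).2, ?_⟩
    simpa using hi
  linarith

variable {Q} in
theorem IsFiniteType.euler_pos [DecidableEq Q₀] (hQ : Q.IsFiniteType) (d : DimVec Q₀) (hd : d ≠ 0) :
    0 < Q.euler d d := by
  refine hQ.eulerZ_pos _ fun h => hd ?_
  funext i
  simpa using congrFun h i

variable {Q} in
/-- There are finitely many positive roots: two different roots cannot be congruent modulo `3`, as
their difference has Tits norm at most `4`, which is less than `9`. -/
theorem IsFiniteType.finite_roots [DecidableEq Q₀] (hQ : Q.IsFiniteType) :
    {d : DimVec Q₀ | Q.euler d d = 1}.Finite := by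
  refine Set.Finite.of_injOn (f := fun d : DimVec Q₀ => fun i => ((d i : ℕ) : ZMod 3))
    (t := Set.univ) (fun _ _ => Set.mem_univ _) ?_ Set.finite_univ
  intro d hd e he hde
  simp only [Set.mem_ofPred_eq, euler_eq_eulerZ] at hd he
  set x : Q₀ → ℤ := fun i => d i with hx
  set y : Q₀ → ℤ := fun i => e i with hy
  have hdvd : ∀ i, (3 : ℤ) ∣ x i - y i := by
    intro i
    have := congrFun hde i
    simp only at this
    refine (ZMod.intCast_zmod_eq_zero_iff_dvd _ 3).mp ?_
    simp [hx, hy, this]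
  choose z hz using hdvd
  have hxz : x = y + (3 : ℤ) • z := by
    funext i
    have := hz i
    simp only [Pi.add_apply, Pi.smul_apply, smul_eq_mul]
    linarith
  by_cases hz0 : z = 0
  · funext i
    have := congrFun hxz i
    simpa [hz0, hx, hy] using this
  · exfalso
    have h1 := hQ.eulerZ_pos z hz0
    -- The parallelogram law bounds the norm of `x - y = 3 z` by `2 + 2 = 4`.
    have h2 : 0 ≤ Q.eulerZ (x + y) (x + y) := by
      by_cases h : x + y = 0
      · rw [h]; simp [eulerZ]
      · exact (hQ.eulerZ_pos _ h).le
    have h3 : Q.eulerZ ((3 : ℤ) • z) ((3 : ℤ) • z) = 9 * Q.eulerZ z z := by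
      rw [eulerZ_smul_left, eulerZ_smul_right]; ring
    set w := (3 : ℤ) • z
    rw [hxz] at hd h2
    simp only [eulerZ_add_left, eulerZ_add_right] at hd h2
    linarith

/-! ### Homomorphisms and extensions of representations -/

section Hom

variable {Q₀ Q₁ : Type*} {Q : InvolutiveQuiver Q₀ Q₁} {k : Type*} [Field k] {d e f : DimVec Q₀}

/-- Graded linear maps between the total spaces of two dimension vectors. -/
abbrev GrHom (k : Type*) [Field k] (d e : DimVec Q₀) :=
  ∀ i, (Fin (d i) → k) →ₗ[k] (Fin (e i) → k)

/-- A graded linear map is a homomorphism of representations. -/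
def IsHom (M : Q.Rep k d) (N : Q.Rep k e) (φ : GrHom k d e) : Prop :=
  ∀ a x, φ (Q.tgt a) (M a x) = N a (φ (Q.src a) x)

theorem IsHom.comp {M : Q.Rep k d} {N : Q.Rep k e} {P : Q.Rep k f} {φ : GrHom k d e}
    {ψ : GrHom k e f} (hψ : IsHom N P ψ) (hφ : IsHom M N φ) :
    IsHom M P (fun i => ψ i ∘ₗ φ i) := fun a x => by
  simp only [LinearMap.comp_apply, hφ a x, hψ a]

theorem isHom_id (M : Q.Rep k d) : IsHom M M (fun _ => LinearMap.id) := fun _ _ => rfl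

/-- The differential `φ ↦ N φ - φ M` whose kernel is `Hom(M, N)` and whose cokernel is
`Ext¹(M, N)`. -/
def homDiff (M : Q.Rep k d) (N : Q.Rep k e) :
    GrHom k d e →ₗ[k] (∀ a, (Fin (d (Q.src a)) → k) →ₗ[k] (Fin (e (Q.tgt a)) → k)) where
  toFun φ a := N a ∘ₗ φ (Q.src a) - φ (Q.tgt a) ∘ₗ M a
  map_add' φ ψ := by
    funext a
    refine LinearMap.ext fun x => ?_
    simp only [Pi.add_apply, LinearMap.sub_apply, LinearMap.comp_apply, LinearMap.add_apply,
      map_add]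
    abel
  map_smul' c φ := by
    funext a
    refine LinearMap.ext fun x => ?_
    simp [smul_sub]

theorem mem_ker_homDiff {M : Q.Rep k d} {N : Q.Rep k e} {φ : GrHom k d e} :
    φ ∈ LinearMap.ker (homDiff M N) ↔ IsHom M N φ := by
  rw [LinearMap.mem_ker]
  constructor
  · intro h a x
    have := LinearMap.congr_fun (congrFun h a) x
    simp only [homDiff, LinearMap.coe_mk, AddHom.coe_mk, LinearMap.sub_apply,
      LinearMap.comp_apply, Pi.zero_apply, LinearMap.zero_apply] at this
    exact (sub_eq_zero.mp this).symm
  · intro h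
    funext a
    refine LinearMap.ext fun x => ?_
    simp [homDiff, h a x]

/-- The space of homomorphisms. -/
abbrev homSpace (M : Q.Rep k d) (N : Q.Rep k e) : Submodule k (GrHom k d e) :=
  LinearMap.ker (homDiff M N)

/-- The vanishing of `Ext¹(M, N)`. -/
def ExtVanishes (M : Q.Rep k d) (N : Q.Rep k e) : Prop := Function.Surjective (homDiff M N)

variable [Fintype Q₀] [Fintype Q₁]

/-- The Euler form is `dim Hom - dim Ext¹`. -/
theorem exists_finrank_homSpace (M : Q.Rep k d) (N : Q.Rep k e) :
    ∃ c : ℕ, (Module.finrank k (homSpace M N) : ℤ) = Q.euler d e + c ∧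
      (c = 0 → ExtVanishes M N) := by
  classical
  have h1 := LinearMap.finrank_range_add_finrank_ker (homDiff M N)
  have h2 := Submodule.finrank_quotient_add_finrank (LinearMap.range (homDiff M N))
  have h3 : Module.finrank k (GrHom k d e) = ∑ i, d i * e i := by
    rw [Module.finrank_pi_fintype]
    simp [Module.finrank_linearMap]
  have h4 : Module.finrank k (∀ a, (Fin (d (Q.src a)) → k) →ₗ[k] (Fin (e (Q.tgt a)) → k))
      = ∑ a, d (Q.src a) * e (Q.tgt a) := by
    rw [Module.finrank_pi_fintype]
    simp [Module.finrank_linearMap]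
  rw [h3] at h1
  rw [h4] at h2
  refine ⟨Module.finrank k (_ ⧸ LinearMap.range (homDiff M N)), ?_, fun h => ?_⟩
  · unfold euler
    zify at h1 h2
    linarith
  · rw [h, zero_add, ← h4] at h2
    exact LinearMap.range_eq_top.mp (Submodule.eq_top_of_finrank_eq h2)

omit [Fintype Q₀] [Fintype Q₁] in
/-- If `Ext¹(T, N) = 0`, then homomorphisms from `T` lift along an epimorphism with kernel `N`. -/
theorem ExtVanishes.exists_lift {T : Q.Rep k f} {N : Q.Rep k d} {U : Q.Rep k e} {d' : DimVec Q₀}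
    {P : Q.Rep k d'} (h : ExtVanishes T N) {j : GrHom k d e} {p : GrHom k e d'}
    (hj : IsHom N U j) (hp : IsHom U P p) (hp' : ∀ i, Function.Surjective (p i))
    (hjp : ∀ i, LinearMap.ker (p i) = LinearMap.range (j i)) {g : GrHom k f d'}
    (hg : IsHom T P g) : ∃ g' : GrHom k f e, IsHom T U g' ∧ ∀ i, p i ∘ₗ g' i = g i := by
  have h1 : ∀ i, ∃ s : (Fin (f i) → k) →ₗ[k] (Fin (e i) → k), p i ∘ₗ s = g i := by
    intro i
    obtain ⟨r, hr⟩ := (p i).exists_rightInverse_of_surjective (LinearMap.range_eq_top.mpr (hp' i))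
    exact ⟨r ∘ₗ g i, by rw [← LinearMap.comp_assoc, hr, LinearMap.id_comp]⟩
  choose s hs using h1
  -- The failure of the linear lift `s` to be a homomorphism takes values in `N`.
  have h2 : ∀ a, ∃ c : (Fin (f (Q.src a)) → k) →ₗ[k] (Fin (d (Q.tgt a)) → k),
      j (Q.tgt a) ∘ₗ c = homDiff T U s a := by
    intro a
    have hr : LinearMap.range (homDiff T U s a) ≤ LinearMap.range (j (Q.tgt a)) := by
      rintro _ ⟨x, rfl⟩
      rw [← hjp, LinearMap.mem_ker]
      have e1 : ∀ i x, p i (s i x) = g i x := fun i x => LinearMap.congr_fun (hs i) x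
      simp [homDiff, hp a, e1, hg a x]
    obtain ⟨r, hr'⟩ := (j (Q.tgt a)).rangeRestrict.exists_rightInverse_of_surjective
      (LinearMap.range_rangeRestrict _)
    refine ⟨r ∘ₗ (LinearMap.codRestrict _ (homDiff T U s a) fun x => hr ⟨x, rfl⟩), ?_⟩
    refine LinearMap.ext fun x => ?_
    have := LinearMap.congr_fun hr' (LinearMap.codRestrict (LinearMap.range (j (Q.tgt a)))
      (homDiff T U s a) (fun x => hr ⟨x, rfl⟩) x)
    exact congrArg Subtype.val this
  choose c hc using h2
  obtain ⟨t, ht⟩ := h c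
  refine ⟨fun i => s i - j i ∘ₗ t i, ?_, ?_⟩
  · rw [← mem_ker_homDiff, LinearMap.mem_ker]
    funext a
    refine LinearMap.ext fun x => ?_
    have e1 := LinearMap.congr_fun (hc a) x
    have e2 := LinearMap.congr_fun (congrFun ht a) x
    simp only [homDiff, LinearMap.coe_mk, AddHom.coe_mk, LinearMap.sub_apply,
      LinearMap.comp_apply] at e1 e2
    simp only [homDiff, LinearMap.coe_mk, AddHom.coe_mk, LinearMap.sub_apply,
      LinearMap.comp_apply, map_sub, Pi.zero_apply, LinearMap.zero_apply]
    rw [← e2, map_sub, hj a] at e1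
    rw [sub_sub_sub_comm, ← e1]
    abel
  · intro i
    refine LinearMap.ext fun x => ?_
    have : p i (j i (t i x)) = 0 := by
      rw [← LinearMap.mem_ker, hjp]; exact ⟨_, rfl⟩
    simp only [LinearMap.comp_apply, LinearMap.sub_apply, map_sub, this, sub_zero]
    exact LinearMap.congr_fun (hs i) x

end Hom

/-! ### Stability -/

section Stability

variable {Q₀ Q₁ : Type*} [Fintype Q₀] {Q : InvolutiveQuiver Q₀ Q₁} {k : Type*} [Field k]
  {d e : DimVec Q₀}

/-- The linear function `θ - μ dim`, which vanishes on the dimension vectors of slope `μ`. -/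
def lam (θ : Q₀ → ℤ) (μ : ℚ) (v : DimVec Q₀) : ℚ := ∑ i, ((θ i : ℚ) - μ) * v i

theorem lam_add (θ : Q₀ → ℤ) (μ : ℚ) (v w : DimVec Q₀) :
    lam θ μ (v + w) = lam θ μ v + lam θ μ w := by
  simp [lam, mul_add, Finset.sum_add_distrib]

theorem lam_zero (θ : Q₀ → ℤ) (μ : ℚ) : lam θ μ (0 : DimVec Q₀) = 0 := by simp [lam]

theorem lam_eq (θ : Q₀ → ℤ) (μ : ℚ) (v : DimVec Q₀) :
    lam θ μ v = (∑ i, (θ i : ℚ) * v i) - μ * ∑ i, (v i : ℚ) := by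
  simp [lam, sub_mul, Finset.sum_sub_distrib, Finset.mul_sum]

theorem sum_pos_of_ne_zero {v : DimVec Q₀} (hv : v ≠ 0) : 0 < ∑ i, (v i : ℚ) := by
  obtain ⟨i, hi⟩ := Function.ne_iff.mp hv
  refine Finset.sum_pos' (fun _ _ => by positivity) ⟨i, Finset.mem_univ _, ?_⟩
  exact_mod_cast Nat.pos_of_ne_zero hi

theorem slope_le_iff {θ : Q₀ → ℤ} {μ : ℚ} {v : DimVec Q₀} (hv : v ≠ 0) :
    slope θ v ≤ μ ↔ lam θ μ v ≤ 0 := by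
  rw [lam_eq, slope, div_le_iff₀ (sum_pos_of_ne_zero hv), sub_nonpos]

theorem slope_eq_iff {θ : Q₀ → ℤ} {μ : ℚ} {v : DimVec Q₀} (hv : v ≠ 0) :
    slope θ v = μ ↔ lam θ μ v = 0 := by
  rw [lam_eq, slope, div_eq_iff (sum_pos_of_ne_zero hv).ne', sub_eq_zero]

/-- `M` is zero, or semistable of slope `μ`. -/
structure IsSS (θ : Q₀ → ℤ) (μ : ℚ) (M : Q.Rep k d) : Prop where
  lam_eq_zero : lam θ μ d = 0
  lam_le : ∀ W : ∀ i, Submodule k (Fin (d i) → k), Q.IsSubrep M W → lam θ μ (subDim W) ≤ 0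

/-- `M` is stable of slope `μ`. -/
structure IsStable (θ : Q₀ → ℤ) (μ : ℚ) (M : Q.Rep k d) : Prop extends Q.IsSS θ μ M where
  ne_zero : d ≠ 0
  eq_bot_or_top : ∀ W : ∀ i, Submodule k (Fin (d i) → k), Q.IsSubrep M W →
    lam θ μ (subDim W) = 0 → (∀ i, W i = ⊥) ∨ ∀ i, W i = ⊤

theorem isSS_iff {θ : Q₀ → ℤ} {μ : ℚ} {M : Q.Rep k d} :
    Q.IsSS θ μ M ↔ (d = 0 ∨ slope θ d = μ) ∧ Q.IsSemistable θ M := by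
  by_cases hd : d = 0
  · have h0 : ∀ W : ∀ i, Submodule k (Fin (d i) → k), subDim W = 0 := by
      intro W
      funext i
      have := Submodule.finrank_le (W i)
      rw [Module.finrank_fintype_fun_eq_card, Fintype.card_fin] at this
      exact Nat.le_zero.mp (this.trans_eq (congrFun hd i))
    refine ⟨fun _ => ⟨Or.inl hd, fun W _ hW' => absurd (h0 W) hW'⟩, fun _ => ⟨?_, ?_⟩⟩
    · rw [hd, lam_zero]
    · intro W _
      rw [h0 W, lam_zero]
  · constructor
    · intro h
      have h1 := (slope_eq_iff hd).mpr h.lam_eq_zero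
      refine ⟨Or.inr h1, fun W hW hW' => ?_⟩
      rw [h1, slope_le_iff hW']
      exact h.lam_le W hW
    · rintro ⟨h1, h2⟩
      have h1 := h1.resolve_left hd
      refine ⟨(slope_eq_iff hd).mp h1, fun W hW => ?_⟩
      by_cases hW' : subDim W = 0
      · rw [hW', lam_zero]
      · have := h2 W hW hW'
        rwa [h1, slope_le_iff hW'] at this

theorem IsSS.isSemistableDim {θ : Q₀ → ℤ} {μ : ℚ} {M : Q.Rep k d} (h : Q.IsSS θ μ M) (hd : d ≠ 0) :
    Q.IsSemistableDim k θ d := ⟨hd, M, (isSS_iff.mp h).2⟩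

theorem IsSS.slope_eq {θ : Q₀ → ℤ} {μ : ℚ} {M : Q.Rep k d} (h : Q.IsSS θ μ M) (hd : d ≠ 0) :
    slope θ d = μ := (slope_eq_iff hd).mpr h.lam_eq_zero

omit [Fintype Q₀] in
theorem IsHom.isSubrep_ker {M : Q.Rep k d} {N : Q.Rep k e} {φ : GrHom k d e} (h : IsHom M N φ) :
    Q.IsSubrep M (fun i => LinearMap.ker (φ i)) := by
  intro a x hx
  rw [LinearMap.mem_ker] at hx ⊢
  rw [h a, hx, map_zero]

omit [Fintype Q₀] in
theorem IsHom.isSubrep_range {M : Q.Rep k d} {N : Q.Rep k e} {φ : GrHom k d e} (h : IsHom M N φ) :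
    Q.IsSubrep N (fun i => LinearMap.range (φ i)) := by
  rintro a _ ⟨x, rfl⟩
  exact ⟨M a x, h a x⟩

omit [Fintype Q₀] in
theorem subDim_range_add_ker (φ : GrHom k d e) :
    subDim (fun i => LinearMap.range (φ i)) + subDim (fun i => LinearMap.ker (φ i)) = d := by
  funext i
  have := LinearMap.finrank_range_add_finrank_ker (φ i)
  rwa [Module.finrank_fintype_fun_eq_card, Fintype.card_fin] at this

theorem IsSS.lam_ker_range {θ : Q₀ → ℤ} {μ : ℚ} {M : Q.Rep k d} {N : Q.Rep k e} {φ : GrHom k d e}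
    (hM : Q.IsSS θ μ M) (hN : Q.IsSS θ μ N) (h : IsHom M N φ) :
    lam θ μ (subDim fun i => LinearMap.ker (φ i)) = 0 ∧
      lam θ μ (subDim fun i => LinearMap.range (φ i)) = 0 := by
  have h1 := hM.lam_le _ h.isSubrep_ker
  have h2 := hN.lam_le _ h.isSubrep_range
  have h3 := lam_add θ μ (subDim fun i => LinearMap.range (φ i))
    (subDim fun i => LinearMap.ker (φ i))
  rw [subDim_range_add_ker, hM.lam_eq_zero] at h3
  constructor <;> linarith

/-- Schur's lemma: a non-zero homomorphism from a stable representation is injective. -/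
theorem IsStable.injective {θ : Q₀ → ℤ} {μ : ℚ} {M : Q.Rep k d} {N : Q.Rep k e} {φ : GrHom k d e}
    (hM : Q.IsStable θ μ M) (hN : Q.IsSS θ μ N) (h : IsHom M N φ) (h0 : φ ≠ 0) (i : Q₀) :
    Function.Injective (φ i) := by
  rcases hM.eq_bot_or_top _ h.isSubrep_ker (hM.lam_ker_range hN h).1 with h1 | h1
  · exact LinearMap.ker_eq_bot.mp (h1 i)
  · exact absurd (funext fun i => LinearMap.ker_eq_top.mp (h1 i)) h0

/-- Schur's lemma: a non-zero homomorphism to a stable representation is surjective. -/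
theorem IsStable.surjective {θ : Q₀ → ℤ} {μ : ℚ} {M : Q.Rep k d} {N : Q.Rep k e} {φ : GrHom k d e}
    (hM : Q.IsSS θ μ M) (hN : Q.IsStable θ μ N) (h : IsHom M N φ) (h0 : φ ≠ 0) (i : Q₀) :
    Function.Surjective (φ i) := by
  rcases hN.eq_bot_or_top _ h.isSubrep_range (hM.lam_ker_range hN.toIsSS h).2 with h1 | h1
  · exact absurd (funext fun i => LinearMap.range_eq_bot.mp (h1 i)) h0
  · exact LinearMap.range_eq_top.mp (h1 i)

/-- The endomorphism algebra of a representation. -/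
def endAlg (M : Q.Rep k d) : Subalgebra k (∀ i, Module.End k (Fin (d i) → k)) where
  carrier := {φ | IsHom M M φ}
  mul_mem' hφ hψ := hφ.comp hψ
  add_mem' {φ ψ} hφ hψ := fun a x => by
    simp only [Pi.add_apply, LinearMap.add_apply, hφ a x, hψ a x, map_add]
  algebraMap_mem' c := fun a x => by simp [Module.algebraMap_end_apply]

omit [Fintype Q₀] in
theorem finrank_endAlg (M : Q.Rep k d) :
    Module.finrank k (endAlg M) = Module.finrank k (homSpace M M) := by
  have : Subalgebra.toSubmodule (endAlg M) = homSpace M M := by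
    ext φ
    exact mem_ker_homDiff.symm
  rw [← this]
  rfl

/-- The spaces of a stable representation are vector spaces over its endomorphism division ring. -/
theorem IsStable.finrank_dvd {θ : Q₀ → ℤ} {μ : ℚ} {M : Q.Rep k d} (hM : Q.IsStable θ μ M) (i : Q₀) :
    Module.finrank k (endAlg M) ∣ d i := by
  obtain ⟨i0, hi0⟩ := Function.ne_iff.mp hM.ne_zero
  have hnt : Nontrivial (endAlg M) := by
    refine ⟨⟨0, 1, fun h => ?_⟩⟩
    have h1 : (0 : ∀ i, Module.End k (Fin (d i) → k)) = 1 := congrArg Subtype.val h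
    have h2 := LinearMap.congr_fun (congrFun h1 i0) (fun _ => 1)
    have h3 := congrFun h2 ⟨0, Nat.pos_of_ne_zero hi0⟩
    exact zero_ne_one h3
  have hunit : ∀ x : endAlg M, IsUnit x ∨ x = 0 := by
    rintro ⟨φ, hφ⟩
    by_cases h0 : φ = 0
    · exact Or.inr (Subtype.ext h0)
    · left
      have hb : ∀ i, Function.Bijective (φ i) := fun i =>
        ⟨hM.injective hM.toIsSS hφ h0 i, IsStable.surjective hM.toIsSS hM hφ h0 i⟩
      let ψ : ∀ i, (Fin (d i) → k) ≃ₗ[k] (Fin (d i) → k) := fun i =>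
        LinearEquiv.ofBijective (φ i) (hb i)
      have hψ : (fun i => ((ψ i).symm : Module.End k (Fin (d i) → k))) ∈ endAlg M := by
        intro a x
        change (ψ _).symm _ = M a ((ψ _).symm x)
        rw [LinearEquiv.symm_apply_eq]
        change _ = φ _ (M a _)
        rw [hφ a]
        congr 1
        exact ((ψ (Q.src a)).apply_symm_apply x).symm
      refine isUnit_iff_exists.mpr ⟨⟨_, hψ⟩, Subtype.ext (funext fun i => ?_),
        Subtype.ext (funext fun i => ?_)⟩
      · refine LinearMap.ext fun x => ?_
        exact (ψ i).apply_symm_apply x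
      · refine LinearMap.ext fun x => ?_
        exact (ψ i).symm_apply_apply x
  -- Each component of `M` is a vector space over the division ring of endomorphisms.
  let _ : DivisionRing (endAlg M) := DivisionRing.ofIsUnitOrEqZero hunit
  let _ : Module (endAlg M) (Fin (d i) → k) :=
    Module.compHom _ ((Pi.evalRingHom (fun i => Module.End k (Fin (d i) → k)) i).comp
      (endAlg M).val.toRingHom)
  have _ : IsScalarTower k (endAlg M) (Fin (d i) → k) := ⟨fun c x v => rfl⟩
  have := Module.finrank_mul_finrank k (endAlg M) (Fin (d i) → k)
  rw [Module.finrank_fintype_fun_eq_card, Fintype.card_fin] at this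
  exact ⟨_, this.symm⟩

variable [DecidableEq Q₀] [Fintype Q₁]

/-- A stable representation of a finite type quiver is a brick without self-extensions.  If `m` is
the dimension of its endomorphism ring, then `m` divides `d`, so `m² ≤ χ(d, d) = m - dim Ext¹`. -/
theorem IsStable.exceptional {θ : Q₀ → ℤ} {μ : ℚ} {M : Q.Rep k d} (hM : Q.IsStable θ μ M)
    (hQ : Q.IsFiniteType) :
    Module.finrank k (homSpace M M) = 1 ∧ Q.euler d d = 1 ∧ ExtVanishes M M := by
  obtain ⟨c, hc, hc'⟩ := exists_finrank_homSpace M M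
  choose d' hd' using hM.finrank_dvd
  rw [finrank_endAlg] at hd'
  set m := Module.finrank k (homSpace M M) with hm
  have h1 : d = m • d' := funext hd'
  have h2 : d' ≠ 0 := by
    rintro rfl
    exact hM.ne_zero (by rw [h1, smul_zero])
  have h3 := hQ.euler_pos d' h2
  have h4 := hQ.euler_pos d hM.ne_zero
  have h5 : Q.euler d d = m * (m * Q.euler d' d') := by
    conv_lhs => rw [h1]
    rw [euler_smul_left, euler_smul_right]
  have h6 : (1 : ℤ) ≤ m := by
    rcases Nat.eq_zero_or_pos m with h | h
    · rw [h5, h] at h4; simp at h4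
    · exact_mod_cast h
  have h7 : (m : ℤ) = 1 ∧ c = 0 := by
    have : (m : ℤ) * m ≤ m * (m * Q.euler d' d') := by
      nlinarith
    have hm1 : (m : ℤ) ≤ 1 := by nlinarith
    have hm2 : (m : ℤ) = 1 := le_antisymm hm1 h6
    refine ⟨hm2, ?_⟩
    rw [h5, hm2] at hc
    omega
  refine ⟨by exact_mod_cast h7.1, ?_, hc' h7.2⟩
  rw [h7.1, h7.2] at hc
  simpa using hc.symm

theorem IsStable.endo_eq_smul {θ : Q₀ → ℤ} {μ : ℚ} {M : Q.Rep k d} (hM : Q.IsStable θ μ M)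
    (hQ : Q.IsFiniteType) {φ : GrHom k d d} (h : IsHom M M φ) :
    ∃ c : k, φ = fun _ => c • LinearMap.id := by
  have hid : (⟨fun _ => LinearMap.id, mem_ker_homDiff.mpr (isHom_id M)⟩ : homSpace M M) ≠ 0 := by
    intro h
    have h1 := congrArg Subtype.val h
    obtain ⟨i0, hi0⟩ := Function.ne_iff.mp hM.ne_zero
    have h2 := LinearMap.congr_fun (congrFun h1 i0) (fun _ => 1)
    have h3 := congrFun h2 ⟨0, Nat.pos_of_ne_zero hi0⟩
    exact one_ne_zero h3
  obtain ⟨c, hc⟩ := (finrank_eq_one_iff_of_nonzero' (V := homSpace M M) _ hid).mp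
    (hM.exceptional hQ).1 ⟨φ, mem_ker_homDiff.mpr h⟩
  exact ⟨c, (congrArg Subtype.val hc).symm⟩

omit [DecidableEq Q₀] [Fintype Q₁] in
/-- Stable representations of the same slope and different dimension vectors have no
homomorphisms between them. -/
theorem IsStable.hom_eq_zero {θ : Q₀ → ℤ} {μ : ℚ} {M : Q.Rep k d} {N : Q.Rep k e}
    (hM : Q.IsStable θ μ M) (hN : Q.IsStable θ μ N) (hde : d ≠ e) {φ : GrHom k d e}
    (h : IsHom M N φ) : φ = 0 := by
  by_contra h0
  apply hde
  funext i
  have := LinearEquiv.finrank_eq (LinearEquiv.ofBijective (φ i)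
    ⟨hM.injective hN.toIsSS h h0 i, IsStable.surjective hM.toIsSS hN h h0 i⟩)
  simpa using this

/-- Stable representations of different dimension vectors, of the same slope and orthogonal for the
skew form, have no extensions: otherwise `d + e` would have Tits norm at most `0`. -/
theorem IsStable.ext_vanishes {θ : Q₀ → ℤ} {μ : ℚ} {M : Q.Rep k d} {N : Q.Rep k e}
    (hM : Q.IsStable θ μ M) (hN : Q.IsStable θ μ N) (hQ : Q.IsFiniteType) (hde : d ≠ e)
    (hs : Q.skew d e = 0) : Q.euler d e = 0 ∧ ExtVanishes M N := by
  obtain ⟨c, hc, hc'⟩ := exists_finrank_homSpace M N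
  have h0 : Module.finrank k (homSpace M N) = 0 := by
    rw [Submodule.finrank_eq_zero, Submodule.eq_bot_iff]
    intro φ hφ
    exact hM.hom_eq_zero hN hde (mem_ker_homDiff.mp hφ)
  rw [h0] at hc
  have h1 := hQ.euler_pos (d + e) (fun h => hM.ne_zero (by
    funext i
    have := congrFun h i
    simp only [Pi.add_apply, Pi.zero_apply] at this ⊢
    omega))
  rw [euler_add_left, euler_add_right, euler_add_right, (hM.exceptional hQ).2.1,
    (hN.exceptional hQ).2.1] at h1
  have h2 : Q.euler d e = Q.euler e d := sub_eq_zero.mp hs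
  have h3 : c = 0 := by
    push_cast at hc
    omega
  refine ⟨?_, hc' h3⟩
  rw [h3] at hc
  push_cast at hc
  linarith

/-- Stable representations of the same dimension vector are isomorphic. -/
theorem IsStable.exists_iso {θ : Q₀ → ℤ} {μ : ℚ} {M N : Q.Rep k d}
    (hM : Q.IsStable θ μ M) (hN : Q.IsStable θ μ N) (hQ : Q.IsFiniteType) :
    ∃ φ : GrHom k d d, IsHom M N φ ∧ ∀ i, Function.Bijective (φ i) := by
  obtain ⟨c, hc, -⟩ := exists_finrank_homSpace M N
  have h1 := (hM.exceptional hQ).2.1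
  have h2 : homSpace M N ≠ ⊥ := by
    intro h
    rw [h, finrank_bot] at hc
    push_cast at hc
    omega
  obtain ⟨φ, hφ, h0⟩ := Submodule.exists_mem_ne_zero_of_ne_bot h2
  rw [mem_ker_homDiff] at hφ
  exact ⟨φ, hφ, fun i => ⟨hM.injective hN.toIsSS hφ h0 i,
    IsStable.surjective hM.toIsSS hN hφ h0 i⟩⟩

end Stability

/-! ### Subrepresentations, quotients and extensions in coordinates -/

section Exact

variable {Q₀ Q₁ : Type*} {Q : InvolutiveQuiver Q₀ Q₁} {k : Type*} [Field k] {d e : DimVec Q₀}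

theorem exists_sub {M : Q.Rep k d} {W : ∀ i, Submodule k (Fin (d i) → k)} (hW : Q.IsSubrep M W) :
    ∃ (N : Q.Rep k (subDim W)) (j : GrHom k (subDim W) d), IsHom N M j ∧
      (∀ i, Function.Injective (j i)) ∧ ∀ i, LinearMap.range (j i) = W i := by
  let E : ∀ i, (Fin (subDim W i) → k) ≃ₗ[k] W i := fun i =>
    LinearEquiv.ofFinrankEq _ _
      ((Module.finrank_fintype_fun_eq_card k).trans (Fintype.card_fin _))
  refine ⟨fun a => (E (Q.tgt a)).symm.toLinearMap ∘ₗ (M a).restrict (hW a) ∘ₗ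
    (E (Q.src a)).toLinearMap, fun i => (W i).subtype ∘ₗ (E i).toLinearMap, ?_, ?_, ?_⟩
  · intro a x
    simp
  · intro i
    exact (Submodule.injective_subtype _).comp (E i).injective
  · intro i
    rw [LinearMap.range_comp, LinearEquiv.range, Submodule.map_top, Submodule.range_subtype]

theorem exists_quot {M : Q.Rep k d} {W : ∀ i, Submodule k (Fin (d i) → k)} (hW : Q.IsSubrep M W) :
    ∃ (d' : DimVec Q₀) (N : Q.Rep k d') (p : GrHom k d d'), d' + subDim W = d ∧ IsHom M N p ∧
      (∀ i, Function.Surjective (p i)) ∧ ∀ i, LinearMap.ker (p i) = W i := by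
  let d' : DimVec Q₀ := fun i => Module.finrank k ((Fin (d i) → k) ⧸ W i)
  let E : ∀ i, ((Fin (d i) → k) ⧸ W i) ≃ₗ[k] (Fin (d' i) → k) := fun i =>
    LinearEquiv.ofFinrankEq _ _ (by simp [d'])
  refine ⟨d', fun a => (E (Q.tgt a)).toLinearMap ∘ₗ (W (Q.src a)).mapQ (W (Q.tgt a)) (M a) (hW a) ∘ₗ
    (E (Q.src a)).symm.toLinearMap, fun i => (E i).toLinearMap ∘ₗ (W i).mkQ, ?_, ?_, ?_, ?_⟩
  · funext i
    have := Submodule.finrank_quotient_add_finrank (W i)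
    rwa [Module.finrank_fintype_fun_eq_card, Fintype.card_fin] at this
  · intro a x
    simp
  · intro i
    exact (E i).surjective.comp (Submodule.mkQ_surjective _)
  · intro i
    rw [LinearMap.ker_comp, LinearEquiv.ker, Submodule.comap_bot, Submodule.ker_mkQ]

theorem exists_directSum (M : Q.Rep k d) (N : Q.Rep k e) :
    ∃ (P : Q.Rep k (d + e)) (j : GrHom k d (d + e)) (p : GrHom k (d + e) e),
      IsHom M P j ∧ IsHom P N p ∧ (∀ i, Function.Injective (j i)) ∧
      (∀ i, LinearMap.ker (p i) = LinearMap.range (j i)) := by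
  let E : ∀ i, ((Fin (d i) → k) × (Fin (e i) → k)) ≃ₗ[k] (Fin ((d + e) i) → k) := fun i =>
    LinearEquiv.ofFinrankEq _ _ (by simp)
  refine ⟨fun a => (E (Q.tgt a)).toLinearMap ∘ₗ (LinearMap.prodMap (M a) (N a)) ∘ₗ
    (E (Q.src a)).symm.toLinearMap, fun i => (E i).toLinearMap ∘ₗ LinearMap.inl k _ _,
    fun i => LinearMap.snd k _ _ ∘ₗ (E i).symm.toLinearMap, ?_, ?_, ?_, ?_⟩
  · intro a x
    simp
  · intro a x
    simp
  · intro i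
    exact (E i).injective.comp LinearMap.inl_injective
  · intro i
    ext x
    simp only [LinearMap.mem_ker, LinearMap.comp_apply, LinearMap.snd_apply, LinearMap.mem_range,
      LinearEquiv.coe_coe, LinearMap.inl_apply]
    constructor
    · intro h
      refine ⟨((E i).symm x).1, ?_⟩
      rw [← h]
      exact (E i).apply_symm_apply x
    · rintro ⟨y, rfl⟩
      simp

theorem subDim_map (j : GrHom k d e) (hj : ∀ i, Function.Injective (j i))
    (W : ∀ i, Submodule k (Fin (d i) → k)) : subDim (fun i => (W i).map (j i)) = subDim W := by
  funext i
  exact (LinearEquiv.finrank_eq (Submodule.equivMapOfInjective (j i) (hj i) (W i))).symm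

theorem IsHom.isSubrep_map {M : Q.Rep k d} {N : Q.Rep k e} {j : GrHom k d e} (hj : IsHom M N j)
    {W : ∀ i, Submodule k (Fin (d i) → k)} (hW : Q.IsSubrep M W) :
    Q.IsSubrep N (fun i => (W i).map (j i)) := by
  rintro a _ ⟨x, hx, rfl⟩
  exact ⟨M a x, hW a x hx, hj a x⟩

theorem IsHom.isSubrep_comap {M : Q.Rep k d} {N : Q.Rep k e} {j : GrHom k d e} (hj : IsHom M N j)
    {W : ∀ i, Submodule k (Fin (e i) → k)} (hW : Q.IsSubrep N W) :
    Q.IsSubrep M (fun i => (W i).comap (j i)) := by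
  intro a x hx
  rw [Submodule.mem_comap] at hx ⊢
  rw [hj a]
  exact hW a _ hx

/-- Dimension count for a subspace of the middle term of an exact sequence. -/
theorem subDim_map_add_comap {f : DimVec Q₀} {j : GrHom k d e} {p : GrHom k e f}
    (hj : ∀ i, Function.Injective (j i)) (hjp : ∀ i, LinearMap.ker (p i) = LinearMap.range (j i))
    (W : ∀ i, Submodule k (Fin (e i) → k)) :
    subDim (fun i => (W i).map (p i)) + subDim (fun i => (W i).comap (j i)) = subDim W := by
  funext i
  have h1 := LinearMap.finrank_range_add_finrank_ker ((p i).domRestrict (W i))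
  have h2 : LinearMap.range ((p i).domRestrict (W i)) = (W i).map (p i) :=
    LinearMap.range_domRestrict _ _
  have h3 : Module.finrank k (LinearMap.ker ((p i).domRestrict (W i)))
      = Module.finrank k ((W i).comap (j i)) := by
    have e1 : ((LinearMap.ker ((p i).domRestrict (W i))).map (W i).subtype)
        = ((W i).comap (j i)).map (j i) := by
      rw [LinearMap.ker_domRestrict, Submodule.map_comap_subtype, hjp,
        Submodule.map_comap_eq, inf_comm]
    have e2 := LinearEquiv.finrank_eq (Submodule.equivMapOfInjective (j i) (hj i)
      ((W i).comap (j i)))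
    have e3 := LinearEquiv.finrank_eq (Submodule.equivMapOfInjective (W i).subtype
      (Submodule.injective_subtype _) (LinearMap.ker ((p i).domRestrict (W i))))
    rw [e2, e3, e1]
  rw [h2, h3] at h1
  exact h1

end Exact

section SemistableExact

variable {Q₀ Q₁ : Type*} [Fintype Q₀] {Q : InvolutiveQuiver Q₀ Q₁} {k : Type*} [Field k]
  {d e : DimVec Q₀} {θ : Q₀ → ℤ} {μ : ℚ}

/-- Dimension vectors of semistable representations of slope `μ` are closed under addition. -/
theorem IsSS.exists_add {M : Q.Rep k d} {N : Q.Rep k e} (hM : Q.IsSS θ μ M) (hN : Q.IsSS θ μ N) :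
    ∃ P : Q.Rep k (d + e), Q.IsSS θ μ P := by
  obtain ⟨P, j, p, hj, hp, hj', hjp⟩ := exists_directSum M N
  refine ⟨P, ?_, fun W hW => ?_⟩
  · rw [lam_add, hM.lam_eq_zero, hN.lam_eq_zero, add_zero]
  · rw [← subDim_map_add_comap hj' hjp W, lam_add]
    have h1 := hN.lam_le _ (hp.isSubrep_map hW)
    have h2 := hM.lam_le _ (hj.isSubrep_comap hW)
    linarith

theorem exists_isSS_zero (θ : Q₀ → ℤ) (μ : ℚ) : ∃ P : Q.Rep k 0, Q.IsSS θ μ P :=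
  ⟨fun _ => 0, isSS_iff.mpr ⟨Or.inl rfl, fun W _ hW => (hW (by
    funext i
    have := Submodule.finrank_le (W i)
    rw [Module.finrank_fintype_fun_eq_card, Fintype.card_fin] at this
    exact Nat.le_zero.mp this)).elim⟩⟩

theorem exists_isSS_nsmul {M : Q.Rep k d} (hM : Q.IsSS θ μ M) (n : ℕ) :
    ∃ P : Q.Rep k (n • d), Q.IsSS θ μ P := by
  induction n with
  | zero => rw [zero_smul]; exact exists_isSS_zero θ μ
  | succ n ih =>
    obtain ⟨P, hP⟩ := ih
    rw [add_smul, one_smul]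
    exact hP.exists_add hM

theorem exists_isSS_sum {ι : Type*} (s : Finset ι) (f : ι → DimVec Q₀)
    (h : ∀ i ∈ s, ∃ P : Q.Rep k (f i), Q.IsSS θ μ P) : ∃ P : Q.Rep k (∑ i ∈ s, f i),
      Q.IsSS θ μ P := by
  classical
  induction s using Finset.induction_on with
  | empty => rw [Finset.sum_empty]; exact exists_isSS_zero θ μ
  | insert i s hi ih =>
    obtain ⟨P, hP⟩ := ih fun j hj => h j (Finset.mem_insert_of_mem hj)
    obtain ⟨N, hN⟩ := h i (Finset.mem_insert_self _ _)
    rw [Finset.sum_insert hi]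
    exact hN.exists_add hP

theorem sum_subDim_lt {W W' : ∀ i, Submodule k (Fin (d i) → k)} (h : ∀ i, W i ≤ W' i)
    {i : Q₀} (hi : W i ≠ W' i) : ∑ i, subDim W i < ∑ i, subDim W' i :=
  Finset.sum_lt_sum (fun i _ => Submodule.finrank_mono (h i))
    ⟨i, Finset.mem_univ _, Submodule.finrank_lt_finrank_of_lt (lt_of_le_of_ne (h i) hi)⟩

omit [Fintype Q₀] in
theorem subDim_top : subDim (fun i => (⊤ : Submodule k (Fin (d i) → k))) = d := by
  funext i
  simp [subDim]

/-- A non-zero semistable representation has a stable subrepresentation of the same slope with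
semistable quotient. -/
theorem IsSS.exists_stable_sub {U : Q.Rep k e} (hU : Q.IsSS θ μ U) (he : e ≠ 0) :
    ∃ (d₀ d' : DimVec Q₀) (N : Q.Rep k d₀) (P : Q.Rep k d') (j : GrHom k d₀ e) (p : GrHom k e d'),
      d' + d₀ = e ∧ Q.IsStable θ μ N ∧ Q.IsSS θ μ P ∧ IsHom N U j ∧ IsHom U P p ∧
      (∀ i, Function.Injective (j i)) ∧ (∀ i, Function.Surjective (p i)) ∧
      ∀ i, LinearMap.ker (p i) = LinearMap.range (j i) := by
  classical
  -- Take a non-zero subrepresentation of slope `μ` of minimal total dimension.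
  let C : Set (∀ i, Submodule k (Fin (e i) → k)) :=
    {W | Q.IsSubrep U W ∧ lam θ μ (subDim W) = 0 ∧ ∃ i, W i ≠ ⊥}
  have hC : C.Nonempty := by
    refine ⟨fun _ => ⊤, fun _ _ _ => trivial, ?_, ?_⟩
    · rw [subDim_top]
      exact hU.lam_eq_zero
    · obtain ⟨i, hi⟩ := Function.ne_iff.mp he
      refine ⟨i, fun h => hi ?_⟩
      have := congrArg (fun S : Submodule k (Fin (e i) → k) => Module.finrank k S) h
      simpa using this
  obtain ⟨W, ⟨hW, hW0, i0, hi0⟩, hmin⟩ :=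
    (InvImage.wf (fun W : ∀ i, Submodule k (Fin (e i) → k) => ∑ i, subDim W i)
      wellFounded_lt).has_min C hC
  obtain ⟨N, j, hj, hj', hjr⟩ := exists_sub hW
  obtain ⟨d', P, p, hd', hp, hp', hpk⟩ := exists_quot hW
  refine ⟨subDim W, d', N, P, j, p, hd', ⟨⟨hW0, ?_⟩, ?_, ?_⟩, ⟨?_, ?_⟩, hj, hp, hj', hp',
    fun i => by rw [hpk, hjr]⟩
  · intro W' hW'
    rw [← subDim_map j hj']
    exact hU.lam_le _ (hj.isSubrep_map hW')
  · intro h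
    have := congrFun h i0
    exact hi0 (Submodule.finrank_eq_zero.mp this)
  · intro W' hW' h0
    by_contra hcon
    push Not at hcon
    obtain ⟨⟨a, ha⟩, ⟨b, hb⟩⟩ := hcon
    have hle : ∀ i, (W' i).map (j i) ≤ W i := fun i => by
      rw [← hjr]; exact LinearMap.map_le_range
    refine hmin (fun i => (W' i).map (j i)) ⟨hj.isSubrep_map hW', ?_, a, ?_⟩
      (sum_subDim_lt hle (i := b) ?_)
    · rw [subDim_map j hj']; exact h0
    · intro h
      rw [← Submodule.map_bot (j a)] at h
      exact ha (Submodule.map_injective_of_injective (hj' a) h)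
    · intro h
      apply hb
      rw [← hjr, ← Submodule.map_top] at h
      exact Submodule.map_injective_of_injective (hj' b) h
  · have h1 := lam_add θ μ d' (subDim W)
    rw [hd', hU.lam_eq_zero, hW0] at h1
    linarith
  · intro W' hW'
    have h1 := hU.lam_le _ (hp.isSubrep_comap hW')
    rw [← subDim_map_add_comap hj' (fun i => by rw [hpk, hjr]) , lam_add] at h1
    have h2 : (fun i => ((W' i).comap (p i)).map (p i)) = W' := by
      funext i
      exact Submodule.map_comap_eq_of_surjective (hp' i) _
    have h3 : (fun i => ((W' i).comap (p i)).comap (j i)) = fun i => ⊤ := by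
      funext i
      rw [eq_top_iff]
      intro x _
      have : p i (j i x) = 0 := by
        rw [← LinearMap.mem_ker, hpk, ← hjr]
        exact ⟨x, rfl⟩
      simp [this]
    rw [h2, h3, subDim_top, hW0] at h1
    linarith

end SemistableExact

/-! ### The semisimple category of semistable representations of fixed slope -/

section Decomposition

variable {Q₀ Q₁ : Type*} [Fintype Q₀] [Fintype Q₁] {Q : InvolutiveQuiver Q₀ Q₁}
  {k : Type*} [Field k] {θ : Q₀ → ℤ} {μ : ℚ}

/-- A choice of the stable representations of slope `μ`, one for each of the finitely many dimension
vectors in `J`, which is an exceptional and completely orthogonal collection.  For `d ∉ J` the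
representation `S d` is arbitrary. -/
structure StableSystem (Q : InvolutiveQuiver Q₀ Q₁) (k : Type*) [Field k] (θ : Q₀ → ℤ) (μ : ℚ) where
  S : ∀ d, Q.Rep k d
  J : Finset (DimVec Q₀)
  mem_iff : ∀ d, d ∈ J ↔ ∃ M : Q.Rep k d, Q.IsStable θ μ M
  stable : ∀ d ∈ J, Q.IsStable θ μ (S d)
  euler_eq : ∀ d ∈ J, ∀ e ∈ J, Q.euler d e = if d = e then 1 else 0
  ext : ∀ d ∈ J, ∀ e ∈ J, ExtVanishes (S d) (S e)
  endo_scalar : ∀ d ∈ J, ∀ φ : GrHom k d d, IsHom (S d) (S d) φ →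
    ∃ c : k, φ = fun _ => c • LinearMap.id
  iso : ∀ d ∈ J, ∀ M : Q.Rep k d, Q.IsStable θ μ M →
    ∃ φ : GrHom k d d, IsHom (S d) M φ ∧ ∀ i, Function.Bijective (φ i)

/-- Stable representations of one slope exist in finitely many dimension vectors, as these are
roots, and by genericity and positivity of the Tits form all extensions between them vanish. -/
theorem exists_stableSystem [DecidableEq Q₀] (hQ : Q.IsFiniteType) (hθ : Q.IsSigmaGeneric k θ)
    (μ : ℚ) : Nonempty (StableSystem Q k θ μ) := by
  classical
  have hfin : {d : DimVec Q₀ | ∃ M : Q.Rep k d, Q.IsStable θ μ M}.Finite :=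
    hQ.finite_roots.subset fun d ⟨M, hM⟩ => (hM.exceptional hQ).2.1
  have hex : ∀ d : DimVec Q₀, ∃ M : Q.Rep k d, (∃ N : Q.Rep k d, Q.IsStable θ μ N) →
      Q.IsStable θ μ M := by
    intro d
    by_cases h : ∃ N : Q.Rep k d, Q.IsStable θ μ N
    · exact ⟨h.choose, fun _ => h.choose_spec⟩
    · exact ⟨fun _ => 0, fun h' => absurd h' h⟩
  choose S hS using hex
  have hst : ∀ d ∈ hfin.toFinset, Q.IsStable θ μ (S d) := fun d hd => hS d (by simpa using hd)
  have hskew : ∀ d ∈ hfin.toFinset, ∀ e ∈ hfin.toFinset, Q.skew d e = 0 := by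
    intro d hd e he
    have h1 := hst d hd
    have h2 := hst e he
    exact hθ.skew_eq_zero d e (h1.isSemistableDim h1.ne_zero) (h2.isSemistableDim h2.ne_zero)
      ((h1.slope_eq h1.ne_zero).trans (h2.slope_eq h2.ne_zero).symm)
  refine ⟨⟨S, hfin.toFinset, fun d => by simp, hst, ?_, ?_, ?_, ?_⟩⟩
  · intro d hd e he
    split_ifs with h
    · subst h; exact ((hst d hd).exceptional hQ).2.1
    · exact ((hst d hd).ext_vanishes (hst e he) hQ h (hskew d hd e he)).1
  · intro d hd e he
    by_cases h : d = e
    · subst h; exact ((hst d hd).exceptional hQ).2.2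
    · exact ((hst d hd).ext_vanishes (hst e he) hQ h (hskew d hd e he)).2
  · intro d hd φ hφ
    exact (hst d hd).endo_eq_smul hQ hφ
  · intro d hd M hM
    exact (hst d hd).exists_iso hM hQ

/-- `U` is isomorphic to the direct sum of the representations `S (f t)`: inclusions `ι t` and
projections `π t` satisfying the relations of a biproduct. -/
structure IsDecomp {T : Type*} [Fintype T] (S : ∀ d, Q.Rep k d) (f : T → DimVec Q₀) {e : DimVec Q₀}
    (U : Q.Rep k e) (ι : ∀ t, GrHom k (f t) e) (π : ∀ t, GrHom k e (f t)) : Prop where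
  hom_ι : ∀ t, IsHom (S (f t)) U (ι t)
  hom_π : ∀ t, IsHom U (S (f t)) (π t)
  π_ι : ∀ t i x, π t i (ι t i x) = x
  π_ι_ne : ∀ t t', t ≠ t' → ∀ i x, π t i (ι t' i x) = 0
  sum_ι_π : ∀ i x, ∑ t, ι t i (π t i x) = x

/-- `U` is isomorphic to the direct sum of the `S (f t)`. -/
def HasDecomp {T : Type*} [Fintype T] (S : ∀ d, Q.Rep k d) (f : T → DimVec Q₀) {e : DimVec Q₀}
    (U : Q.Rep k e) : Prop :=
  ∃ (ι : ∀ t, GrHom k (f t) e) (π : ∀ t, GrHom k e (f t)), IsDecomp S f U ι π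

omit [Fintype Q₀] [Fintype Q₁] in
theorem HasDecomp.reindex {T T' : Type*} [Fintype T] [Fintype T'] {S : ∀ d, Q.Rep k d}
    {f : T → DimVec Q₀} {e : DimVec Q₀} {U : Q.Rep k e} (h : HasDecomp S f U) (E : T' ≃ T)
    {f' : T' → DimVec Q₀} (hf : ∀ t, f' t = f (E t)) : HasDecomp S f' U := by
  obtain rfl : f' = fun t => f (E t) := funext hf
  obtain ⟨ι, π, h⟩ := h
  refine ⟨fun t => ι (E t), fun t => π (E t), ⟨fun t => h.hom_ι _, fun t => h.hom_π _,
    fun t => h.π_ι _, fun t t' ht => h.π_ι_ne _ _ fun hE => ht (E.injective hE), fun i x => ?_⟩⟩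
  exact (E.sum_comp (fun t => ι t i (π t i x))).trans (h.sum_ι_π i x)

omit [Fintype Q₀] [Fintype Q₁] in
/-- A decomposition of a quotient `P = U / S d₀` lifts to `U` when the extensions of the summands by
`S d₀` vanish. -/
theorem HasDecomp.of_exact {T : Type*} [Fintype T] {S : ∀ d, Q.Rep k d} {f : T → DimVec Q₀}
    {d₀ d' e : DimVec Q₀} {U : Q.Rep k e} {P : Q.Rep k d'} (h : HasDecomp S f P)
    (hext : ∀ t, ExtVanishes (S (f t)) (S d₀)) {j : GrHom k d₀ e} {p : GrHom k e d'}
    (hj : IsHom (S d₀) U j) (hp : IsHom U P p) (hj' : ∀ i, Function.Injective (j i))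
    (hp' : ∀ i, Function.Surjective (p i))
    (hjp : ∀ i, LinearMap.ker (p i) = LinearMap.range (j i)) :
    HasDecomp S (fun o : Option T => o.elim d₀ f) U := by
  classical
  obtain ⟨ι, π, h⟩ := h
  choose κ hκ hpκ using fun t => (hext t).exists_lift hj hp hp' hjp (h.hom_ι t)
  have hpκ' : ∀ t i x, p i (κ t i x) = ι t i x := fun t i x => LinearMap.congr_fun (hpκ t i) x
  have hpj : ∀ i x, p i (j i x) = 0 := fun i x => by
    rw [← LinearMap.mem_ker, hjp]; exact ⟨x, rfl⟩
  -- The retraction onto the sub is determined by `j ∘ r = 1 - ∑ κ π p`.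
  have hr : ∀ i, ∃ r : (Fin (e i) → k) →ₗ[k] (Fin (d₀ i) → k),
      ∀ x, j i (r x) = x - ∑ t, κ t i (π t i (p i x)) := by
    intro i
    let F : (Fin (e i) → k) →ₗ[k] (Fin (e i) → k) :=
      LinearMap.id - ∑ t, κ t i ∘ₗ π t i ∘ₗ p i
    have hF : ∀ x, F x = x - ∑ t, κ t i (π t i (p i x)) := fun x => by simp [F]
    have hFr : ∀ x, F x ∈ LinearMap.range (j i) := by
      intro x
      rw [← hjp, LinearMap.mem_ker, hF, map_sub, map_sum]
      simp only [hpκ', h.sum_ι_π, sub_self]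
    refine ⟨(LinearEquiv.ofInjective (j i) (hj' i)).symm.toLinearMap ∘ₗ
      LinearMap.codRestrict _ F hFr, fun x => ?_⟩
    rw [← hF]
    have := (LinearEquiv.ofInjective (j i) (hj' i)).apply_symm_apply
      (LinearMap.codRestrict _ F hFr x)
    exact congrArg Subtype.val this
  choose r hr using hr
  refine ⟨fun o => match o with | none => j | some t => κ t,
    fun o => match o with | none => r | some t => fun i => π t i ∘ₗ p i, ?_, ?_, ?_, ?_, ?_⟩
  · rintro (_ | t)
    · exact hj
    · exact hκ t
  · rintro (_ | t)
    · intro a x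
      apply hj' (Q.tgt a)
      show j _ (r _ (U a x)) = j _ (S d₀ a (r _ x))
      rw [hj a, hr, hr, map_sub, map_sum]
      congr 1
      refine Finset.sum_congr rfl fun t _ => ?_
      rw [hp a, h.hom_π t a, hκ t a]
    · exact (h.hom_π t).comp hp
  · rintro (_ | t) i x
    · change Fin (d₀ i) → k at x
      apply hj' i
      show j i (r i (j i x)) = j i x
      rw [hr, hpj]
      simp
    · change Fin (f t i) → k at x
      show π t i (p i (κ t i x)) = x
      rw [hpκ', h.π_ι]
  · rintro (_ | t) (_ | t') htt i x
    · exact absurd rfl htt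
    · change Fin (f t' i) → k at x
      apply hj' i
      show j i (r i (κ t' i x)) = j i 0
      rw [hr, hpκ', map_zero, Finset.sum_eq_single t', h.π_ι, sub_self]
      · intro t _ ht
        rw [h.π_ι_ne t t' ht, map_zero]
      · simp
    · change Fin (d₀ i) → k at x
      show π t i (p i (j i x)) = 0
      rw [hpj, map_zero]
    · change Fin (f t' i) → k at x
      show π t i (p i (κ t' i x)) = 0
      rw [hpκ', h.π_ι_ne t t' fun h => htt (congrArg some h)]
  · intro i x
    rw [Fintype.sum_option]
    show j i (r i x) + ∑ t, κ t i (π t i (p i x)) = x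
    rw [hr, sub_add_cancel]

namespace StableSystem

variable (sys : StableSystem Q k θ μ)

omit [Fintype Q₀] [Fintype Q₁] in
theorem _root_.Orientifold.InvolutiveQuiver.comp_iso {d₀ e : DimVec Q₀}
    {d' : DimVec Q₀} {j : GrHom k d₀ e} {p : GrHom k e d'}
    {φ : GrHom k d₀ d₀} (hφ : ∀ i, Function.Bijective (φ i))
    (hj' : ∀ i, Function.Injective (j i))
    (hjp : ∀ i, LinearMap.ker (p i) = LinearMap.range (j i)) :
    (∀ i, Function.Injective (j i ∘ₗ φ i)) ∧
    ∀ i, LinearMap.ker (p i) = LinearMap.range (j i ∘ₗ φ i) := by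
  refine ⟨fun i => (hj' i).comp (hφ i).1, fun i => ?_⟩
  rw [hjp, LinearMap.range_comp, LinearMap.range_eq_top.mpr (hφ i).2, Submodule.map_top]

/-- Every semistable representation is a direct sum of stable ones. -/
theorem exists_decomp {e : DimVec Q₀} (U : Q.Rep k e) (hU : Q.IsSS θ μ U) :
    ∃ (T : Type) (_ : Fintype T) (f : T → DimVec Q₀), (∀ t, f t ∈ sys.J) ∧ e = ∑ t, f t ∧
      HasDecomp sys.S f U := by
  induction hN : ∑ i, e i using Nat.strong_induction_on generalizing e with
  | _ N ih =>
    by_cases he : e = 0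
    · refine ⟨Empty, inferInstance, fun t => t.elim, fun t => t.elim, by simpa using he,
        fun t => t.elim, fun t => t.elim, fun t => t.elim, fun t => t.elim, fun t => t.elim,
        fun t => t.elim, fun i x => ?_⟩
      funext z
      exact absurd z.2 (by simp [he])
    · obtain ⟨d₀, d', N', P, j, p, hd, hN', hP, hj, hp, hj', hp', hjp⟩ := hU.exists_stable_sub he
      have hd₀ : d₀ ∈ sys.J := (sys.mem_iff d₀).mpr ⟨N', hN'⟩
      obtain ⟨φ, hφ, hφ'⟩ := sys.iso d₀ hd₀ N' hN'
      obtain ⟨hi, hk⟩ := comp_iso hφ' hj' hjp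
      have hlt : ∑ i, d' i < N := by
        obtain ⟨i, hi⟩ := Function.ne_iff.mp hN'.ne_zero
        rw [← hN, ← hd]
        refine Finset.sum_lt_sum (fun i _ => Nat.le_add_right _ _) ⟨i, Finset.mem_univ _, ?_⟩
        exact Nat.lt_add_of_pos_right (Nat.pos_of_ne_zero hi)
      obtain ⟨T, hT, f, hf, hd', hdec⟩ := ih _ hlt P hP rfl
      refine ⟨Option T, inferInstance, fun o => o.elim d₀ f, ?_, ?_,
        hdec.of_exact (fun t => sys.ext _ (hf t) _ hd₀) (hj.comp hφ) hp hi hp' hk⟩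
      · rintro (_ | t)
        · exact hd₀
        · exact hf t
      · rw [Fintype.sum_option, ← hd, hd', add_comm]
        rfl

/-- The multiplicity of the stable representation of dimension vector `d` in the semistable
representations of dimension vector `e`. -/
def mult (Q : InvolutiveQuiver Q₀ Q₁) (e d : DimVec Q₀) : ℕ := (Q.euler d e).toNat

/-- The index set of the stable summands of a semistable representation, for multiplicities `m`. -/
abbrev Idx (m : DimVec Q₀ → ℕ) := Σ d : sys.J, Fin (m d.1)

theorem euler_sum (m : DimVec Q₀ → ℕ) {d : DimVec Q₀} (hd : d ∈ sys.J) :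
    Q.euler d (∑ d' ∈ sys.J, m d' • d') = m d := by
  rw [euler_sum_right, Finset.sum_eq_single d]
  · rw [euler_smul_right, sys.euler_eq d hd d hd, if_pos rfl, mul_one]
  · intro d' hd' h
    rw [euler_smul_right, sys.euler_eq d hd d' hd', if_neg h.symm, mul_zero]
  · exact fun h => absurd hd h

theorem mult_sum (m : DimVec Q₀ → ℕ) {d : DimVec Q₀} (hd : d ∈ sys.J) :
    mult Q (∑ d' ∈ sys.J, m d' • d') d = m d := by
  rw [mult, sys.euler_sum m hd, Int.toNat_natCast]

/-- The stable summands of a semistable representation are determined by its dimension vector `e`: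
since `J` is orthonormal for the Euler form, `S d` occurs `χ(d, e)` times. -/
theorem hasDecomp {e : DimVec Q₀} (U : Q.Rep k e) (hU : Q.IsSS θ μ U) :
    e = ∑ d ∈ sys.J, mult Q e d • d ∧
      HasDecomp sys.S (fun t : sys.Idx (mult Q e) => t.1.1) U := by
  classical
  obtain ⟨T, hT, f, hf, he, hdec⟩ := sys.exists_decomp U hU
  have hm : ∀ d ∈ sys.J, Fintype.card {t // f t = d} = mult Q e d := by
    intro d hd
    have : Q.euler d e = ((Fintype.card {t // f t = d} : ℕ) : ℤ) := by
      rw [he, euler_sum_right, Finset.sum_congr rfl fun t _ => sys.euler_eq d hd _ (hf t)]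
      rw [Fintype.card_subtype, Finset.card_filter]
      push_cast
      exact Finset.sum_congr rfl fun t _ => by simp [eq_comm]
    rw [mult, this, Int.toNat_natCast]
  let E1 : T ≃ Σ d : sys.J, {t // f t = d.1} :=
    (Equiv.sigmaFiberEquiv (fun t => (⟨f t, hf t⟩ : sys.J))).symm.trans
      (Equiv.sigmaCongrRight fun d => Equiv.subtypeEquivRight fun t => by
        rw [Subtype.ext_iff])
  let E2 : (Σ d : sys.J, {t // f t = d.1}) ≃ sys.Idx (mult Q e) :=
    Equiv.sigmaCongrRight fun d => Fintype.equivFinOfCardEq (hm d.1 d.2)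
  have hE1 : ∀ x, x.1.1 = f (E1.symm x) := by
    rintro ⟨d, t, ht⟩
    exact ht.symm
  refine ⟨?_, hdec.reindex (E1.trans E2).symm ?_⟩
  · conv_lhs => rw [he]
    rw [← E1.symm.sum_comp, Fintype.sum_sigma,
      ← Finset.sum_coe_sort sys.J (fun d => mult Q e d • d)]
    refine Finset.sum_congr rfl fun d _ => ?_
    have : ∀ t : {t // f t = d.1}, f (E1.symm ⟨d, t⟩) = d.1 := fun t => (hE1 ⟨d, t⟩).symm
    simp only [this, Finset.sum_const, Finset.card_univ, hm d.1 d.2]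
  · intro t
    obtain ⟨x, rfl⟩ := E2.surjective t
    have : (E1.trans E2).symm (E2 x) = E1.symm x := by simp
    rw [this, ← hE1]
    rfl

/-- Semistable representations exist in all dimension vectors spanned by those of stable ones. -/
theorem exists_isSS (m : DimVec Q₀ → ℕ) :
    ∃ U : Q.Rep k (∑ d ∈ sys.J, m d • d), Q.IsSS θ μ U :=
  exists_isSS_sum _ _ fun d hd => exists_isSS_nsmul (sys.stable d hd).toIsSS (m d)

end StableSystem

omit [Fintype Q₀] [Fintype Q₁] in
theorem IsDecomp.exists_iso {T : Type*} [Fintype T] {S : ∀ d, Q.Rep k d} {f : T → DimVec Q₀}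
    {e : DimVec Q₀} {U U' : Q.Rep k e} {ι ι' : ∀ t, GrHom k (f t) e} {π π' : ∀ t, GrHom k e (f t)}
    (h : IsDecomp S f U ι π) (h' : IsDecomp S f U' ι' π') : Nonempty (Q.RepIso U U') := by
  classical
  have key : ∀ {U U' : Q.Rep k e} {ι ι' : ∀ t, GrHom k (f t) e} {π π' : ∀ t, GrHom k e (f t)}
      (h : IsDecomp S f U ι π) (h' : IsDecomp S f U' ι' π') (i : Q₀) (x : Fin (e i) → k),
      (∑ t, ι t i ∘ₗ π' t i) ((∑ t, ι' t i ∘ₗ π t i) x) = x := by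
    intro U U' ι ι' π π' h h' i x
    simp only [LinearMap.sum_apply, LinearMap.comp_apply, map_sum]
    conv_rhs => rw [← h.sum_ι_π i x]
    refine Finset.sum_congr rfl fun t _ => ?_
    rw [Finset.sum_eq_single t, h'.π_ι]
    · intro s _ hs
      rw [h'.π_ι_ne s t hs, map_zero]
    · simp
  refine ⟨⟨fun i => LinearEquiv.ofLinearMap (∑ t, ι' t i ∘ₗ π t i) (∑ t, ι t i ∘ₗ π' t i)
    (LinearMap.ext fun x => key h' h i x) (LinearMap.ext fun x => key h h' i x), ?_⟩⟩
  intro a x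
  simp only [LinearEquiv.coe_ofLinearMap, LinearMap.sum_apply, LinearMap.comp_apply, map_sum]
  exact Finset.sum_congr rfl fun t _ => by rw [h.hom_π t a, h'.hom_ι t a]

end Decomposition

/-! ### Automorphism groups and the ordinary series -/

section Automorphisms

variable {Q₀ Q₁ : Type*} [Fintype Q₀] [Fintype Q₁] {Q : InvolutiveQuiver Q₀ Q₁}
  {k : Type*} [Field k] {θ : Q₀ → ℤ} {μ : ℚ} (sys : StableSystem Q k θ μ)
  {m : DimVec Q₀ → ℕ} {e : DimVec Q₀} {U : Q.Rep k e}
  {ι : ∀ t : sys.Idx m, GrHom k t.1.1 e} {π : ∀ t : sys.Idx m, GrHom k e t.1.1}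

omit [Fintype Q₀] [Fintype Q₁] in
theorem IsDecomp.ext_ι {T : Type*} [Fintype T] {S : ∀ d, Q.Rep k d} {f : T → DimVec Q₀}
    {ι : ∀ t, GrHom k (f t) e} {π : ∀ t, GrHom k e (f t)} (h : IsDecomp S f U ι π) {d : DimVec Q₀}
    {φ ψ : GrHom k e d} (hφ : ∀ t i x, φ i (ι t i x) = ψ i (ι t i x)) : φ = ψ := by
  funext i
  refine LinearMap.ext fun x => ?_
  rw [← h.sum_ι_π i x, map_sum, map_sum]
  exact Finset.sum_congr rfl fun t _ => hφ t i _

namespace StableSystem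

/-- Block diagonal matrices, one block for each stable summand. -/
abbrev Blocks (m : DimVec Q₀ → ℕ) := ∀ d : sys.J, Matrix (Fin (m d.1)) (Fin (m d.1)) k

/-- The endomorphism of a direct sum of stable representations given by matrices of scalars. -/
def endo (ι : ∀ t : sys.Idx m, GrHom k t.1.1 e) (π : ∀ t : sys.Idx m, GrHom k e t.1.1)
    (c : sys.Blocks m) : GrHom k e e :=
  fun i => ∑ d : sys.J, ∑ u, ∑ v, c d u v • (ι ⟨d, u⟩ i ∘ₗ π ⟨d, v⟩ i)

variable {sys}

theorem endo_ι (h : IsDecomp sys.S (fun t : sys.Idx m => t.1.1) U ι π) (c : sys.Blocks m)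
    (d : sys.J) (v : Fin (m d.1)) (i : Q₀) (x : Fin (d.1 i) → k) :
    sys.endo ι π c i (ι ⟨d, v⟩ i x) = ∑ u, c d u v • ι ⟨d, u⟩ i x := by
  classical
  simp only [endo, LinearMap.sum_apply, LinearMap.smul_apply, LinearMap.comp_apply]
  rw [Finset.sum_eq_single d]
  · refine Finset.sum_congr rfl fun u _ => ?_
    rw [Finset.sum_eq_single v]
    · rw [h.π_ι ⟨d, v⟩ i x]
    · intro v' _ hv
      rw [h.π_ι_ne ⟨d, v'⟩ ⟨d, v⟩ (fun hh => hv (by simpa using hh)), map_zero, smul_zero]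
    · simp
  · intro d' _ hd
    refine Finset.sum_eq_zero fun u _ => Finset.sum_eq_zero fun v' _ => ?_
    rw [h.π_ι_ne ⟨d', v'⟩ ⟨d, v⟩ (fun hh => hd (congrArg Sigma.fst hh)), map_zero, smul_zero]
  · simp

theorem isHom_endo (h : IsDecomp sys.S (fun t : sys.Idx m => t.1.1) U ι π) (c : sys.Blocks m) :
    IsHom U U (sys.endo ι π c) := by
  intro a x
  simp only [endo, LinearMap.sum_apply, LinearMap.smul_apply, LinearMap.comp_apply, map_sum,
    map_smul]
  refine Finset.sum_congr rfl fun d _ => Finset.sum_congr rfl fun u _ =>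
    Finset.sum_congr rfl fun v _ => ?_
  rw [h.hom_π ⟨d, v⟩ a, h.hom_ι ⟨d, u⟩ a]

theorem endo_mul (h : IsDecomp sys.S (fun t : sys.Idx m => t.1.1) U ι π) (c c' : sys.Blocks m) :
    (fun i => sys.endo ι π c i ∘ₗ sys.endo ι π c' i) = sys.endo ι π (fun d => c d * c' d) := by
  refine h.ext_ι fun t i x => ?_
  obtain ⟨d, v⟩ := t
  rw [LinearMap.comp_apply, endo_ι h, endo_ι h, map_sum]
  simp only [map_smul, endo_ι h, Finset.smul_sum, Matrix.mul_apply, Finset.sum_smul, smul_smul]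
  rw [Finset.sum_comm]
  exact Finset.sum_congr rfl fun u _ => Finset.sum_congr rfl fun w _ => by rw [mul_comm]

theorem endo_one (h : IsDecomp sys.S (fun t : sys.Idx m => t.1.1) U ι π) :
    sys.endo ι π (fun _ => 1) = fun _ => LinearMap.id := by
  refine h.ext_ι fun t i x => ?_
  obtain ⟨d, v⟩ := t
  rw [endo_ι h, Finset.sum_eq_single v]
  · simp
  · intro u _ hu
    rw [Matrix.one_apply_ne hu, zero_smul]
  · simp

/-- A non-zero vector of the stable representation of dimension vector `d`. -/
theorem exists_vec (d : sys.J) : ∃ (i : Q₀) (x : Fin (d.1 i) → k), x ≠ 0 := by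
  obtain ⟨i, hi⟩ := Function.ne_iff.mp (sys.stable d.1 d.2).ne_zero
  refine ⟨i, fun _ => 1, fun h => ?_⟩
  exact one_ne_zero (congrFun h ⟨0, Nat.pos_of_ne_zero hi⟩)

theorem endo_injective (h : IsDecomp sys.S (fun t : sys.Idx m => t.1.1) U ι π) :
    Function.Injective (sys.endo ι π) := by
  classical
  intro c c' hc
  funext d
  ext u v
  obtain ⟨i, x, hx⟩ := exists_vec d
  have key : ∀ c : sys.Blocks m,
      π ⟨d, u⟩ i (sys.endo ι π c i (ι ⟨d, v⟩ i x)) = c d u v • x := by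
    intro c
    rw [endo_ι h, map_sum, Finset.sum_eq_single u]
    · rw [map_smul, h.π_ι ⟨d, u⟩ i x]
    · intro w _ hw
      rw [map_smul, h.π_ι_ne ⟨d, u⟩ ⟨d, w⟩ (fun hh => hw (by simpa using hh.symm)), smul_zero]
    · simp
  have := (key c).symm.trans ((congrArg (fun φ : GrHom k e e => π ⟨d, u⟩ i (φ i (ι ⟨d, v⟩ i x)))
    hc).trans (key c'))
  exact smul_left_injective k hx this

theorem endo_surjective (h : IsDecomp sys.S (fun t : sys.Idx m => t.1.1) U ι π) {φ : GrHom k e e}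
    (hφ : IsHom U U φ) : ∃ c, sys.endo ι π c = φ := by
  have h1 : ∀ (d : sys.J) (u v : Fin (m d.1)), ∃ c : k, ∀ i x,
      π ⟨d, u⟩ i (φ i (ι ⟨d, v⟩ i x)) = c • x := by
    intro d u v
    obtain ⟨c, hc⟩ := sys.endo_scalar d.1 d.2 _ (((h.hom_π ⟨d, u⟩).comp hφ).comp (h.hom_ι ⟨d, v⟩))
    exact ⟨c, fun i x => LinearMap.congr_fun (congrFun hc i) x⟩
  choose c hc using h1
  refine ⟨fun d => Matrix.of (c d), h.ext_ι fun t i x => ?_⟩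
  obtain ⟨d, v⟩ := t
  change Fin (d.1 i) → k at x
  rw [endo_ι h]
  conv_rhs => rw [← h.sum_ι_π i (φ i (ι ⟨d, v⟩ i x)), Fintype.sum_sigma]
  rw [Finset.sum_eq_single d]
  · exact Finset.sum_congr rfl fun u _ => by rw [hc d u v i x, map_smul, Matrix.of_apply]
  · intro d' _ hd
    refine Finset.sum_eq_zero fun u _ => ?_
    have h2 := (sys.stable d.1 d.2).hom_eq_zero (sys.stable d'.1 d'.2)
      (fun hh => hd (Subtype.ext hh.symm))
      (((h.hom_π ⟨d', u⟩).comp hφ).comp (h.hom_ι ⟨d, v⟩))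
    have h3 := LinearMap.congr_fun (congrFun h2 i) x
    simp only [LinearMap.comp_apply, Pi.zero_apply, LinearMap.zero_apply] at h3
    rw [h3, map_zero]
  · simp

/-- The automorphism group of `⨁ S_d^{m_d}` is `∏ GL_{m_d}`. -/
theorem card_aut (h : IsDecomp sys.S (fun t : sys.Idx m => t.1.1) U ι π) :
    Nat.card (Q.RepIso U U) = ∏ d ∈ sys.J, Nat.card (GL (Fin (m d)) k) := by
  rw [← Finset.prod_coe_sort sys.J (fun d => Nat.card (GL (Fin (m d)) k)), ← Nat.card_pi]
  refine (Nat.card_eq_of_bijective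
    (fun g : ∀ d : sys.J, GL (Fin (m d.1)) k => (⟨fun i =>
      LinearEquiv.ofLinearMap (sys.endo ι π (fun d => (g d).1) i)
        (sys.endo ι π (fun d => (g d)⁻¹.1) i)
        ((congrFun (endo_mul h _ _) i).trans (by
          simp only [Units.mul_inv]
          exact congrFun (endo_one h) i))
        ((congrFun (endo_mul h _ _) i).trans (by
          simp only [Units.inv_mul]
          exact congrFun (endo_one h) i)),
      fun a x => isHom_endo h _ a x⟩ : Q.RepIso U U)) ⟨?_, ?_⟩).symm
  · intro g g' hg
    have h1 : sys.endo ι π (fun d => (g d).1) = sys.endo ι π (fun d => (g' d).1) := by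
      funext i
      refine LinearMap.ext fun x => ?_
      exact LinearEquiv.congr_fun (congrFun (congrArg Subtype.val hg) i) x
    funext d
    exact Units.ext (congrFun (endo_injective h h1) d)
  · rintro ⟨φ, hφ⟩
    obtain ⟨c, hc⟩ := endo_surjective h (φ := fun i => (φ i).toLinearMap) hφ
    have hφ' : IsHom U U (fun i => (φ i).symm.toLinearMap) := by
      intro a x
      show (φ _).symm (U a x) = U a ((φ _).symm x)
      rw [LinearEquiv.symm_apply_eq, hφ, LinearEquiv.apply_symm_apply]
    obtain ⟨c', hc'⟩ := endo_surjective h hφ'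
    have h1 : ∀ d, c d * c' d = 1 := by
      refine fun d =>
        congrFun (endo_injective h (a₁ := fun d => c d * c' d) (a₂ := fun _ => 1) ?_) d
      rw [endo_one h, ← endo_mul h, hc, hc']
      funext i
      exact LinearMap.ext fun x => (φ i).apply_symm_apply x
    refine ⟨fun d => ⟨c d, c' d, h1 d, mul_eq_one_comm.mp (h1 d)⟩,
      Subtype.ext (funext fun i => LinearEquiv.ext fun x => ?_)⟩
    exact LinearMap.congr_fun (congrFun hc i) x

end StableSystem

omit [Fintype Q₁] in
theorem IsSS.of_iso {M N : Q.Rep k e} (hM : Q.IsSS θ μ M) (h : Nonempty (Q.RepIso M N)) :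
    Q.IsSS θ μ N := by
  obtain ⟨φ, hφ⟩ := h
  refine ⟨hM.lam_eq_zero, fun W hW => ?_⟩
  have h1 : IsHom M N (fun i => (φ i).toLinearMap) := hφ
  have h2 := hM.lam_le _ (h1.isSubrep_comap hW)
  rw [← subDim_map (fun i => (φ i).toLinearMap) (fun i => (φ i).injective)] at h2
  have h3 : (fun i => ((W i).comap (φ i).toLinearMap).map (φ i).toLinearMap) = W := by
    funext i
    exact Submodule.map_comap_eq_of_surjective (φ i).surjective _
  rwa [h3] at h2

/-- The total count of semistable representations of slope `μ`, weighted by automorphisms. -/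
theorem StableSystem.finsum_eq (e : DimVec Q₀) (P : Q.Rep k e → Prop)
    (hP : ∀ U, P U ↔ Q.IsSS θ μ U) [DecidablePred P] :
    (∑ᶠ U : Quotient (Q.repSetoid k e),
      if P U.out then 1 / (Nat.card (Q.RepIso U.out U.out) : ℝ) else 0) =
    if e = ∑ d ∈ sys.J, StableSystem.mult Q e d • d then
      ∏ d ∈ sys.J, 1 / (Nat.card (GL (Fin (StableSystem.mult Q e d)) k) : ℝ) else 0 := by
  split_ifs with he
  · obtain ⟨U₀, hU₀⟩ : ∃ U : Q.Rep k e, Q.IsSS θ μ U := he ▸ sys.exists_isSS _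
    obtain ⟨-, ι, π, h⟩ := sys.hasDecomp U₀ hU₀
    rw [finsum_eq_single _ (Quotient.mk (Q.repSetoid k e) U₀)]
    · have hr : Nonempty (Q.RepIso (Quotient.mk (Q.repSetoid k e) U₀).out U₀) :=
        Quotient.exact (Quotient.out_eq (Quotient.mk (Q.repSetoid k e) U₀))
      have hss := hU₀.of_iso ((Q.repSetoid k e).iseqv.symm hr)
      rw [if_pos ((hP _).mpr hss)]
      obtain ⟨-, ι', π', h'⟩ := sys.hasDecomp _ hss
      rw [StableSystem.card_aut h', Nat.cast_prod, one_div, ← Finset.prod_inv_distrib]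
      simp
    · intro c hc
      rw [if_neg]
      intro hcs
      obtain ⟨-, ι', π', h'⟩ := sys.hasDecomp _ ((hP _).mp hcs)
      apply hc
      rw [← Quotient.out_eq c]
      exact Quotient.sound (h'.exists_iso h)
  · refine (finsum_congr fun c => if_neg fun hc => he ?_).trans finsum_zero
    exact (sys.hasDecomp _ ((hP _).mp hc)).1

theorem StableSystem.euler_self (m : DimVec Q₀ → ℕ) :
    Q.euler (∑ d ∈ sys.J, m d • d) (∑ d ∈ sys.J, m d • d) = ∑ d ∈ sys.J, (m d : ℤ) ^ 2 := by
  rw [euler_sum_left]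
  refine Finset.sum_congr rfl fun d hd => ?_
  rw [euler_smul_left, sys.euler_sum m hd, sq]

theorem card_GL_eq [Finite k] (n : ℕ) :
    (Nat.card (GL (Fin n) k) : ℝ)
      = ∏ j ∈ Finset.range n, ((Nat.card k : ℝ) ^ n - (Nat.card k : ℝ) ^ j) := by
  have := Fintype.ofFinite k
  rw [Matrix.card_GL_field, Nat.card_eq_fintype_card,
    Finset.prod_range fun j => ((Fintype.card k : ℝ) ^ n - (Fintype.card k : ℝ) ^ j), Nat.cast_prod]
  refine Finset.prod_congr rfl fun j _ => ?_
  rw [Nat.cast_sub (Nat.pow_le_pow_right Fintype.card_pos j.2.le)]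
  push_cast
  rfl

theorem coeff_qDilog_sqrt [Finite k] (n : ℕ) :
    PowerSeries.coeff n (qDilog √(Nat.card k : ℝ))
      = √(Nat.card k : ℝ) ^ (n ^ 2) / Nat.card (GL (Fin n) k) := by
  rw [card_GL_eq, qDilog, PowerSeries.coeff_mk]
  simp only [pow_mul, Real.sq_sqrt (Nat.cast_nonneg _)]

/-- The series `A_μ` in terms of multiplicities of stable summands. -/
theorem StableSystem.slopeSeries_eq [DecidableEq Q₀] [Finite k] (e : DimVec Q₀) :
    Q.slopeSeries k θ μ e = if e = ∑ d ∈ sys.J, StableSystem.mult Q e d • d then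
      ∏ d ∈ sys.J, PowerSeries.coeff (StableSystem.mult Q e d) (qDilog √(Nat.card k : ℝ))
      else 0 := by
  classical
  have hq : √(Nat.card k : ℝ) ≠ 0 := by
    rw [Real.sqrt_ne_zero']
    exact_mod_cast Nat.card_pos
  unfold slopeSeries
  by_cases h0 : e = 0 ∨ slope θ e = μ
  · rw [if_pos h0, sys.finsum_eq e (fun U => Q.IsSemistable θ U)
      (fun U => by rw [isSS_iff]; exact ⟨fun h => ⟨h0, h⟩, fun h => h.2⟩)]
    split_ifs with he
    · have h1 : Q.euler e e = ∑ d ∈ sys.J, (StableSystem.mult Q e d : ℤ) ^ 2 := by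
        conv_lhs => rw [he]
        exact sys.euler_self _
      have h2 : √(Nat.card k : ℝ) ^ Q.euler e e
          = ∏ d ∈ sys.J, √(Nat.card k : ℝ) ^ (StableSystem.mult Q e d ^ 2) := by
        rw [Finset.prod_pow_eq_pow_sum, h1, ← zpow_natCast]
        push_cast
        rfl
      rw [h2, ← Finset.prod_mul_distrib]
      refine Finset.prod_congr rfl fun d _ => ?_
      rw [coeff_qDilog_sqrt, mul_one_div]
    · rw [mul_zero]
  · rw [if_neg h0, if_neg]
    intro he
    obtain ⟨U, hU⟩ : ∃ U : Q.Rep k e, Q.IsSS θ μ U := he ▸ sys.exists_isSS _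
    exact h0 (isSS_iff.mp hU).1

end Automorphisms

end InvolutiveQuiver

/-! ### Computations in the quantum torus -/

section EvalAt

variable {Q₀ : Type*} [Fintype Q₀]

/-- The total dimension. -/
def deg (v : DimVec Q₀) : ℕ := ∑ i, v i

theorem deg_add (v w : DimVec Q₀) : deg (v + w) = deg v + deg w := Finset.sum_add_distrib

theorem deg_nsmul (n : ℕ) (v : DimVec Q₀) : deg (n • v) = n * deg v := by
  simp [deg, Finset.mul_sum]

theorem deg_eq_zero {v : DimVec Q₀} : deg v = 0 ↔ v = 0 := by
  simp [deg, funext_iff]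

theorem deg_pos {v : DimVec Q₀} (hv : v ≠ 0) : 0 < deg v :=
  Nat.pos_of_ne_zero fun h => hv (deg_eq_zero.mp h)

theorem nsmul_left_injective' {d : DimVec Q₀} (hd : d ≠ 0) {m n : ℕ} (h : m • d = n • d) :
    m = n := by
  have := congrArg deg h
  rw [deg_nsmul, deg_nsmul] at this
  exact Nat.eq_of_mul_eq_mul_right (deg_pos hd) this

theorem evalAt_nsmul (f : PowerSeries ℝ) {d : DimVec Q₀} (hd : d ≠ 0) (n : ℕ) :
    evalAt f d (n • d) = PowerSeries.coeff n f := by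
  unfold evalAt
  rw [Finset.sum_eq_single n, if_pos rfl]
  · intro m _ hm
    rw [if_neg fun h => hm (nsmul_left_injective' hd h).symm]
  · intro h
    refine absurd (Finset.mem_range.mpr ?_) h
    have h1 : ∑ i, (n • d) i = n * deg d := deg_nsmul n d
    rw [h1]
    exact Nat.lt_succ_of_le (Nat.le_mul_of_pos_right n (deg_pos hd))

theorem exists_of_evalAt_ne_zero {f : PowerSeries ℝ} {d v : DimVec Q₀} (h : evalAt f d v ≠ 0) :
    ∃ n : ℕ, v = n • d := by
  unfold evalAt at h
  obtain ⟨n, -, hn⟩ := Finset.exists_ne_zero_of_sum_ne_zero h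
  by_contra hc
  push Not at hc
  exact hn (if_neg (hc n))

theorem evalAt_zero (f : PowerSeries ℝ) {d : DimVec Q₀} (hd : d ≠ 0) :
    evalAt f d 0 = PowerSeries.constantCoeff f := by
  have := evalAt_nsmul f hd 0
  rwa [zero_smul, PowerSeries.coeff_zero_eq_constantCoeff] at this

theorem evalAt_one [DecidableEq Q₀] {d : DimVec Q₀} (hd : d ≠ 0) :
    evalAt 1 d = Pi.single 0 1 := by
  funext v
  by_cases hv : v = 0
  · subst hv
    rw [evalAt_zero _ hd, Pi.single_eq_same, map_one]
  · rw [Pi.single_eq_of_ne hv]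
    by_contra h
    obtain ⟨n, rfl⟩ := exists_of_evalAt_ne_zero h
    rw [evalAt_nsmul _ hd, PowerSeries.coeff_one] at h
    have hn : n ≠ 0 := fun hn => hv (by rw [hn, zero_smul])
    exact h (if_neg hn)

/-- Up to the total dimension of `d`, the series `f(x_d)` has only terms in `1` and `x_d`. -/
theorem evalAt_eq_zero (f : PowerSeries ℝ) {d v : DimVec Q₀} (hv : v ≠ 0) (hvd : v ≠ d)
    (h : deg v ≤ deg d) : evalAt f d v = 0 := by
  by_contra hc
  obtain ⟨n, rfl⟩ := exists_of_evalAt_ne_zero hc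
  rw [deg_nsmul] at h
  have h0 : n ≠ 0 := fun hn => hv (by rw [hn, zero_smul])
  have h1 : n ≠ 1 := fun hn => hvd (by rw [hn, one_smul])
  have h2 : 0 < deg d := deg_pos fun hd => hv (by rw [hd, smul_zero])
  have : 2 * deg d ≤ n * deg d := Nat.mul_le_mul_right _ (by omega)
  omega

theorem constantCoeff_qDilog (r : ℝ) : PowerSeries.constantCoeff (qDilog r) = 1 := by
  rw [← PowerSeries.coeff_zero_eq_constantCoeff_apply, qDilog, PowerSeries.coeff_mk]
  simp

theorem coeff_one_qDilog (r : ℝ) : PowerSeries.coeff 1 (qDilog r) = r / (r ^ 2 - 1) := by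
  rw [qDilog, PowerSeries.coeff_mk]
  simp

theorem constantCoeff_seriesZPow {f : PowerSeries ℝ} (hf : PowerSeries.constantCoeff f = 1)
    (c : ℤ) : PowerSeries.constantCoeff (seriesZPow f c) = 1 := by
  simp [seriesZPow, hf]

theorem coeff_one_seriesZPow {f : PowerSeries ℝ} (hf : PowerSeries.constantCoeff f = 1) (c : ℤ) :
    PowerSeries.coeff 1 (seriesZPow f c) = c * PowerSeries.coeff 1 f := by
  have hp : ∀ (g : PowerSeries ℝ), PowerSeries.constantCoeff g = 1 → ∀ n : ℕ,
      PowerSeries.coeff 1 (g ^ n) = n * PowerSeries.coeff 1 g := by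
    intro g hg n
    induction n with
    | zero => simp [PowerSeries.coeff_one]
    | succ n ih =>
      rw [pow_succ, PowerSeries.coeff_one_mul, ih, map_pow, hg]
      push_cast
      ring
  have hi : PowerSeries.coeff 1 f⁻¹ = - PowerSeries.coeff 1 f := by
    have h1 : f * f⁻¹ = 1 := PowerSeries.mul_inv_cancel f (by rw [hf]; exact one_ne_zero)
    have h2 := congrArg (PowerSeries.coeff 1) h1
    rw [PowerSeries.coeff_one_mul, PowerSeries.constantCoeff_inv, hf, PowerSeries.coeff_one] at h2
    simp at h2
    linarith
  have h3 : ((c.toNat : ℤ) : ℝ) - (((-c).toNat : ℤ) : ℝ) = c := by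
    rw [← Int.cast_sub, Int.toNat_sub_toNat_neg]
  rw [seriesZPow, PowerSeries.coeff_one_mul, hp f hf, hp f⁻¹ (by simp [hf]), map_pow, map_pow, hi]
  simp only [PowerSeries.constantCoeff_inv, hf, inv_one, one_pow, mul_one]
  push_cast at h3
  linear_combination PowerSeries.coeff 1 f * h3

end EvalAt

namespace InvolutiveQuiver

section Torus

variable {Q₀ Q₁ : Type*} [Fintype Q₀] [DecidableEq Q₀] [Fintype Q₁] {Q : InvolutiveQuiver Q₀ Q₁}

omit [DecidableEq Q₀] in
theorem skew_zero_left (v : DimVec Q₀) : Q.skew 0 v = 0 := by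
  rw [skew, euler_zero_left, euler_zero_right, sub_zero]

omit [DecidableEq Q₀] in
theorem skew_zero_right (v : DimVec Q₀) : Q.skew v 0 = 0 := by
  rw [skew, euler_zero_left, euler_zero_right, sub_zero]

theorem torusProd_cons (r : ℝ) (f : DimVec Q₀ → ℝ) (l : List (DimVec Q₀ → ℝ)) :
    Q.torusProd r (f :: l) = Q.torusMul r f (Q.torusProd r l) := rfl

theorem torusMul_apply_zero (r : ℝ) (f g : DimVec Q₀ → ℝ) : Q.torusMul r f g 0 = f 0 * g 0 := by
  unfold torusMul
  rw [Finset.sum_eq_single 0]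
  · rw [tsub_self, skew_zero_left, zpow_zero, mul_one]
  · intro b hb hb0
    rw [Finset.mem_Iic] at hb
    exact absurd (le_antisymm hb (fun i => Nat.zero_le _)) hb0
  · simp

theorem one_torusMul (r : ℝ) (g : DimVec Q₀ → ℝ) : Q.torusMul r (Pi.single 0 1) g = g := by
  funext v
  unfold torusMul
  rw [Finset.sum_eq_single 0]
  · rw [Pi.single_eq_same, skew_zero_left, zpow_zero, mul_one, one_mul]
    congr 1
  · intro b hb hb0
    rw [Pi.single_eq_of_ne hb0, zero_mul, zero_mul]
  · intro h
    exact absurd (Finset.mem_Iic.mpr fun i => Nat.zero_le _) h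

theorem torusMul_apply_of_ne_zero (r : ℝ) (f g : DimVec Q₀ → ℝ) {v : DimVec Q₀} (hv : v ≠ 0) :
    Q.torusMul r f g v = f 0 * g v + f v * g 0 +
      ∑ a ∈ ((Finset.Iic v).erase 0).erase v, f a * g (v - a) * r ^ Q.skew a (v - a) := by
  unfold torusMul
  have h0 : (0 : DimVec Q₀) ∈ Finset.Iic v := Finset.mem_Iic.mpr fun i => Nat.zero_le _
  have hv' : v ∈ (Finset.Iic v).erase 0 := Finset.mem_erase.mpr ⟨hv, Finset.mem_Iic.mpr le_rfl⟩
  rw [← Finset.add_sum_erase _ _ h0, ← Finset.add_sum_erase _ _ hv', skew_zero_left, tsub_self,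
    skew_zero_right, zpow_zero, mul_one, mul_one, ← add_assoc]
  congr 3

/-- Changing the factors of a product in degree `N` and above changes the product additively in
degree `N`. -/
theorem torusProd_triangular {ι : Type*} (r : ℝ) (l : List ι) (f g : ι → DimVec Q₀ → ℝ) (N : ℕ)
    (hf : ∀ t ∈ l, f t 0 = 1) (hg : ∀ t ∈ l, g t 0 = 1)
    (hfg : ∀ t ∈ l, ∀ w, deg w < N → f t w = g t w) :
    Q.torusProd r (l.map f) 0 = 1 ∧ Q.torusProd r (l.map g) 0 = 1 ∧
    (∀ w, deg w < N → Q.torusProd r (l.map f) w = Q.torusProd r (l.map g) w) ∧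
    ∀ v, v ≠ 0 → deg v = N → Q.torusProd r (l.map f) v - Q.torusProd r (l.map g) v
      = (l.map fun t => f t v - g t v).sum := by
  induction l with
  | nil => simp [torusProd]
  | cons t l ih =>
    obtain ⟨h1, h2, h3, h4⟩ := ih (fun s hs => hf s (List.mem_cons_of_mem _ hs))
      (fun s hs => hg s (List.mem_cons_of_mem _ hs))
      (fun s hs => hfg s (List.mem_cons_of_mem _ hs))
    have hft := hf t (List.mem_cons_self ..)
    have hgt := hg t (List.mem_cons_self ..)
    have hfgt := hfg t (List.mem_cons_self ..)
    have hdeg : ∀ a v : DimVec Q₀, a ≤ v → deg a + deg (v - a) = deg v := by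
      intro a v hav
      rw [← deg_add]
      congr 1
      funext i
      exact Nat.add_sub_cancel' (hav i)
    simp only [List.map_cons, torusProd_cons]
    refine ⟨?_, ?_, ?_, ?_⟩
    · rw [torusMul_apply_zero, hft, h1, one_mul]
    · rw [torusMul_apply_zero, hgt, h2, one_mul]
    · intro w hw
      unfold torusMul
      refine Finset.sum_congr rfl fun a ha => ?_
      have := hdeg a w (Finset.mem_Iic.mp ha)
      rw [hfgt a (by omega), h3 (w - a) (by omega)]
    · intro v hv hvN
      rw [torusMul_apply_of_ne_zero r _ _ hv, torusMul_apply_of_ne_zero r _ _ hv, hft, hgt, h1, h2,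
        List.sum_cons, ← h4 v hv hvN]
      have : ∑ a ∈ ((Finset.Iic v).erase 0).erase v, f t a * Q.torusProd r (l.map f) (v - a)
            * r ^ Q.skew a (v - a)
          = ∑ a ∈ ((Finset.Iic v).erase 0).erase v, g t a * Q.torusProd r (l.map g) (v - a)
            * r ^ Q.skew a (v - a) := by
        refine Finset.sum_congr rfl fun a ha => ?_
        simp only [Finset.mem_erase, Finset.mem_Iic] at ha
        have h5 := hdeg a v ha.2.2
        have h6 := deg_pos ha.2.1
        have h7 : 0 < deg (v - a) := by
          refine deg_pos fun h => ha.1 ?_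
          exact le_antisymm ha.2.2 (tsub_eq_zero_iff_le.mp h)
        rw [hfgt a (by omega), h3 (v - a) (by omega)]
      rw [this]
      ring

/-- Trivial factors can be dropped. -/
theorem torusProd_filter (r : ℝ) (F : PowerSeries ℝ) (Ω : DimVec Q₀ → ℤ) (l : List (DimVec Q₀))
    (hl : ∀ d ∈ l, d ≠ 0) :
    Q.torusProd r (l.map fun d => evalAt (seriesZPow F (Ω d)) d)
      = Q.torusProd r ((l.filter fun d => Ω d ≠ 0).map fun d => evalAt (seriesZPow F (Ω d)) d) := by
  induction l with
  | nil => rfl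
  | cons d l ih =>
    have ih := ih fun e he => hl e (List.mem_cons_of_mem _ he)
    by_cases h : Ω d = 0
    · rw [List.filter_cons_of_neg (by simpa using h), ← ih]
      have : evalAt (seriesZPow F (Ω d)) d = Pi.single 0 1 := by
        rw [h, ← evalAt_one (hl d (List.mem_cons_self ..))]
        simp [seriesZPow]
      rw [List.map_cons, torusProd_cons, this, one_torusMul]
    · rw [List.filter_cons_of_pos (by simpa using h)]
      rw [List.map_cons, List.map_cons, torusProd_cons, torusProd_cons, ih]

variable {k : Type*} [Field k] {θ : Q₀ → ℤ} {μ : ℚ}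

/-- The ordinary DT invariants are determined by the factorization: by induction on the total
dimension, as `Ω_d` enters the coefficient of `x_d` through the term `Ω_d q^{1/2} / (q - 1)`. -/
theorem IsDTInvariant.unique [Finite k] {Ω Ω' : DimVec Q₀ → ℤ} (h : Q.IsDTInvariant k θ Ω)
    (h' : Q.IsDTInvariant k θ Ω') : Ω' = Ω := by
  have hq : (1 : ℝ) < Nat.card k := by exact_mod_cast Finite.one_lt_card
  set r := √(Nat.card k : ℝ) with hr
  have hr0 : r ≠ 0 := by rw [hr, Real.sqrt_ne_zero']; linarith
  have hr2 : r ^ 2 = Nat.card k := Real.sq_sqrt (by linarith)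
  funext v
  induction hN : deg v using Nat.strong_induction_on generalizing v with
  | _ N ih =>
    by_cases hv : v = 0
    · rw [hv, h.zero, h'.zero]
    have hfin : {d | (Ω d ≠ 0 ∨ Ω' d ≠ 0) ∧ slope θ d = slope θ v}.Finite :=
      (h.finite.union h'.finite).subset fun d hd => hd.1
    let L := hfin.toFinset.toList
    have hmem : ∀ d, d ∈ L ↔ (Ω d ≠ 0 ∨ Ω' d ≠ 0) ∧ slope θ d = slope θ v := fun d => by
      simp only [L, Finset.mem_toList, Set.Finite.mem_toFinset]
      rfl
    have hL0 : ∀ d ∈ L, d ≠ 0 := by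
      rintro d hd rfl
      rw [hmem, h.zero, h'.zero] at hd
      simp at hd
    by_cases hvL : v ∈ L
    swap
    · rw [hmem] at hvL
      push Not at hvL
      by_contra hne
      by_cases h1 : Ω v = 0
      · exact hvL (Or.inr fun h2 => hne (by rw [h1, h2])) rfl
      · exact hvL (Or.inl h1) rfl
    have hnd : L.Nodup := Finset.nodup_toList _
    have e1 := h.factorization (slope θ v) (L.filter fun d => Ω d ≠ 0) (hnd.filter _) (fun d => by
      rw [List.mem_filter, hmem]
      simp only [ne_eq, decide_eq_true_eq]
      tauto)
    have e2 := h'.factorization (slope θ v) (L.filter fun d => Ω' d ≠ 0) (hnd.filter _) (fun d => by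
      rw [List.mem_filter, hmem]
      simp only [ne_eq, decide_eq_true_eq]
      tauto)
    rw [← torusProd_filter _ _ _ _ hL0] at e1 e2
    have e3 := congrFun (e2.symm.trans e1) v
    have hc : ∀ c, PowerSeries.constantCoeff (seriesZPow (qDilog r) c) = 1 :=
      constantCoeff_seriesZPow (constantCoeff_qDilog r)
    -- By induction the two products have the same factors in degrees below `N`.
    have key := (torusProd_triangular (Q := Q) r L
      (fun d => evalAt (seriesZPow (qDilog r) (Ω' d)) d)
      (fun d => evalAt (seriesZPow (qDilog r) (Ω d)) d) N
      (fun d hd => by rw [evalAt_zero _ (hL0 d hd), hc])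
      (fun d hd => by rw [evalAt_zero _ (hL0 d hd), hc])
      (fun d hd w hw => by
        by_cases hdN : deg d < N
        · rw [ih _ hdN d rfl]
        · by_cases hw0 : w = 0
          · rw [hw0, evalAt_zero _ (hL0 d hd), evalAt_zero _ (hL0 d hd), hc, hc]
          · have hwd : w ≠ d := by rintro rfl; exact hdN hw
            rw [evalAt_eq_zero _ hw0 hwd (by omega), evalAt_eq_zero _ hw0 hwd (by omega)])).2.2.2
      v hv hN
    rw [sub_eq_zero.mpr e3] at key
    have hsum : (L.map fun d => evalAt (seriesZPow (qDilog r) (Ω' d)) d v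
        - evalAt (seriesZPow (qDilog r) (Ω d)) d v).sum
        = ((Ω' v - Ω v : ℤ) : ℝ) * (r / (r ^ 2 - 1)) := by
      rw [← List.sum_toFinset _ hnd, Finset.sum_eq_single v]
      · have e5 : ∀ F : PowerSeries ℝ, evalAt F v v = PowerSeries.coeff 1 F := fun F => by
          have := evalAt_nsmul F hv 1
          rwa [one_smul] at this
        rw [e5, e5, coeff_one_seriesZPow (constantCoeff_qDilog r),
          coeff_one_seriesZPow (constantCoeff_qDilog r), coeff_one_qDilog]
        push_cast
        ring
      · intro d hd hdv
        rw [sub_eq_zero]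
        by_cases hdN : deg d < N
        · rw [ih _ hdN d rfl]
        · rw [evalAt_eq_zero _ hv hdv.symm (by omega), evalAt_eq_zero _ hv hdv.symm (by omega)]
      · intro hv'
        exact absurd (List.mem_toFinset.mpr hvL) hv'
    rw [hsum, hr2] at key
    have h5 : ((Ω' v - Ω v : ℤ) : ℝ) = 0 := by
      rcases mul_eq_zero.mp key.symm with h | h
      · exact h
      · rw [div_eq_zero_iff] at h
        rcases h with h | h
        · exact absurd h hr0
        · linarith
    have := Int.cast_eq_zero.mp h5
    omega

variable (sys : StableSystem Q k θ μ)

omit [DecidableEq Q₀] in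
theorem StableSystem.euler_comm {d e : DimVec Q₀} (hd : d ∈ sys.J) (he : e ∈ sys.J) :
    Q.euler d e = Q.euler e d := by
  rw [sys.euler_eq d hd e he, sys.euler_eq e he d hd]
  simp only [eq_comm]

omit [DecidableEq Q₀] in
theorem StableSystem.skew_sum {L L' : Finset (DimVec Q₀)} (hL : L ⊆ sys.J) (hL' : L' ⊆ sys.J)
    (m m' : DimVec Q₀ → ℕ) : Q.skew (∑ d ∈ L, m d • d) (∑ d ∈ L', m' d • d) = 0 := by
  rw [skew, sub_eq_zero]
  simp only [euler_sum_left, euler_sum_right, euler_smul_left, euler_smul_right, Finset.mul_sum]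
  rw [Finset.sum_comm]
  refine Finset.sum_congr rfl fun d hd => Finset.sum_congr rfl fun e he => ?_
  rw [sys.euler_comm (hL hd) (hL' he)]
  ring

omit [DecidableEq Q₀] in
theorem StableSystem.mult_sum_subset {L : Finset (DimVec Q₀)} (hL : L ⊆ sys.J)
    (m : DimVec Q₀ → ℕ) {d : DimVec Q₀} (hd : d ∈ L) :
    StableSystem.mult Q (∑ d' ∈ L, m d' • d') d = m d := by
  classical
  have : ∑ d' ∈ L, m d' • d' = ∑ d' ∈ sys.J, (if d' ∈ L then m d' else 0) • d' := by
    rw [← Finset.sum_subset hL]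
    · exact Finset.sum_congr rfl fun d' hd' => by rw [if_pos hd']
    · intro d' _ hd'
      rw [if_neg hd', zero_smul]
  rw [this, sys.mult_sum _ (hL hd), if_pos hd]

omit [DecidableEq Q₀] in
theorem StableSystem.ne_zero {d : DimVec Q₀} (hd : d ∈ sys.J) : d ≠ 0 := (sys.stable d hd).ne_zero

/-- Products of series in the commuting variables `x_d`, for `d` in an orthonormal set `J`. -/
theorem StableSystem.torusProd_eq (r : ℝ) (F : DimVec Q₀ → PowerSeries ℝ) (l : List (DimVec Q₀))
    (hl : l.Nodup) (hJ : l.toFinset ⊆ sys.J) (v : DimVec Q₀) :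
    Q.torusProd r (l.map fun d => evalAt (F d) d) v =
      if v = ∑ d ∈ l.toFinset, StableSystem.mult Q v d • d then
        ∏ d ∈ l.toFinset, PowerSeries.coeff (StableSystem.mult Q v d) (F d) else 0 := by
  induction l generalizing v with
  | nil =>
    simp only [List.map_nil, List.toFinset_nil, Finset.sum_empty, Finset.prod_empty]
    show (Pi.single 0 1 : DimVec Q₀ → ℝ) v = _
    rw [Pi.single_apply]
    congr 1
  | cons d l ih =>
    rw [List.nodup_cons] at hl
    have hdl : d ∉ l.toFinset := fun h => hl.1 (List.mem_toFinset.mp h)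
    rw [List.toFinset_cons] at hJ ⊢
    have hlJ : l.toFinset ⊆ sys.J := (Finset.subset_insert _ _).trans hJ
    have hdJ : d ∈ sys.J := hJ (Finset.mem_insert_self _ _)
    have ih := ih hl.2 hlJ
    rw [List.map_cons, torusProd_cons]
    unfold torusMul
    -- A non-zero term comes from a decomposition of `v`, so it determines the multiplicities.
    have hterm : ∀ a ∈ Finset.Iic v, evalAt (F d) d a
        * Q.torusProd r (l.map fun d => evalAt (F d) d) (v - a) ≠ 0 →
        v = ∑ d' ∈ insert d l.toFinset, StableSystem.mult Q v d' • d' ∧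
          a = StableSystem.mult Q v d • d ∧
          v - a = ∑ d' ∈ l.toFinset, StableSystem.mult Q v d' • d' := by
      intro a ha hne
      obtain ⟨n, hn⟩ := exists_of_evalAt_ne_zero (left_ne_zero_of_mul hne)
      have h2 := right_ne_zero_of_mul hne
      rw [ih] at h2
      have h3 : v - a = ∑ d' ∈ l.toFinset, StableSystem.mult Q (v - a) d' • d' := by
        by_contra hc
        exact h2 (if_neg hc)
      set m' : DimVec Q₀ → ℕ := fun d' => if d' = d then n else StableSystem.mult Q (v - a) d'
        with hm'
      have hm'l : ∀ d' ∈ l.toFinset, m' d' = StableSystem.mult Q (v - a) d' := by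
        intro d' hd'
        exact if_neg (ne_of_mem_of_not_mem hd' hdl)
      have h4 : v = ∑ d' ∈ insert d l.toFinset, m' d' • d' := by
        rw [Finset.sum_insert hdl, Finset.sum_congr rfl fun d' hd' => by rw [hm'l d' hd'], ← h3]
        simp only [hm', if_true, ← hn]
        funext i
        exact (Nat.add_sub_cancel' (Finset.mem_Iic.mp ha i)).symm
      have h5 : ∀ d' ∈ insert d l.toFinset, StableSystem.mult Q v d' = m' d' := by
        intro d' hd'
        conv_lhs => rw [h4]
        exact sys.mult_sum_subset hJ m' hd'
      refine ⟨?_, ?_, ?_⟩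
      · conv_lhs => rw [h4]
        exact Finset.sum_congr rfl fun d' hd' => by rw [h5 d' hd']
      · rw [h5 d (Finset.mem_insert_self _ _), hn]
        simp [hm']
      · rw [h3]
        exact Finset.sum_congr rfl fun d' hd' => by
          rw [h5 d' (Finset.mem_insert_of_mem hd'), hm'l d' hd']
    by_cases hv : v = ∑ d' ∈ insert d l.toFinset, StableSystem.mult Q v d' • d'
    · rw [if_pos hv]
      have hv' := hv
      rw [Finset.sum_insert hdl] at hv'
      have hsub : v - StableSystem.mult Q v d • d
          = ∑ d' ∈ l.toFinset, StableSystem.mult Q v d' • d' := by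
        conv_lhs => rw [hv']
        rw [← hv']
        funext i
        have := congrFun hv' i
        simp only [Pi.add_apply] at this
        simp only [Pi.sub_apply]
        omega
      rw [Finset.sum_eq_single (StableSystem.mult Q v d • d)]
      · rw [hsub, ih, evalAt_nsmul _ (sys.ne_zero hdJ), if_pos, Finset.prod_insert hdl]
        · have hsk : Q.skew (StableSystem.mult Q v d • d)
              (∑ d' ∈ l.toFinset, StableSystem.mult Q v d' • d') = 0 := by
            have := sys.skew_sum (L := {d}) (Finset.singleton_subset_iff.mpr hdJ) hlJ
              (StableSystem.mult Q v) (StableSystem.mult Q v)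
            rwa [Finset.sum_singleton] at this
          rw [hsk, zpow_zero, mul_one]
          congr 1
          exact Finset.prod_congr rfl fun d' hd' => by rw [sys.mult_sum_subset hlJ _ hd']
        · exact Finset.sum_congr rfl fun d' hd' => by rw [sys.mult_sum_subset hlJ _ hd']
      · intro a ha hne
        by_contra hc
        exact hne (hterm a ha (left_ne_zero_of_mul hc)).2.1
      · intro h
        refine absurd (Finset.mem_Iic.mpr ?_) h
        conv_rhs => rw [hv']
        intro i
        exact Nat.le_add_right _ _
    · rw [if_neg hv]
      refine Finset.sum_eq_zero fun a ha => ?_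
      by_contra hc
      exact hv (hterm a ha (left_ne_zero_of_mul hc)).1

/-- The indicator function of the dimension vectors of stable representations. -/
noncomputable def stableInvariant (Q : InvolutiveQuiver Q₀ Q₁) (k : Type*) [Field k] (θ : Q₀ → ℤ)
    (d : DimVec Q₀) : ℤ :=
  open Classical in if ∃ M : Q.Rep k d, Q.IsStable θ (slope θ d) M then 1 else 0

omit [DecidableEq Q₀] [Fintype Q₁] in
theorem stableInvariant_eq_one_iff {d : DimVec Q₀} :
    Q.stableInvariant k θ d = 1 ↔ Q.stableInvariant k θ d ≠ 0 := by
  unfold stableInvariant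
  split_ifs <;> simp

omit [DecidableEq Q₀] in
theorem StableSystem.mem_J_iff {d : DimVec Q₀} :
    d ∈ sys.J ↔ Q.stableInvariant k θ d ≠ 0 ∧ slope θ d = μ := by
  rw [sys.mem_iff]
  unfold stableInvariant
  constructor
  · rintro ⟨M, hM⟩
    have := hM.slope_eq hM.ne_zero
    refine ⟨?_, this⟩
    rw [if_pos ⟨M, by rwa [this]⟩]
    exact one_ne_zero
  · rintro ⟨h1, rfl⟩
    by_contra h
    exact h1 (if_neg h)

/-- The ordinary factorization: the class of semistable representations with multiplicities `n_d`
has automorphism group `∏ GL_{n_d}`, whose order is the denominator of a coefficient of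
`∏ 𝔼_q(x_d)`. -/
theorem isDTInvariant_stableInvariant [Finite k] (hQ : Q.IsFiniteType)
    (hθ : Q.IsSigmaGeneric k θ) : Q.IsDTInvariant k θ (Q.stableInvariant k θ) := by
  refine ⟨?_, ?_, ?_⟩
  · unfold stableInvariant
    rw [if_neg]
    rintro ⟨M, hM⟩
    exact hM.ne_zero rfl
  · refine hQ.finite_roots.subset fun d hd => ?_
    obtain ⟨sys⟩ := exists_stableSystem hQ hθ (slope θ d)
    have hd' : d ∈ sys.J := sys.mem_J_iff.mpr ⟨hd, rfl⟩
    exact (sys.euler_eq d hd' d hd').trans (if_pos rfl)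
  · intro μ l hl hmem
    obtain ⟨sys⟩ := exists_stableSystem hQ hθ μ
    have hlJ : l.toFinset = sys.J := by
      ext d
      rw [List.mem_toFinset, hmem, sys.mem_J_iff]
    funext v
    rw [sys.slopeSeries_eq, sys.torusProd_eq _ _ l hl hlJ.subset, hlJ]
    congr 1
    refine Finset.prod_congr rfl fun d hd => ?_
    rw [stableInvariant_eq_one_iff.mpr (sys.mem_J_iff.mp hd).1]
    simp [seriesZPow]

end Torus

end InvolutiveQuiver

/-! ### Counting symmetric and alternating matrices -/

section Counting

open Matrix

variable {k : Type*} [Field k]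

/-- The number of invertible `ε`-symmetric matrices, `ε = ± 1`. -/
noncomputable def numForms (ε : k) (m : Type*) [Fintype m] [DecidableEq m] : ℕ :=
  Nat.card {b : Matrix m m k // bᵀ = ε • b ∧ IsUnit b.det}

theorem numForms_congr (ε : k) {m m' : Type*} [Fintype m] [DecidableEq m] [Fintype m']
    [DecidableEq m'] (E : m ≃ m') : numForms ε m = numForms ε m' := by
  refine Nat.card_congr ((Matrix.reindex E E).subtypeEquiv fun b => ?_)
  rw [Matrix.det_reindex_self, Matrix.transpose_reindex]
  refine and_congr_left' ?_
  rw [← (Matrix.reindex E E).injective.eq_iff]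
  rfl

variable {m : Type*} [Fintype m] [DecidableEq m] {ε : k}

/-- The `ε`-symmetric matrix with corner `a`, first column `w` and complementary block `D`. -/
def bordered (ε a : k) (w : m → k) (D : Matrix m m k) : Matrix (Unit ⊕ m) (Unit ⊕ m) k :=
  fromBlocks (of fun _ _ => a) (replicateRow Unit (ε • w)) (replicateCol Unit w) D

omit [Fintype m] [DecidableEq m] in
theorem bordered_transpose_iff (hε : ε * ε = 1) (a : k) (w : m → k) (D : Matrix m m k) :
    (bordered ε a w D)ᵀ = ε • bordered ε a w D ↔ a = ε * a ∧ Dᵀ = ε • D := by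
  rw [bordered, fromBlocks_transpose, fromBlocks_smul, fromBlocks_inj]
  constructor
  · rintro ⟨h1, -, -, h4⟩
    exact ⟨congrFun (congrFun h1 ()) (), h4⟩
  · rintro ⟨h1, h4⟩
    refine ⟨?_, ?_, ?_, h4⟩
    · ext i j
      exact h1
    · ext i j
      simp [← mul_assoc, hε]
    · ext i j
      simp

theorem card_bordered [Finite k] (hε : ε * ε = 1)
    (P : Matrix (Unit ⊕ m) (Unit ⊕ m) k → Prop) [Fintype {a : k // a = ε * a}] [Fintype k] :
    Nat.card {b : Matrix (Unit ⊕ m) (Unit ⊕ m) k // bᵀ = ε • b ∧ P b}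
      = ∑ a : {a : k // a = ε * a}, ∑ w : m → k,
        Nat.card {D : Matrix m m k // Dᵀ = ε • D ∧ P (bordered ε a.1 w D)} := by
  rw [← Fintype.sum_prod_type', ← Nat.card_sigma]
  refine (Nat.card_eq_of_bijective (fun x : (Σ x : {a : k // a = ε * a} × (m → k),
    {D : Matrix m m k // Dᵀ = ε • D ∧ P (bordered ε x.1.1 x.2 D)}) =>
    (⟨bordered ε x.1.1.1 x.1.2 x.2.1,
      (bordered_transpose_iff hε _ _ _).mpr ⟨x.1.1.2, x.2.2.1⟩, x.2.2.2⟩ :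
      {b : Matrix (Unit ⊕ m) (Unit ⊕ m) k // bᵀ = ε • b ∧ P b})) ⟨?_, ?_⟩).symm
  · rintro ⟨⟨⟨a, ha⟩, w⟩, D, hD⟩ ⟨⟨⟨a', ha'⟩, w'⟩, D', hD'⟩ h
    have h1 := congrArg Subtype.val h
    simp only [bordered, fromBlocks_inj] at h1
    obtain ⟨h1, -, h3, h4⟩ := h1
    obtain rfl : a = a' := congrFun (congrFun h1 ()) ()
    obtain rfl : w = w' := funext fun i => congrFun (congrFun h3 i) ()
    obtain rfl : D = D' := h4
    rfl
  · rintro ⟨b, hb, hP⟩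
    have hb' : b = bordered ε (b (Sum.inl ()) (Sum.inl ())) (fun i => b (Sum.inr i) (Sum.inl ()))
        (of fun i j => b (Sum.inr i) (Sum.inr j)) := by
      ext (i | i) (j | j)
      · rfl
      · have := congrFun (congrFun hb (Sum.inr j)) (Sum.inl ())
        simp only [transpose_apply, Matrix.smul_apply] at this
        exact this
      · rfl
      · rfl
    have h2 := hb
    rw [hb', bordered_transpose_iff hε] at h2
    refine ⟨⟨(⟨_, h2.1⟩, _), ⟨_, h2.2, ?_⟩⟩, Subtype.ext hb'.symm⟩
    rw [← hb']
    exact hP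

theorem isUnit_det_bordered {a : k} (ha : a ≠ 0) (w : m → k) (D : Matrix m m k) :
    IsUnit (bordered ε a w D).det ↔
      IsUnit (D - (a⁻¹ * ε) • vecMulVec w w).det := by
  let A : Matrix Unit Unit k := of fun _ _ => a
  let B : Matrix Unit Unit k := of fun _ _ => a⁻¹
  have hAB : A * B = 1 := by
    ext i j
    simp [A, B, mul_apply, ha]
  have hBA : B * A = 1 := by
    ext i j
    simp [A, B, mul_apply, ha]
  let _ : Invertible A := ⟨B, hBA, hAB⟩
  have h1 : bordered ε a w D = fromBlocks A (replicateRow Unit (ε • w)) (replicateCol Unit w) D :=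
    rfl
  rw [h1, det_fromBlocks₁₁]
  have h2 : A.det = a := by simp [A]
  have h3 : replicateCol Unit w * ⅟A * replicateRow Unit (ε • w) = (a⁻¹ * ε) • vecMulVec w w := by
    show replicateCol Unit w * B * replicateRow Unit (ε • w) = _
    ext i j
    simp [mul_apply, B, vecMulVec_apply]
    ring
  rw [h2, h3, IsUnit.mul_iff, and_iff_right ha.isUnit]

/-- A non-zero corner can be split off. -/
theorem card_bordered_corner (hε : ε * ε = 1) {a : k} (ha : a ≠ 0) (ha' : a = ε * a) (w : m → k) :
    Nat.card {D : Matrix m m k // Dᵀ = ε • D ∧ IsUnit (bordered ε a w D).det}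
      = numForms ε m := by
  have hε1 : ε = 1 := by
    have : (1 - ε) * a = 0 := by linear_combination ha'
    rcases mul_eq_zero.mp this with h | h
    · linear_combination -h
    · exact absurd h ha
  subst hε1
  have hw : (vecMulVec w w)ᵀ = vecMulVec w w := by
    ext i j
    simp [vecMulVec_apply, mul_comm]
  refine Nat.card_congr ((Equiv.subRight ((a⁻¹ * 1) • vecMulVec w w)).subtypeEquiv fun D => ?_)
  rw [isUnit_det_bordered ha, Equiv.subRight_apply]
  refine and_congr_left' ?_
  rw [transpose_sub, transpose_smul, hw, one_smul, one_smul, sub_left_inj]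

omit [DecidableEq m] in
theorem bordered_congr (g : Matrix m m k) (w : m → k) (D : Matrix m m k) :
    fromBlocks (1 : Matrix Unit Unit k) 0 0 g * bordered ε 0 w D
      * (fromBlocks (1 : Matrix Unit Unit k) 0 0 g)ᵀ = bordered ε 0 (g *ᵥ w) (g * D * gᵀ) := by
  rw [bordered, bordered, fromBlocks_transpose, fromBlocks_multiply, fromBlocks_multiply,
    fromBlocks_inj]
  refine ⟨?_, ?_, ?_, ?_⟩
  · ext i j
    simp
  · ext i j
    simp [mul_apply, mulVec, dotProduct, Finset.mul_sum]
    exact Finset.sum_congr rfl fun _ _ => by ring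
  · ext i j
    simp [mul_apply, mulVec, dotProduct]
  · simp

/-- For a vanishing corner, the count depends only on the orbit of the first column. -/
theorem card_bordered_mulVec (g : GL m k) (w : m → k) :
    Nat.card {D : Matrix m m k // Dᵀ = ε • D ∧ IsUnit (bordered ε 0 w D).det}
      = Nat.card {D : Matrix m m k // Dᵀ = ε • D ∧ IsUnit (bordered ε 0 (g.1 *ᵥ w) D).det} := by
  have hg1 : g.1 * g⁻¹.1 = 1 := g.mul_inv
  have hg2 : g⁻¹.1 * g.1 = 1 := g.inv_mul
  have hg3 : g.1ᵀ * g⁻¹.1ᵀ = 1 := by rw [← transpose_mul, hg2, transpose_one]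
  have hg4 : g⁻¹.1ᵀ * g.1ᵀ = 1 := by rw [← transpose_mul, hg1, transpose_one]
  let E : Matrix m m k ≃ Matrix m m k :=
    { toFun := fun D => g.1 * D * g.1ᵀ
      invFun := fun D => g⁻¹.1 * D * g⁻¹.1ᵀ
      left_inv := fun D => by
        calc g⁻¹.1 * (g.1 * D * g.1ᵀ) * g⁻¹.1ᵀ
            = (g⁻¹.1 * g.1) * D * (g.1ᵀ * g⁻¹.1ᵀ) := by simp only [Matrix.mul_assoc]
          _ = D := by rw [hg2, hg3, Matrix.one_mul, Matrix.mul_one]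
      right_inv := fun D => by
        calc g.1 * (g⁻¹.1 * D * g⁻¹.1ᵀ) * g.1ᵀ
            = (g.1 * g⁻¹.1) * D * (g⁻¹.1ᵀ * g.1ᵀ) := by simp only [Matrix.mul_assoc]
          _ = D := by rw [hg1, hg4, Matrix.one_mul, Matrix.mul_one] }
  refine Nat.card_congr (E.subtypeEquiv fun D => ?_)
  refine and_congr ?_ ?_
  · rw [← E.injective.eq_iff]
    show g.1 * Dᵀ * g.1ᵀ = g.1 * (ε • D) * g.1ᵀ ↔ (g.1 * D * g.1ᵀ)ᵀ = ε • (g.1 * D * g.1ᵀ)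
    rw [transpose_mul, transpose_mul, transpose_transpose, Matrix.mul_smul, Matrix.smul_mul,
      Matrix.mul_assoc]
  · show _ ↔ IsUnit (bordered ε 0 (g.1 *ᵥ w) (g.1 * D * g.1ᵀ)).det
    have hgd : IsUnit g.1.det := (isUnit_iff_isUnit_det _).mp g.isUnit
    rw [← bordered_congr, det_mul, det_mul, det_transpose, det_fromBlocks_zero₂₁, det_one, one_mul,
      IsUnit.mul_iff, IsUnit.mul_iff]
    tauto

/-- When the first column is a basis vector, the two outer rows and columns split off. -/
theorem isUnit_det_bordered_bordered (hε : ε * ε = 1) (c : k) (u : m → k) (D : Matrix m m k) :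
    IsUnit (bordered ε 0 (Sum.elim (fun _ : Unit => 1) 0) (bordered ε c u D)).det
      ↔ IsUnit D.det := by
  have hε0 : ε ≠ 0 := left_ne_zero_of_mul_eq_one hε
  have key : ∀ (x₀ x₁ : k) (y : m → k),
      bordered ε 0 (Sum.elim (fun _ : Unit => 1) 0) (bordered ε c u D) *ᵥ
        Sum.elim (fun _ : Unit => x₀) (Sum.elim (fun _ : Unit => x₁) y)
      = Sum.elim (fun _ : Unit => ε * x₁) (Sum.elim (fun _ : Unit => x₀ + c * x₁ + ε * (u ⬝ᵥ y))
          (x₁ • u + D *ᵥ y)) := by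
    intro x₀ x₁ y
    rw [bordered, bordered, fromBlocks_mulVec]
    funext i
    rcases i with i | i | i
    · simp [mulVec, dotProduct]
    · simp [mulVec, dotProduct, Finset.mul_sum, mul_assoc, add_assoc]
    · simp [mulVec, dotProduct, mul_comm]
  rw [isUnit_iff_ne_zero, isUnit_iff_ne_zero, not_iff_not, ← exists_mulVec_eq_zero_iff,
    ← exists_mulVec_eq_zero_iff]
  constructor
  · rintro ⟨v, hv, h⟩
    obtain ⟨x₀, x₁, y, rfl⟩ : ∃ (x₀ x₁ : k) (y : m → k),
        v = Sum.elim (fun _ : Unit => x₀) (Sum.elim (fun _ : Unit => x₁) y) :=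
      ⟨v (Sum.inl ()), v (Sum.inr (Sum.inl ())), fun i => v (Sum.inr (Sum.inr i)), by
        funext i
        rcases i with i | i | i <;> rfl⟩
    rw [key] at h
    have h0 : ε * x₁ = 0 := congrFun h (Sum.inl ())
    have h1 : x₀ + c * x₁ + ε * (u ⬝ᵥ y) = 0 := congrFun h (Sum.inr (Sum.inl ()))
    have h2 : x₁ • u + D *ᵥ y = 0 := funext fun i => congrFun h (Sum.inr (Sum.inr i))
    obtain rfl : x₁ = 0 := (mul_eq_zero.mp h0).resolve_left hε0
    rw [zero_smul, zero_add] at h2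
    refine ⟨y, ?_, h2⟩
    rintro rfl
    apply hv
    rw [dotProduct_zero, mul_zero, mul_zero, add_zero, add_zero] at h1
    funext i
    rcases i with i | i | i <;> simp [h1]
  · rintro ⟨y, hy, h⟩
    refine ⟨Sum.elim (fun _ : Unit => -(ε * (u ⬝ᵥ y))) (Sum.elim (fun _ : Unit => 0) y), ?_, ?_⟩
    · intro h0
      exact hy (funext fun i => congrFun h0 (Sum.inr (Sum.inr i)))
    · rw [key, h]
      funext i
      rcases i with i | i | i <;> simp

theorem exists_GL_mulVec {v w : m → k} (hv : v ≠ 0) (hw : w ≠ 0) :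
    ∃ g : GL m k, g.1 *ᵥ v = w := by
  obtain ⟨f, hf⟩ := Submodule.exists_linearEquiv_restrict_eq
    ((LinearEquiv.toSpanNonzeroSingleton k (m → k) v hv).symm.trans
      (LinearEquiv.toSpanNonzeroSingleton k (m → k) w hw))
  refine ⟨⟨LinearMap.toMatrix' f.toLinearMap, LinearMap.toMatrix' f.symm.toLinearMap, ?_, ?_⟩, ?_⟩
  · rw [← LinearMap.toMatrix'_comp, LinearEquiv.comp_symm, LinearMap.toMatrix'_id]
  · rw [← LinearMap.toMatrix'_comp, LinearEquiv.symm_comp, LinearMap.toMatrix'_id]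
  · show LinearMap.toMatrix' f.toLinearMap *ᵥ v = w
    rw [LinearMap.toMatrix'_mulVec]
    have h1 := hf (LinearEquiv.toSpanNonzeroSingleton k (m → k) v hv 1)
    rw [LinearEquiv.trans_apply, LinearEquiv.symm_apply_apply,
      LinearEquiv.toSpanNonzeroSingleton_one, LinearEquiv.toSpanNonzeroSingleton_one] at h1
    exact h1.symm

theorem det_bordered_zero (D : Matrix m m k) : (bordered ε 0 (0 : m → k) D).det = 0 :=
  det_eq_zero_of_column_eq_zero (Sum.inl ()) fun i => by
    rcases i with i | i <;> rfl

variable [Finite k]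

/-- The recursion for the number of invertible `ε`-symmetric matrices, by splitting off a
non-isotropic basis vector or a hyperbolic plane. -/
theorem numForms_add_two (hε : ε * ε = 1) (n : ℕ) :
    numForms ε (Fin (n + 2)) =
      (Nat.card k ^ (n + 1) - 1) * (Nat.card {a : k // a = ε * a} * (Nat.card k ^ n
        * numForms ε (Fin n)))
      + (Nat.card {a : k // a = ε * a} - 1)
        * (Nat.card k ^ (n + 1) * numForms ε (Fin (n + 1))) := by
  classical
  have := Fintype.ofFinite k
  let E1 : Unit ⊕ Fin n ≃ Fin (n + 1) := (Equiv.sumComm _ _).trans (Fintype.equivFinOfCardEq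
    (by simp))
  let E2 : Unit ⊕ (Unit ⊕ Fin n) ≃ Fin (n + 2) := Fintype.equivFinOfCardEq (by simp; omega)
  rw [← numForms_congr ε E2, ← numForms_congr ε E1, numForms, card_bordered hε]
  have hsplit : ∀ a : {a : k // a = ε * a}, a ≠ ⟨0, (mul_zero ε).symm⟩ →
      ∑ w : Unit ⊕ Fin n → k, Nat.card {D : Matrix (Unit ⊕ Fin n) (Unit ⊕ Fin n) k //
        Dᵀ = ε • D ∧ IsUnit (bordered ε a.1 w D).det}
      = Nat.card k ^ (n + 1) * numForms ε (Unit ⊕ Fin n) := by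
    intro a ha
    have ha0 : a.1 ≠ 0 := fun h => ha (Subtype.ext h)
    rw [Finset.sum_congr rfl fun w _ => card_bordered_corner hε ha0 a.2 w, Finset.sum_const,
      Finset.card_univ, smul_eq_mul, Fintype.card_fun, Nat.card_eq_fintype_card]
    simp [add_comm]
  rw [← Finset.add_sum_erase _ _ (Finset.mem_univ (⟨0, (mul_zero ε).symm⟩ : {a : k // a = ε * a})),
    Finset.sum_congr rfl fun a ha => hsplit a (Finset.ne_of_mem_erase ha), Finset.sum_const,
    Finset.card_erase_of_mem (Finset.mem_univ _), Finset.card_univ, smul_eq_mul,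
    ← Nat.card_eq_fintype_card]
  congr 1
  -- It remains to treat the vanishing corner.
  have hone : (Sum.elim (fun _ : Unit => 1) 0 : Unit ⊕ Fin n → k) ≠ 0 := fun h =>
    one_ne_zero (congrFun h (Sum.inl ()))
  have hzero : ∀ w : Unit ⊕ Fin n → k, w ≠ 0 →
      Nat.card {D : Matrix (Unit ⊕ Fin n) (Unit ⊕ Fin n) k //
        Dᵀ = ε • D ∧ IsUnit (bordered ε 0 w D).det}
      = Nat.card {a : k // a = ε * a} * (Nat.card k ^ n * numForms ε (Fin n)) := by
    intro w hw
    obtain ⟨g, rfl⟩ := exists_GL_mulVec hone hw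
    rw [← card_bordered_mulVec, card_bordered hε]
    simp only [isUnit_det_bordered_bordered hε, Finset.sum_const, smul_eq_mul, Finset.card_univ,
      Fintype.card_fun, Fintype.card_fin, Nat.card_eq_fintype_card (α := k),
      ← Nat.card_eq_fintype_card (α := {a : k // a = ε * a})]
    rfl
  rw [← Finset.add_sum_erase _ _ (Finset.mem_univ (0 : Unit ⊕ Fin n → k)),
    Finset.sum_congr rfl fun w hw => hzero w (Finset.ne_of_mem_erase hw), Finset.sum_const,
    Finset.card_erase_of_mem (Finset.mem_univ _), Finset.card_univ, smul_eq_mul]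
  have hz : Nat.card {D : Matrix (Unit ⊕ Fin n) (Unit ⊕ Fin n) k //
        Dᵀ = ε • D ∧ IsUnit (bordered ε 0 (0 : Unit ⊕ Fin n → k) D).det} = 0 := by
    rw [Nat.card_eq_zero]
    left
    refine ⟨fun D => ?_⟩
    have := D.2.2
    rw [det_bordered_zero] at this
    exact not_isUnit_zero this
  rw [hz, zero_add]
  simp [add_comm]

omit [Finite k] in
theorem numForms_zero (ε : k) : numForms ε (Fin 0) = 1 := by
  unfold numForms
  rw [Nat.card_eq_one_iff_unique]
  refine ⟨⟨fun a b => Subtype.ext (Subsingleton.elim _ _)⟩, ⟨⟨0, Subsingleton.elim _ _, ?_⟩⟩⟩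
  simp

theorem numForms_one (ε : k) :
    numForms ε (Fin 1) = Nat.card {a : k // a = ε * a} - 1 := by
  classical
  have := Fintype.ofFinite k
  have h1 : numForms ε (Fin 1)
      = Nat.card {a : {a : k // a = ε * a} // a ≠ ⟨0, (mul_zero ε).symm⟩} := by
    refine Nat.card_congr
      { toFun := fun b => ⟨⟨b.1 0 0, congrFun (congrFun b.2.1 0) 0⟩, fun h => ?_⟩
        invFun := fun a => ⟨of fun _ _ => a.1.1, ?_, ?_⟩
        left_inv := fun b => ?_
        right_inv := fun a => ?_ }
    · have h0 : b.1 0 0 = 0 := congrArg Subtype.val h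
      have := b.2.2
      rw [det_fin_one, h0] at this
      exact not_isUnit_zero this
    · ext i j
      exact a.1.2
    · rw [det_fin_one, isUnit_iff_ne_zero]
      exact fun h => a.2 (Subtype.ext h)
    · apply Subtype.ext
      ext i j
      rw [Subsingleton.elim i 0, Subsingleton.elim j 0]
      rfl
    · rfl
  rw [h1, Nat.card_eq_fintype_card, Nat.card_eq_fintype_card]
  simp [Fintype.card_subtype_compl]

omit [Finite k] in
theorem card_eq_one_mul : Nat.card {a : k // a = 1 * a} = Nat.card k := by
  refine Nat.card_congr (Equiv.subtypeUnivEquiv fun a => (one_mul a).symm)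

omit [Finite k] in
theorem card_eq_neg_mul (h2 : (2 : k) ≠ 0) : Nat.card {a : k // a = -1 * a} = 1 := by
  rw [Nat.card_eq_one_iff_unique]
  refine ⟨⟨fun a b => Subtype.ext ?_⟩, ⟨⟨0, by simp⟩⟩⟩
  have h : ∀ a : {a : k // a = -1 * a}, a.1 = 0 := by
    intro a
    have : 2 * a.1 = 0 := by linear_combination a.2
    exact (mul_eq_zero.mp this).resolve_left h2
  rw [h a, h b]

theorem card_GL_succ (n : ℕ) :
    (Nat.card (GL (Fin (n + 1)) k) : ℝ)
      = ((Nat.card k : ℝ) ^ (n + 1) - 1) * (Nat.card k : ℝ) ^ n * Nat.card (GL (Fin n) k) := by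
  rw [InvolutiveQuiver.card_GL_eq, InvolutiveQuiver.card_GL_eq, Finset.prod_range_succ']
  have : ∀ j ∈ Finset.range n, (Nat.card k : ℝ) ^ (n + 1) - (Nat.card k : ℝ) ^ (j + 1)
      = Nat.card k * ((Nat.card k : ℝ) ^ n - (Nat.card k : ℝ) ^ j) := fun j _ => by ring
  rw [Finset.prod_congr rfl this, Finset.prod_mul_distrib, Finset.prod_const, Finset.card_range]
  ring

theorem card_GL_pos (n : ℕ) : (0 : ℝ) < Nat.card (GL (Fin n) k) := by
  have : Finite (GL (Fin n) k) := inferInstance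
  exact_mod_cast Nat.card_pos

/-- The denominators of the dilogarithm `𝔼_{q²}`. -/
noncomputable def dilogDenom (q : ℝ) (m : ℕ) : ℝ :=
  ∏ j ∈ Finset.range m, (q ^ (2 * m) - q ^ (2 * j))

theorem dilogDenom_succ (q : ℝ) (m : ℕ) :
    dilogDenom q (m + 1) = (q ^ (2 * m + 2) - 1) * q ^ (2 * m) * dilogDenom q m := by
  unfold dilogDenom
  rw [Finset.prod_range_succ']
  have : ∀ j ∈ Finset.range m, q ^ (2 * (m + 1)) - q ^ (2 * (j + 1))
      = q ^ 2 * (q ^ (2 * m) - q ^ (2 * j)) := fun j _ => by ring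
  rw [Finset.prod_congr rfl this, Finset.prod_mul_distrib, Finset.prod_const, Finset.card_range]
  ring

theorem dilogDenom_ne_zero {q : ℝ} (hq : 1 < q) (m : ℕ) : dilogDenom q m ≠ 0 := by
  unfold dilogDenom
  refine Finset.prod_ne_zero_iff.mpr fun j hj => ?_
  have := pow_lt_pow_right₀ hq (show 2 * j < 2 * m by have := Finset.mem_range.mp hj; omega)
  linarith

/-- The mass of the `ε`-symmetric forms of rank `n`: the sum of the inverse orders of their
isometry groups. -/
noncomputable def formMass (ε : k) (n : ℕ) : ℝ :=
  numForms ε (Fin n) / Nat.card (GL (Fin n) k)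

theorem formMass_zero (ε : k) : formMass ε 0 = 1 := by
  rw [formMass, numForms_zero, InvolutiveQuiver.card_GL_eq]
  simp

theorem formMass_one (ε : k) :
    formMass ε 1 = ((Nat.card {a : k // a = ε * a} - 1 : ℕ) : ℝ) / ((Nat.card k : ℝ) - 1) := by
  rw [formMass, numForms_one, InvolutiveQuiver.card_GL_eq]
  simp

/-- The recursion `numForms_add_two`, divided by the orders of the general linear groups. -/
theorem formMass_add_two (hε : ε * ε = 1) (n : ℕ) :
    ((Nat.card k : ℝ) ^ (n + 2) - 1) * (Nat.card k : ℝ) ^ (n + 1) * formMass ε (n + 2) =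
      Nat.card {a : k // a = ε * a} * formMass ε n
      + ((Nat.card {a : k // a = ε * a} - 1 : ℕ) : ℝ) * (Nat.card k : ℝ) ^ (n + 1)
        * formMass ε (n + 1) := by
  have hq : (1 : ℝ) < Nat.card k := by exact_mod_cast Finite.one_lt_card
  have hq' : ∀ n : ℕ, (Nat.card k : ℝ) ^ (n + 1) - 1 ≠ 0 := fun n => by
    have : (1 : ℝ) < (Nat.card k : ℝ) ^ (n + 1) := one_lt_pow₀ hq n.succ_ne_zero
    exact (by linarith : (0 : ℝ) < (Nat.card k : ℝ) ^ (n + 1) - 1).ne'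
  have h1 : ((Nat.card k ^ (n + 1) - 1 : ℕ) : ℝ) = (Nat.card k : ℝ) ^ (n + 1) - 1 := by
    rw [Nat.cast_sub (Nat.one_le_pow _ _ Nat.card_pos)]
    push_cast
    rfl
  have hG := (card_GL_pos (k := k) n).ne'
  unfold formMass
  rw [numForms_add_two hε, card_GL_succ (n + 1), card_GL_succ n]
  push_cast [h1]
  have hq0 : (Nat.card k : ℝ) ≠ 0 := by linarith
  have h3 := hq' n
  have h4 := hq' (n + 1)
  rw [show n + 1 + 1 = n + 2 from rfl] at h4 ⊢
  generalize Nat.card {a : k // a = ε * a} = A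
  field_simp

/-- The masses of the symmetric forms. -/
theorem formMass_symm (m : ℕ) :
    formMass (1 : k) (2 * m) = (Nat.card k : ℝ) ^ m / dilogDenom (Nat.card k) m ∧
      formMass (1 : k) (2 * m + 1) = 1 / ((Nat.card k : ℝ) ^ m * dilogDenom (Nat.card k) m) := by
  have hq : (1 : ℝ) < Nat.card k := by exact_mod_cast Finite.one_lt_card
  have hq0 : (Nat.card k : ℝ) ≠ 0 := by linarith
  have hq' : ∀ n : ℕ, (Nat.card k : ℝ) ^ (n + 1) - 1 ≠ 0 := fun n => by
    have : (1 : ℝ) < (Nat.card k : ℝ) ^ (n + 1) := one_lt_pow₀ hq n.succ_ne_zero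
    exact (by linarith : (0 : ℝ) < (Nat.card k : ℝ) ^ (n + 1) - 1).ne'
  have h1 : ((Nat.card k - 1 : ℕ) : ℝ) = (Nat.card k : ℝ) - 1 := by
    rw [Nat.cast_sub (Nat.card_pos), Nat.cast_one]
  have hrec := fun n => formMass_add_two (k := k) (ε := 1) (one_mul 1) n
  rw [card_eq_one_mul] at hrec
  simp only [h1] at hrec
  induction m with
  | zero =>
    refine ⟨?_, ?_⟩
    · rw [mul_zero, formMass_zero]
      simp [dilogDenom]
    · rw [mul_zero, zero_add, formMass_one, card_eq_one_mul, h1]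
      have := hq' 0
      simp only [zero_add, pow_one] at this
      rw [div_self this]
      simp [dilogDenom]
  | succ m ih =>
    obtain ⟨ih1, ih2⟩ := ih
    have hP := dilogDenom_ne_zero hq m
    have r1 := hrec (2 * m)
    have r2 := hrec (2 * m + 1)
    rw [ih1, ih2] at r1
    have e1 : formMass (1 : k) (2 * (m + 1))
        = (Nat.card k : ℝ) ^ (m + 1) / dilogDenom (Nat.card k) (m + 1) := by
      rw [dilogDenom_succ, show 2 * (m + 1) = 2 * m + 2 by ring]
      have h3 := hq' (2 * m + 1)
      rw [show 2 * m + 1 + 1 = 2 * m + 2 by ring] at h3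
      refine mul_left_cancel₀ (mul_ne_zero h3 (pow_ne_zero (2 * m + 1) hq0)) (r1.trans ?_)
      field_simp
      ring
    refine ⟨e1, ?_⟩
    rw [show 2 * m + 1 + 1 = 2 * (m + 1) by ring, e1, ih2, dilogDenom_succ] at r2
    rw [dilogDenom_succ, show 2 * (m + 1) + 1 = 2 * m + 1 + 2 by ring]
    have h3 := hq' (2 * m + 1)
    have h4 := hq' (2 * m + 2)
    rw [show 2 * m + 1 + 1 = 2 * m + 2 by ring] at h3
    rw [show 2 * m + 1 + 2 = 2 * m + 2 + 1 by ring] at r2 ⊢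
    refine mul_left_cancel₀ (mul_ne_zero h4 (pow_ne_zero (2 * (m + 1)) hq0)) (r2.trans ?_)
    field_simp
    ring

/-- The masses of the alternating forms; there are none of odd rank. -/
theorem formMass_alt (h2 : (2 : k) ≠ 0) (m : ℕ) :
    formMass (-1 : k) (2 * m) = 1 / ((Nat.card k : ℝ) ^ m * dilogDenom (Nat.card k) m) ∧
      formMass (-1 : k) (2 * m + 1) = 0 := by
  have hq : (1 : ℝ) < Nat.card k := by exact_mod_cast Finite.one_lt_card
  have hq0 : (Nat.card k : ℝ) ≠ 0 := by linarith
  have hq' : ∀ n : ℕ, (Nat.card k : ℝ) ^ (n + 1) - 1 ≠ 0 := fun n => by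
    have : (1 : ℝ) < (Nat.card k : ℝ) ^ (n + 1) := one_lt_pow₀ hq n.succ_ne_zero
    exact (by linarith : (0 : ℝ) < (Nat.card k : ℝ) ^ (n + 1) - 1).ne'
  have hrec := fun n => formMass_add_two (k := k) (ε := -1) (by ring) n
  rw [card_eq_neg_mul h2] at hrec
  simp only [Nat.cast_one, one_mul, tsub_self, Nat.cast_zero, zero_mul, add_zero] at hrec
  induction m with
  | zero =>
    refine ⟨?_, ?_⟩
    · rw [mul_zero, formMass_zero]
      simp [dilogDenom]
    · rw [mul_zero, zero_add, formMass_one, card_eq_neg_mul h2]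
      simp
  | succ m ih =>
    obtain ⟨ih1, ih2⟩ := ih
    have hP := dilogDenom_ne_zero hq m
    have r1 := hrec (2 * m)
    have r2 := hrec (2 * m + 1)
    rw [ih1] at r1
    rw [ih2] at r2
    have h3 := hq' (2 * m + 1)
    rw [show 2 * m + 1 + 1 = 2 * m + 2 by ring] at h3
    refine ⟨?_, ?_⟩
    · rw [dilogDenom_succ, show 2 * (m + 1) = 2 * m + 2 by ring]
      refine mul_left_cancel₀ (mul_ne_zero h3 (pow_ne_zero (2 * m + 1) hq0)) (r1.trans ?_)
      field_simp
      ring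
    · rw [show 2 * (m + 1) + 1 = 2 * m + 1 + 2 by ring]
      have h4 := hq' (2 * m + 2)
      rw [show 2 * m + 2 + 1 = 2 * m + 1 + 2 by ring] at h4
      exact (mul_eq_zero.mp r2).resolve_left (mul_ne_zero h4 (pow_ne_zero _ hq0))

end Counting

namespace InvolutiveQuiver

/-! ### Pairings of representations -/

section Total

variable {Q₀ Q₁ : Type*} [DecidableEq Q₀] {Q : InvolutiveQuiver Q₀ Q₁} {k : Type*} [Field k]
  {d e f : DimVec Q₀}

/-- The total space `⨁ k^{d_i}` of a graded space. -/
abbrev Tot (k : Type*) (d : DimVec Q₀) := ∀ i, Fin (d i) → k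

/-- The projector of the total space onto the component of degree `i`. -/
def proj (k : Type*) [Field k] (d : DimVec Q₀) (i : Q₀) : Tot k d →ₗ[k] Tot k d :=
  LinearMap.single k _ i ∘ₗ LinearMap.proj i

/-- The action of an arrow on the total space. -/
def arrow (M : Q.Rep k d) (a : Q₁) : Tot k d →ₗ[k] Tot k d :=
  LinearMap.single k _ (Q.tgt a) ∘ₗ M a ∘ₗ LinearMap.proj (Q.src a)

omit [DecidableEq Q₀] in
/-- The linear map of total spaces underlying a graded linear map. -/
def GrHom.tot (φ : GrHom k d e) : Tot k d →ₗ[k] Tot k e :=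
  LinearMap.pi fun i => φ i ∘ₗ LinearMap.proj i

theorem proj_apply (i : Q₀) (x : Tot k d) : proj k d i x = Pi.single i (x i) := rfl

theorem arrow_apply (M : Q.Rep k d) (a : Q₁) (x : Tot k d) :
    arrow M a x = Pi.single (Q.tgt a) (M a (x (Q.src a))) := rfl

omit [DecidableEq Q₀] in
theorem GrHom.tot_apply (φ : GrHom k d e) (x : Tot k d) (i : Q₀) : φ.tot x i = φ i (x i) := rfl

theorem proj_single (i : Q₀) (x : Fin (d i) → k) :
    proj k d i (Pi.single i x) = Pi.single i x := by
  rw [proj_apply, Pi.single_eq_same]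

theorem proj_single_ne {i j : Q₀} (h : i ≠ j) (x : Fin (d j) → k) :
    proj k d i (Pi.single j x) = 0 := by
  rw [proj_apply, Pi.single_eq_of_ne h, Pi.single_zero]

theorem arrow_single (M : Q.Rep k d) (a : Q₁) (x : Fin (d (Q.src a)) → k) :
    arrow M a (Pi.single (Q.src a) x) = Pi.single (Q.tgt a) (M a x) := by
  rw [arrow_apply, Pi.single_eq_same]

theorem arrow_proj (M : Q.Rep k d) (a : Q₁) (x : Tot k d) :
    arrow M a (proj k d (Q.src a) x) = arrow M a x := by
  rw [proj_apply, arrow_single, arrow_apply]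

theorem proj_arrow (M : Q.Rep k d) (a : Q₁) (x : Tot k d) :
    proj k d (Q.tgt a) (arrow M a x) = arrow M a x := proj_single _ _

theorem GrHom.tot_single (φ : GrHom k d e) (i : Q₀) (x : Fin (d i) → k) :
    φ.tot (Pi.single i x) = Pi.single i (φ i x) := by
  funext j
  rw [GrHom.tot_apply]
  by_cases h : j = i
  · subst h
    rw [Pi.single_eq_same, Pi.single_eq_same]
  · rw [Pi.single_eq_of_ne h, Pi.single_eq_of_ne h, map_zero]

theorem GrHom.tot_proj (φ : GrHom k d e) (i : Q₀) (x : Tot k d) :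
    φ.tot (proj k d i x) = proj k e i (φ.tot x) := φ.tot_single i _

theorem IsHom.tot_arrow {M : Q.Rep k d} {N : Q.Rep k e} {φ : GrHom k d e} (h : IsHom M N φ) (a : Q₁)
    (x : Tot k d) : φ.tot (arrow M a x) = arrow N a (φ.tot x) := by
  rw [arrow_apply, GrHom.tot_single, h]
  rfl

/-- A linear map of total spaces commuting with the projectors and the arrows is a homomorphism. -/
theorem exists_isHom_tot {M : Q.Rep k d} {N : Q.Rep k e} (Φ : Tot k d →ₗ[k] Tot k e)
    (h1 : ∀ i x, Φ (proj k d i x) = proj k e i (Φ x))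
    (h2 : ∀ a x, Φ (arrow M a x) = arrow N a (Φ x)) :
    ∃ φ : GrHom k d e, IsHom M N φ ∧ φ.tot = Φ := by
  have h3 : ∀ i x, Φ (Pi.single i x) = Pi.single i (Φ (Pi.single i x) i) := by
    intro i x
    conv_lhs => rw [← proj_single, h1]
    rfl
  refine ⟨fun i => LinearMap.proj i ∘ₗ Φ ∘ₗ LinearMap.single k (fun i => Fin (d i) → k) i,
    fun a x => ?_, ?_⟩
  · have h := congrFun (h2 a (Pi.single (Q.src a) x)) (Q.tgt a)
    rw [arrow_single, arrow_apply, Pi.single_eq_same] at h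
    exact h
  · refine LinearMap.ext fun x => funext fun i => ?_
    have h := congrFun (h1 i x) i
    rw [proj_apply, proj_apply, Pi.single_eq_same] at h
    exact h

variable (D : Q.DualityStructure)

/-- A pairing of two representations: a bilinear form on the total spaces for which the projector
onto degree `i` is adjoint to the projector onto degree `σ(i)`, and the arrow `a` is adjoint to
`τ_a σ(a)`.  Equivalently, a homomorphism from `M` to the dual of `N`. -/
structure IsPairing (M : Q.Rep k d) (N : Q.Rep k e) (B : Tot k d →ₗ[k] Tot k e →ₗ[k] k) :
    Prop where
  orth : ∀ i x y, B (proj k d i x) y = B x (proj k e (Q.σ₀ i) y)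
  compat : ∀ a x y, B (arrow M a x) y = ((D.τ a : ℤ) : k) * B x (arrow N (Q.σ₁ a) y)

variable {D}

theorem IsPairing.comp {d' e' : DimVec Q₀} {M : Q.Rep k d} {N : Q.Rep k e} {M' : Q.Rep k d'}
    {N' : Q.Rep k e'} {B : Tot k d →ₗ[k] Tot k e →ₗ[k] k} (h : IsPairing D M N B)
    {φ : GrHom k d' d} {ψ : GrHom k e' e} (hφ : IsHom M' M φ) (hψ : IsHom N' N ψ) :
    IsPairing D M' N' (B.compl₁₂ φ.tot ψ.tot) where
  orth i x y := by
    simp only [LinearMap.compl₁₂_apply, GrHom.tot_proj, h.orth]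
  compat a x y := by
    simp only [LinearMap.compl₁₂_apply, hφ.tot_arrow, hψ.tot_arrow, h.compat]

/-- A pairing vanishes between degrees not exchanged by `σ`. -/
theorem IsPairing.single_single {M : Q.Rep k d} {N : Q.Rep k e} {B : Tot k d →ₗ[k] Tot k e →ₗ[k] k}
    (h : IsPairing D M N B) {i j : Q₀} (hij : j ≠ Q.σ₀ i) (x : Fin (d i) → k) (y : Fin (e j) → k) :
    B (Pi.single i x) (Pi.single j y) = 0 := by
  rw [← proj_single, h.orth, proj_single_ne hij.symm, map_zero]

/-- A non-degenerate pairing of `N` with itself represents every other pairing with `N`. -/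
theorem IsPairing.exists_hom [Fintype Q₀] {M : Q.Rep k d} {N : Q.Rep k e}
    {B : Tot k e →ₗ[k] Tot k e →ₗ[k] k}
    {G : Tot k d →ₗ[k] Tot k e →ₗ[k] k} (hB : IsPairing D N N B)
    (hnd : LinearMap.BilinForm.Nondegenerate B) (hG : IsPairing D M N G) :
    ∃ φ : GrHom k d e, IsHom M N φ ∧ ∀ x y, G x y = B (φ.tot x) y := by
  let Φ : Tot k d →ₗ[k] Tot k e := (LinearMap.BilinForm.toDual B hnd).symm.toLinearMap ∘ₗ G
  have hΦ : ∀ x y, B (Φ x) y = G x y := fun x y =>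
    LinearMap.BilinForm.apply_toDual_symm_apply (hB := hnd) (f := G x) y
  have hinj : ∀ u v, (∀ y, B u y = B v y) → u = v := by
    intro u v huv
    rw [← sub_eq_zero]
    refine hnd.1 _ fun y => ?_
    rw [map_sub, LinearMap.sub_apply, huv, sub_self]
  obtain ⟨φ, hφ, hφ'⟩ := exists_isHom_tot (M := M) (N := N) Φ
    (fun i x => hinj _ _ fun y => by rw [hΦ, hG.orth, hB.orth, hΦ])
    (fun a x => hinj _ _ fun y => by rw [hΦ, hG.compat, hB.compat, hΦ])
  exact ⟨φ, hφ, fun x y => by rw [hφ', hΦ]⟩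

end Total

section Radical

variable {k : Type*} [Field k]

/-- The left and the right radical of a bilinear map have the same codimension. -/
theorem finrank_add_finrank_ker_flip {V V' : Type*} [AddCommGroup V] [Module k V] [AddCommGroup V']
    [Module k V'] [FiniteDimensional k V] [FiniteDimensional k V'] (b : V →ₗ[k] V' →ₗ[k] k) :
    Module.finrank k V + Module.finrank k (LinearMap.ker b.flip)
      = Module.finrank k V' + Module.finrank k (LinearMap.ker b) := by
  have h1 := LinearMap.finrank_range_add_finrank_ker b
  have h2 := LinearMap.finrank_range_add_finrank_ker b.flip
  have h3 : LinearMap.range b.flip = LinearMap.range b.dualMap := by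
    have : b.flip = b.dualMap ∘ₗ (Module.evalEquiv k V').toLinearMap := by
      refine LinearMap.ext fun y => LinearMap.ext fun x => ?_
      rfl
    rw [this, LinearMap.range_comp_of_range_eq_top _ (LinearEquiv.range _)]
  have h4 := LinearMap.finrank_range_dualMap_eq_finrank_range b
  rw [h3] at h2
  have h5 : Module.finrank k (LinearMap.range b.dualMap)
      = Module.finrank k (LinearMap.range b) := h4
  have h6 : Module.finrank k (LinearMap.range b.dualMap) + Module.finrank k (LinearMap.ker b.flip)
      = Module.finrank k V' := h2
  omega

variable {Q₀ Q₁ : Type*} [Fintype Q₀] [DecidableEq Q₀] {Q : InvolutiveQuiver Q₀ Q₁}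
  {d : DimVec Q₀} {D : Q.DualityStructure} {M : Q.Rep k d}

/-- The left radical of a pairing restricted to a graded subspace. -/
def leftRad (B : Tot k d →ₗ[k] Tot k d →ₗ[k] k) (W : ∀ i, Submodule k (Fin (d i) → k)) (i : Q₀) :
    Submodule k (Fin (d i) → k) where
  carrier := {x | x ∈ W i ∧ ∀ y : Tot k d, (∀ j, y j ∈ W j) → B (Pi.single i x) y = 0}
  zero_mem' := ⟨zero_mem _, fun y _ => by simp⟩
  add_mem' := fun ha hb => ⟨add_mem ha.1 hb.1, fun y hy => by
    rw [Pi.single_add, map_add, LinearMap.add_apply, ha.2 y hy, hb.2 y hy, add_zero]⟩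
  smul_mem' := fun c x hx => ⟨Submodule.smul_mem _ c hx.1, fun y hy => by
    rw [Pi.single_smul, map_smul, LinearMap.smul_apply, hx.2 y hy, smul_zero]⟩

omit [Fintype Q₀] in
theorem single_mem {W : ∀ i, Submodule k (Fin (d i) → k)} {i : Q₀} {x : Fin (d i) → k}
    (hx : x ∈ W i) (j : Q₀) : (Pi.single i x : Tot k d) j ∈ W j := by
  by_cases h : j = i
  · subst h
    rwa [Pi.single_eq_same]
  · rw [Pi.single_eq_of_ne h]
    exact zero_mem _

omit [Fintype Q₀] in
theorem arrow_mem {W : ∀ i, Submodule k (Fin (d i) → k)} (hW : Q.IsSubrep M W) (a : Q₁)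
    {x : Tot k d} (hx : ∀ i, x i ∈ W i) (j : Q₀) : arrow M a x j ∈ W j :=
  single_mem (W := W) (hW a _ (hx _)) j

omit [Fintype Q₀] in
theorem IsPairing.isSubrep_leftRad {B : Tot k d →ₗ[k] Tot k d →ₗ[k] k} (hB : IsPairing D M M B)
    {W : ∀ i, Submodule k (Fin (d i) → k)} (hW : Q.IsSubrep M W) : Q.IsSubrep M (leftRad B W) := by
  intro a x hx
  refine ⟨hW a x hx.1, fun y hy => ?_⟩
  rw [← arrow_single, hB.compat, hx.2 _ (arrow_mem hW _ hy), mul_zero]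

omit [Fintype Q₀] in
/-- The flip of a pairing is a pairing up to the exchange of `τ_a` and `τ_{σ(a)}`. -/
theorem IsPairing.flip {B : Tot k d →ₗ[k] Tot k d →ₗ[k] k} (hB : IsPairing D M M B) :
    (∀ i x y, B.flip (proj k d i x) y = B.flip x (proj k d (Q.σ₀ i) y)) ∧
      ∀ a x y, B.flip (arrow M a x) y
        = ((D.τ (Q.σ₁ a) : ℤ) : k) * B.flip x (arrow M (Q.σ₁ a) y) := by
  refine ⟨fun i x y => ?_, fun a x y => ?_⟩
  · rw [LinearMap.flip_apply, LinearMap.flip_apply, hB.orth, Q.σ₀_σ₀]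
  · rw [LinearMap.flip_apply, LinearMap.flip_apply, hB.compat, Q.σ₁_σ₁, ← mul_assoc,
      ← Int.cast_mul, ← Units.val_mul, Int.units_mul_self]
    simp

omit [Fintype Q₀] in
theorem IsPairing.isSubrep_leftRad_flip {B : Tot k d →ₗ[k] Tot k d →ₗ[k] k} (hB : IsPairing D M M B)
    {W : ∀ i, Submodule k (Fin (d i) → k)} (hW : Q.IsSubrep M W) :
    Q.IsSubrep M (leftRad B.flip W) := by
  intro a x hx
  refine ⟨hW a x hx.1, fun y hy => ?_⟩
  rw [← arrow_single, hB.flip.2, hx.2 _ (arrow_mem hW _ hy), mul_zero]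

omit [Fintype Q₀] in
/-- In degrees exchanged by `σ`, the left and right radicals have equal codimensions. -/
theorem IsPairing.subDim_leftRad {B : Tot k d →ₗ[k] Tot k d →ₗ[k] k} (hB : IsPairing D M M B)
    (W : ∀ i, Submodule k (Fin (d i) → k)) (i : Q₀) :
    subDim W i + subDim (leftRad B.flip W) (Q.σ₀ i)
      = subDim W (Q.σ₀ i) + subDim (leftRad B W) i := by
  let b : W i →ₗ[k] W (Q.σ₀ i) →ₗ[k] k :=
    B.compl₁₂ (LinearMap.single k _ i ∘ₗ (W i).subtype)
      (LinearMap.single k _ (Q.σ₀ i) ∘ₗ (W (Q.σ₀ i)).subtype)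
  have hb : ∀ x y, b x y = B (Pi.single i x.1) (Pi.single (Q.σ₀ i) y.1) := fun x y => rfl
  have h1 : leftRad B W i = (LinearMap.ker b).map (W i).subtype := by
    ext x
    constructor
    · rintro ⟨hx, hx'⟩
      refine ⟨⟨x, hx⟩, ?_, rfl⟩
      exact LinearMap.ext fun y => hx' _ (single_mem y.2)
    · rintro ⟨⟨x, hx⟩, hx', rfl⟩
      refine ⟨hx, fun y hy => ?_⟩
      show B (Pi.single i x) y = 0
      rw [← proj_single, hB.orth]
      exact LinearMap.congr_fun hx' ⟨y (Q.σ₀ i), hy _⟩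
  have h2 : leftRad B.flip W (Q.σ₀ i) = (LinearMap.ker b.flip).map (W (Q.σ₀ i)).subtype := by
    ext y
    constructor
    · rintro ⟨hy, hy'⟩
      refine ⟨⟨y, hy⟩, ?_, rfl⟩
      exact LinearMap.ext fun x => hy' _ (single_mem x.2)
    · rintro ⟨⟨y, hy⟩, hy', rfl⟩
      refine ⟨hy, fun x hx => ?_⟩
      show B x (Pi.single (Q.σ₀ i) y) = 0
      rw [← proj_single, ← hB.orth]
      exact LinearMap.congr_fun hy' ⟨x i, hx _⟩
  unfold subDim
  rw [h1, h2, Submodule.finrank_map_subtype_eq, Submodule.finrank_map_subtype_eq]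
  exact finrank_add_finrank_ker_flip b

omit [DecidableEq Q₀] in
theorem lam_sigmaDim {θ : Q₀ → ℤ} (hθ : ∀ i, θ (Q.σ₀ i) = -θ i) (v : DimVec Q₀) :
    lam θ 0 (Q.sigmaDim v) = -lam θ 0 v := by
  unfold lam sigmaDim
  rw [← Equiv.sum_comp (Function.Involutive.toPerm Q.σ₀ Q.σ₀_σ₀), ← Finset.sum_neg_distrib]
  refine Finset.sum_congr rfl fun i _ => ?_
  show ((θ (Q.σ₀ i) : ℚ) - 0) * v (Q.σ₀ (Q.σ₀ i)) = _
  rw [hθ, Q.σ₀_σ₀]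
  push_cast
  ring

/-- The values of `θ` on the two radicals of `W` have the value on `W` as their mean.  Hence both
radicals of a stable representation of slope zero have slope zero, and a destabilizing `W` has a
destabilizing radical. -/
theorem IsPairing.lam_leftRad {B : Tot k d →ₗ[k] Tot k d →ₗ[k] k} (hB : IsPairing D M M B)
    {θ : Q₀ → ℤ} (hθ : ∀ i, θ (Q.σ₀ i) = -θ i) (W : ∀ i, Submodule k (Fin (d i) → k)) :
    lam θ 0 (subDim (leftRad B W)) + lam θ 0 (subDim (leftRad B.flip W))
      = 2 * lam θ 0 (subDim W) := by
  have h : subDim W + Q.sigmaDim (subDim (leftRad B.flip W))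
      = Q.sigmaDim (subDim W) + subDim (leftRad B W) := funext (hB.subDim_leftRad W)
  have h1 := congrArg (lam θ 0) h
  rw [lam_add, lam_add, lam_sigmaDim hθ, lam_sigmaDim hθ] at h1
  linarith

/-- A non-zero pairing of a stable representation of slope zero with itself is non-degenerate. -/
theorem IsPairing.nondegenerate {B : Tot k d →ₗ[k] Tot k d →ₗ[k] k} (hB : IsPairing D M M B)
    {θ : Q₀ → ℤ} (hθ : ∀ i, θ (Q.σ₀ i) = -θ i) (hM : Q.IsStable θ 0 M) (h0 : B ≠ 0) :
    LinearMap.BilinForm.Nondegenerate B := by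
  have htop : Q.IsSubrep M (fun _ => ⊤) := fun _ _ _ => trivial
  have h1 := hB.lam_leftRad hθ (fun _ => ⊤)
  rw [subDim_top, hM.lam_eq_zero] at h1
  have hL := hB.isSubrep_leftRad htop
  have hR := hB.isSubrep_leftRad_flip htop
  have hL1 := hM.lam_le _ hL
  have hR1 := hM.lam_le _ hR
  have ext0 : ∀ x y : Tot k d, (∀ i, B (Pi.single i (x i)) y = 0) → B x y = 0 := by
    intro x y hx
    rw [← Finset.univ_sum_single x, map_sum, LinearMap.sum_apply]
    exact Finset.sum_eq_zero fun i _ => hx i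
  have ext1 : ∀ x y : Tot k d, (∀ i, B x (Pi.single i (y i)) = 0) → B x y = 0 := by
    intro x y hx
    rw [← Finset.univ_sum_single y, map_sum]
    exact Finset.sum_eq_zero fun i _ => hx i
  constructor
  · intro x hx
    rcases hM.eq_bot_or_top _ hL (by linarith) with h | h
    · funext i
      have : x i ∈ leftRad B (fun _ => ⊤) i := by
        refine ⟨trivial, fun y _ => ?_⟩
        rw [← proj_apply, hB.orth]
        exact hx _
      rw [h i] at this
      exact this
    · refine absurd (LinearMap.ext fun x => LinearMap.ext fun y => ?_) h0
      refine ext0 x y fun i => ?_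
      have : x i ∈ leftRad B (fun _ => ⊤) i := by rw [h i]; trivial
      exact this.2 y fun _ => trivial
  · intro y hy
    rcases hM.eq_bot_or_top _ hR (by linarith) with h | h
    · funext i
      have : y i ∈ leftRad B.flip (fun _ => ⊤) i := by
        refine ⟨trivial, fun x _ => ?_⟩
        rw [← proj_apply, hB.flip.1]
        exact hy _
      rw [h i] at this
      exact this
    · refine absurd (LinearMap.ext fun x => LinearMap.ext fun y => ?_) h0
      refine ext1 x y fun i => ?_
      have : y i ∈ leftRad B.flip (fun _ => ⊤) i := by rw [h i]; trivial
      exact this.2 x fun _ => trivial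

end Radical

section SelfDual

variable {Q₀ Q₁ : Type*} [DecidableEq Q₀] {Q : InvolutiveQuiver Q₀ Q₁} {D : Q.DualityStructure}
  {k : Type*} [Field k] {d : DimVec Q₀}

/-- The operator acting by `s_i` in degree `i`. -/
def sgn (D : Q.DualityStructure) (k : Type*) [Field k] (d : DimVec Q₀) : Tot k d →ₗ[k] Tot k d :=
  LinearMap.pi fun i => ((D.s i : ℤ) : k) • LinearMap.proj i

omit [DecidableEq Q₀] in
theorem sgn_apply (x : Tot k d) (i : Q₀) : sgn D k d x i = ((D.s i : ℤ) : k) • x i := rfl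

theorem sgn_single (i : Q₀) (x : Fin (d i) → k) :
    sgn D k d (Pi.single i x) = ((D.s i : ℤ) : k) • Pi.single i x := by
  funext j
  rw [sgn_apply, Pi.smul_apply]
  by_cases h : j = i
  · subst h
    rfl
  · rw [Pi.single_eq_of_ne h, smul_zero, smul_zero]

omit [DecidableEq Q₀] in
theorem GrHom.tot_sgn {e : DimVec Q₀} (φ : GrHom k d e)
    (x : Tot k d) : φ.tot (sgn D k d x) = sgn D k e (φ.tot x) := by
  funext i
  rw [GrHom.tot_apply, sgn_apply, sgn_apply, map_smul]
  rfl

variable [Fintype Q₀]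

theorem DualityStructure.SelfDualRep.isPairing (N : D.SelfDualRep k d) :
    IsPairing D N.maps N.maps N.form := by
  have h1 : ∀ i x y, N.form (proj k d i x) y = N.form x (proj k d (Q.σ₀ i) y) := by
    intro i x y
    have e1 : N.form (proj k d i x) y = N.form (proj k d i x) (proj k d (Q.σ₀ i) y) := by
      conv_lhs => rw [← Finset.univ_sum_single y]
      rw [map_sum, Finset.sum_eq_single (Q.σ₀ i) (fun j _ hj => ?_) (by simp)]
      · rfl
      · exact N.orthogonal i j (fun h => hj (by rw [h, Q.σ₀_σ₀])) _ _
    have e2 : N.form x (proj k d (Q.σ₀ i) y) = N.form (proj k d i x) (proj k d (Q.σ₀ i) y) := by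
      conv_lhs => rw [← Finset.univ_sum_single x]
      rw [map_sum, LinearMap.sum_apply, Finset.sum_eq_single i (fun j _ hj => ?_) (by simp)]
      · rfl
      · exact N.orthogonal j _ (fun h => hj (by rw [h, Q.σ₀_σ₀])) _ _
    rw [e1, e2]
  refine ⟨h1, fun a x y => ?_⟩
  have e1 : N.form (arrow N.maps a x) y
      = N.form (arrow N.maps a x) (proj k d (Q.src (Q.σ₁ a)) y) := by
    conv_lhs => rw [← proj_arrow, h1, ← Q.src_σ₁]
  have e2 : N.form x (arrow N.maps (Q.σ₁ a) y)
      = N.form (proj k d (Q.src a) x) (arrow N.maps (Q.σ₁ a) y) := by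
    conv_lhs => rw [← proj_arrow, Q.tgt_σ₁, ← h1]
  rw [e1, e2]
  exact N.compatible a _ _

theorem DualityStructure.SelfDualRep.form_symm (N : D.SelfDualRep k d) (x y : Tot k d) :
    N.form y (sgn D k d x) = N.form x y := by
  have h := N.isPairing
  have key : ∀ i (x : Fin (d i) → k) (y : Tot k d),
      N.form y (sgn D k d (Pi.single i x)) = N.form (Pi.single i x) y := by
    intro i x y
    have e1 : N.form (Pi.single i x) y = N.form (Pi.single i x) (proj k d (Q.σ₀ i) y) := by
      conv_lhs => rw [← proj_single, h.orth]
    have e2 : N.form y (Pi.single i x) = N.form (proj k d (Q.σ₀ i) y) (Pi.single i x) := by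
      rw [h.orth, Q.σ₀_σ₀, proj_single]
    rw [sgn_single, map_smul, e1, e2]
    exact (N.symmetric i x _).symm
  rw [← Finset.univ_sum_single x]
  simp only [map_sum, LinearMap.sum_apply]
  exact Finset.sum_congr rfl fun i _ => key i _ y

omit [DecidableEq Q₀] [Fintype Q₀] in
theorem sgn_sgn (x : Tot k d) : sgn D k d (sgn D k d x) = x := by
  funext i
  rw [sgn_apply, sgn_apply, smul_smul, ← Int.cast_mul, ← Units.val_mul, Int.units_mul_self]
  simp

omit [Fintype Q₀] in
/-- A non-degenerate pairing of a representation with itself which is symmetric up to the signs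
`s_i` is a self-dual structure. -/
def DualityStructure.SelfDualRep.ofPairing (U : Q.Rep k d) (B : LinearMap.BilinForm k (Tot k d))
    (hB : IsPairing D U U B) (hnd : B.Nondegenerate)
    (hs : ∀ x y, B y (sgn D k d x) = B x y) : D.SelfDualRep k d where
  maps := U
  form := B
  nondegenerate := hnd
  orthogonal i j h x y := hB.single_single (fun hh => h (by rw [hh, Q.σ₀_σ₀])) x y
  symmetric i x y := by
    rw [← hs, sgn_single, map_smul, smul_eq_mul]
  compatible a x y := by
    have := hB.compat a (Pi.single _ x) (Pi.single _ y)
    rwa [arrow_single, arrow_single] at this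

omit [DecidableEq Q₀] in
theorem lam_eq_zero {θ : Q₀ → ℤ} (hθ : ∀ i, θ (Q.σ₀ i) = -θ i) (hd : ∀ i, d (Q.σ₀ i) = d i) :
    lam θ 0 d = 0 := by
  have hd' : Q.sigmaDim d = d := funext hd
  have := lam_sigmaDim (Q := Q) hθ d
  rw [hd'] at this
  linarith

omit [DecidableEq Q₀] in
theorem slope_eq_zero {θ : Q₀ → ℤ} (hθ : ∀ i, θ (Q.σ₀ i) = -θ i) (hd : ∀ i, d (Q.σ₀ i) = d i) :
    slope θ d = 0 := by
  by_cases h : d = 0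
  · simp [h, slope]
  · exact (slope_eq_iff h).mpr (lam_eq_zero hθ hd)

/-- For self-dual representations, `σ`-semistability is semistability of the underlying
representation: a destabilizing subrepresentation `W` gives the isotropic destabilizing
subrepresentation `W ∩ W^⊥`. -/
theorem isSigmaSemistable_iff {θ : Q₀ → ℤ} (hθ : ∀ i, θ (Q.σ₀ i) = -θ i)
    (hd : ∀ i, d (Q.σ₀ i) = d i) (N : D.SelfDualRep k d) :
    DualityStructure.IsSigmaSemistable θ N ↔ Q.IsSS θ 0 N.maps := by
  have hs := slope_eq_zero hθ hd
  have h0 := lam_eq_zero hθ hd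
  unfold DualityStructure.IsSigmaSemistable
  rw [hs]
  constructor
  · intro h
    refine ⟨h0, fun W hW => ?_⟩
    have hL := N.isPairing.isSubrep_leftRad hW
    -- Left and right radical agree since the form is symmetric up to signs.
    have hLR : leftRad (LinearMap.flip N.form) W = leftRad N.form W := by
      funext i
      ext x
      refine and_congr_right' ⟨fun hx y hy => ?_, fun hx y hy => ?_⟩
      · have h1 : N.form y (Pi.single i x) = 0 := hx y hy
        rw [← N.form_symm, sgn_single, map_smul, h1, smul_zero]
      · show N.form y (Pi.single i x) = 0
        rw [← sgn_sgn (D := D) (Pi.single i x), N.form_symm, sgn_single, map_smul,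
          LinearMap.smul_apply, hx y hy, smul_zero]
    have h1 := N.isPairing.lam_leftRad hθ W
    rw [hLR] at h1
    by_cases hz : subDim (leftRad N.form W) = 0
    · rw [hz, lam_zero] at h1
      linarith
    · -- The radical of `W` is isotropic, so semistability applies to it.
      have h2 := h _ hL ?_ hz
      · rw [slope_le_iff hz] at h2
        linarith
      · intro i j x hx y hy
        exact hx.2 _ (single_mem hy.1)
  · intro h W hW _ hz
    rw [slope_le_iff hz]
    exact h.lam_le W hW

end SelfDual

end InvolutiveQuiver

/-! ### Signed permutations and their eigenspaces -/

section SignedPerm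

variable {X : Type*} [Fintype X] [DecidableEq X] (π : X → X) (s : X → ℤˣ)

/-- The signed permutation operator on functions. -/
def signedPerm (k : Type*) [Field k] : (X → k) →ₗ[k] (X → k) where
  toFun f x := ((s x : ℤ) : k) * f (π x)
  map_add' f g := by
    funext x
    simp [mul_add]
  map_smul' c f := by
    funext x
    simp only [Pi.smul_apply, smul_eq_mul, RingHom.id_apply]
    ring

variable {π s} {k : Type*} [Field k]

theorem units_cast_mul_self (ε : ℤˣ) : ((ε : ℤ) : k) * ((ε : ℤ) : k) = 1 := by
  rw [← Int.cast_mul, ← Units.val_mul, Int.units_mul_self]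
  simp

omit [Fintype X] [DecidableEq X] in
theorem signedPerm_signedPerm (hπ : ∀ x, π (π x) = x) (hs : ∀ x, s x * s (π x) = 1) (f : X → k) :
    signedPerm π s k (signedPerm π s k f) = f := by
  funext x
  show ((s x : ℤ) : k) * (((s (π x) : ℤ) : k) * f (π (π x))) = f x
  rw [hπ, ← mul_assoc, ← Int.cast_mul, ← Units.val_mul, hs]
  simp

/-- The eigenspace of a signed permutation for the eigenvalue `ε = ±1`. -/
def signedEigen (π : X → X) (s : X → ℤˣ) (k : Type*) [Field k] (ε : ℤˣ) : Submodule k (X → k) :=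
  LinearMap.ker (signedPerm π s k - ((ε : ℤ) : k) • LinearMap.id)

omit [Fintype X] [DecidableEq X] in
theorem mem_signedEigen {ε : ℤˣ} {f : X → k} :
    f ∈ signedEigen π s k ε ↔ ∀ x, ((s x : ℤ) : k) * f (π x) = ((ε : ℤ) : k) * f x := by
  rw [signedEigen, LinearMap.mem_ker, LinearMap.sub_apply, sub_eq_zero, funext_iff]
  rfl

/-- An eigenvector is determined by its values on a transversal of the orbits, the fixed points with
the wrong sign being omitted. -/
theorem finrank_signedEigen [LinearOrder X] (h2 : (2 : k) ≠ 0) (hπ : ∀ x, π (π x) = x)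
    (hs : ∀ x, s x * s (π x) = 1) (ε : ℤˣ) :
    Module.finrank k (signedEigen π s k ε)
      = (Finset.univ.filter fun x => x < π x).card
        + (Finset.univ.filter fun x => π x = x ∧ s x = ε).card := by
  classical
  let Y := {x // x < π x ∨ (π x = x ∧ s x = ε)}
  have hsk : ∀ x, ((s x : ℤ) : k) * ((s (π x) : ℤ) : k) = 1 := fun x => by
    rw [← Int.cast_mul, ← Units.val_mul, hs]
    simp
  let E : signedEigen π s k ε ≃ₗ[k] (Y → k) :=
    { toFun := fun f y => f.1 y.1
      map_add' := fun _ _ => rfl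
      map_smul' := fun _ _ => rfl
      invFun := fun g => ⟨fun x => if h : x < π x ∨ (π x = x ∧ s x = ε) then g ⟨x, h⟩ else
          if h' : π x < x then ((ε : ℤ) : k) * ((s x : ℤ) : k) * g ⟨π x, Or.inl (by rwa [hπ])⟩
          else 0, by
        rw [mem_signedEigen]
        intro x
        rcases lt_trichotomy x (π x) with h | h | h
        · rw [dif_neg (by
            rw [hπ]
            rintro (h' | h')
            · exact absurd h' h.not_gt
            · exact absurd h'.1 h.ne), dif_pos (show π (π x) < π x by rwa [hπ]), dif_pos (Or.inl h)]
          have : (⟨π (π x), Or.inl (by simpa only [hπ] using h)⟩ : Y) = ⟨x, Or.inl h⟩ :=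
            Subtype.ext (hπ x)
          rw [this]
          linear_combination ((ε : ℤ) : k) * g ⟨x, Or.inl h⟩ * hsk x
        · simp only [← h, lt_irrefl, false_or, true_and, dite_false]
          split_ifs with hε
          · exact congrArg (fun u : ℤˣ => ((u : ℤ) : k) * g ⟨x, Or.inr ⟨h.symm, hε⟩⟩) hε
          · simp
        · have h1 : ¬ (x < π x ∨ (π x = x ∧ s x = ε)) := by
            rintro (h' | h')
            · exact absurd h' h.not_gt
            · exact absurd h'.1 h.ne
          rw [dif_neg h1, dif_pos h, dif_pos (Or.inl (by rwa [hπ]))]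
          linear_combination (-(((s x : ℤ) : k) * g ⟨π x, Or.inl (by rwa [hπ])⟩)) *
            units_cast_mul_self (k := k) ε⟩
      left_inv := fun f => by
        have hf := mem_signedEigen.mp f.2
        apply Subtype.ext
        funext x
        show (if h : x < π x ∨ (π x = x ∧ s x = ε) then f.1 x else
          if h' : π x < x then ((ε : ℤ) : k) * ((s x : ℤ) : k) * f.1 (π x) else 0) = f.1 x
        split_ifs with h h'
        · rfl
        · rw [mul_assoc, hf, ← mul_assoc, units_cast_mul_self, one_mul]
        · -- A fixed point with the wrong sign: here the eigenvector vanishes.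
          have hx : π x = x := by
            push Not at h
            exact le_antisymm h.1 (not_lt.mp h')
          have hε : s x = -ε := by
            rcases Int.units_eq_one_or (s x) with h1 | h1 <;>
              rcases Int.units_eq_one_or ε with h2 | h2 <;> simp_all
          have h1 := hf x
          rw [hx, hε] at h1
          have h3 : 2 * (((ε : ℤ) : k) * f.1 x) = 0 := by
            push_cast at h1
            linear_combination -h1
          have h4 := (mul_eq_zero.mp h3).resolve_left h2
          exact ((mul_eq_zero.mp h4).resolve_left
            (left_ne_zero_of_mul_eq_one (units_cast_mul_self ε))).symm
      right_inv := fun g => by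
        funext y
        exact dif_pos y.2 }
  rw [LinearEquiv.finrank_eq E, Module.finrank_fintype_fun_eq_card, Fintype.card_subtype,
    ← Finset.card_union_of_disjoint, ← Finset.filter_or]
  rw [Finset.disjoint_filter]
  exact fun x _ h h' => h.ne h'.1.symm

/-- The trace of a signed permutation of order two is the signed number of its fixed points. -/
theorem finrank_signedEigen_sub (h2 : (2 : k) ≠ 0) (hπ : ∀ x, π (π x) = x)
    (hs : ∀ x, s x * s (π x) = 1) :
    (Module.finrank k (signedEigen π s k 1) : ℤ) - Module.finrank k (signedEigen π s k (-1))
      = ∑ x with π x = x, (s x : ℤ) := by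
  let _ : LinearOrder X := LinearOrder.lift' (Fintype.equivFin X) (Fintype.equivFin X).injective
  rw [finrank_signedEigen h2 hπ hs, finrank_signedEigen h2 hπ hs]
  push_cast
  rw [add_sub_add_left_eq_sub, ← Finset.filter_filter, ← Finset.filter_filter,
    Finset.card_filter, Finset.card_filter]
  push_cast
  rw [← Finset.sum_sub_distrib]
  refine Finset.sum_congr rfl fun x _ => ?_
  rcases Int.units_eq_one_or (s x) with h | h <;> simp [h]

variable {Y : Type*} [Fintype Y] [DecidableEq Y] {ρ : Y → Y} {t : Y → ℤˣ}

/-- An equivariant map between signed permutation representations whose dimensions differ by one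
and whose kernel is a line: the sign of the kernel is the difference of the signed numbers of fixed
points. -/
theorem sign_ker_eq (h2 : (2 : k) ≠ 0) (hπ : ∀ x, π (π x) = x)
    (hs : ∀ x, s x * s (π x) = 1) (hρ : ∀ x, ρ (ρ x) = x) (ht : ∀ x, t x * t (ρ x) = 1)
    (F : (X → k) →ₗ[k] (Y → k))
    (hF : ∀ f, F (signedPerm π s k f) = signedPerm ρ t k (F f))
    (hcard : Fintype.card X = Fintype.card Y + 1) {v : X → k} (hv : v ≠ 0)
    (hker : ∀ f, F f = 0 ↔ ∃ c : k, f = c • v) :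
    ∃ ε : ℤˣ, signedPerm π s k v = ((ε : ℤ) : k) • v ∧
      (ε : ℤ) = ∑ x with π x = x, (s x : ℤ) - ∑ y with ρ y = y, (t y : ℤ) := by
  have hFv : F v = 0 := (hker v).mpr ⟨1, (one_smul k v).symm⟩
  obtain ⟨c, hc⟩ := (hker (signedPerm π s k v)).mp (by rw [hF, hFv, map_zero])
  have hcc : c * c = 1 := by
    have h := signedPerm_signedPerm hπ hs v
    rw [hc, map_smul, hc, smul_smul] at h
    by_contra hne
    refine hv ((smul_eq_zero.mp ?_).resolve_left (sub_ne_zero.mpr hne))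
    rw [sub_smul, h, one_smul, sub_self]
  obtain ⟨ε, hε⟩ : ∃ ε : ℤˣ, signedPerm π s k v = ((ε : ℤ) : k) • v := by
    rcases mul_self_eq_one_iff.mp hcc with rfl | rfl
    · exact ⟨1, by rw [hc]; simp⟩
    · exact ⟨-1, by rw [hc]; simp⟩
  refine ⟨ε, hε, ?_⟩
  have hkerF : Module.finrank k (LinearMap.ker F) = 1 := by
    refine finrank_eq_one_iff'.mpr ⟨⟨v, hFv⟩, fun h => hv (congrArg Subtype.val h), fun w => ?_⟩
    obtain ⟨c, hc⟩ := (hker w.1).mp w.2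
    exact ⟨c, Subtype.ext hc.symm⟩
  have hsurj : Function.Surjective F := by
    rw [← LinearMap.range_eq_top]
    refine Submodule.eq_top_of_finrank_eq ?_
    have := LinearMap.finrank_range_add_finrank_ker F
    rw [hkerF, Module.finrank_fintype_fun_eq_card, hcard] at this
    rw [Module.finrank_fintype_fun_eq_card]
    omega
  -- The surjection `F` restricts to surjections of eigenspaces, with kernel the line through `v`
  -- for the eigenvalue `ε` and zero for `-ε`.
  have main : ∀ δ : ℤˣ, Module.finrank k (signedEigen π s k δ)
      = Module.finrank k (signedEigen ρ t k δ) + if δ = ε then 1 else 0 := by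
    intro δ
    have hmem : ∀ f : signedEigen π s k δ, F f.1 ∈ signedEigen ρ t k δ := by
      intro f
      have hf : signedPerm π s k f.1 = ((δ : ℤ) : k) • f.1 := funext (mem_signedEigen.mp f.2)
      refine mem_signedEigen.mpr fun y => ?_
      have := congrFun (hF f.1) y
      rw [hf, map_smul] at this
      exact this.symm
    let G : signedEigen π s k δ →ₗ[k] signedEigen ρ t k δ :=
      LinearMap.codRestrict _ (F.domRestrict _) hmem
    have hG : LinearMap.range G = ⊤ := by
      rw [LinearMap.range_eq_top]
      intro w
      obtain ⟨f, hf⟩ := hsurj w.1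
      have hw : signedPerm ρ t k w.1 = ((δ : ℤ) : k) • w.1 := funext (mem_signedEigen.mp w.2)
      -- Average a preimage to make it an eigenvector.
      refine ⟨⟨(2 : k)⁻¹ • (f + ((δ : ℤ) : k) • signedPerm π s k f), ?_⟩, Subtype.ext ?_⟩
      · rw [signedEigen, LinearMap.mem_ker, LinearMap.sub_apply, map_smul, map_add, map_smul,
          signedPerm_signedPerm hπ hs]
        simp only [LinearMap.smul_apply, LinearMap.id_apply]
        rw [smul_comm, smul_add _ f, smul_smul, units_cast_mul_self, one_smul, add_comm, sub_self]
      · show F ((2 : k)⁻¹ • (f + ((δ : ℤ) : k) • signedPerm π s k f)) = w.1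
        rw [map_smul, map_add, map_smul, hF, hf, hw, smul_smul, units_cast_mul_self, one_smul,
          ← two_smul k w.1, smul_smul, inv_mul_cancel₀ h2, one_smul]
    have h1 := LinearMap.finrank_range_add_finrank_ker G
    rw [hG, finrank_top] at h1
    rw [← h1]
    congr 1
    split_ifs with h
    · subst h
      have hvm : v ∈ signedEigen π s k δ := mem_signedEigen.mpr (congrFun hε)
      have h1 : (LinearMap.ker G).map (signedEigen π s k δ).subtype = LinearMap.ker F := by
        ext f
        constructor
        · rintro ⟨w, hw, rfl⟩
          exact congrArg Subtype.val hw
        · intro hf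
          obtain ⟨c, rfl⟩ := (hker f).mp hf
          exact ⟨⟨c • v, Submodule.smul_mem _ c hvm⟩, Subtype.ext hf, rfl⟩
      rw [← hkerF, ← h1, Submodule.finrank_map_subtype_eq]
    · have : LinearMap.ker G = ⊥ := by
        rw [LinearMap.ker_eq_bot']
        intro w hw
        obtain ⟨c, hc⟩ := (hker w.1).mp (congrArg Subtype.val hw)
        have hw' : signedPerm π s k w.1 = ((δ : ℤ) : k) • w.1 := funext (mem_signedEigen.mp w.2)
        have hδ : (δ : ℤ) = -ε := by
          rcases Int.units_eq_one_or δ with rfl | rfl <;>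
            rcases Int.units_eq_one_or ε with rfl | rfl <;>
            first
            | exact absurd rfl h
            | simp
        have h3 : signedPerm π s k w.1 = ((ε : ℤ) : k) • w.1 := by
          rw [hc, map_smul, hε, smul_comm]
        rw [h3, hδ] at hw'
        have h4 : (2 * ((ε : ℤ) : k)) • w.1 = 0 := by
          rw [two_mul, add_smul]
          nth_rewrite 1 [hw']
          push_cast
          rw [neg_smul, neg_add_cancel]
        exact Subtype.ext ((smul_eq_zero.mp h4).resolve_left (mul_ne_zero h2
          (left_ne_zero_of_mul_eq_one (units_cast_mul_self ε))))
      rw [this, finrank_bot]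
  have e1 := finrank_signedEigen_sub (k := k) h2 hπ hs
  have e2 := finrank_signedEigen_sub (k := k) h2 hρ ht
  rw [← e1, ← e2, main 1, main (-1)]
  rcases Int.units_eq_one_or ε with rfl | rfl
  · rw [if_pos rfl, if_neg (by decide)]
    push_cast
    ring
  · rw [if_pos rfl, if_neg (by decide)]
    push_cast
    ring

end SignedPerm

namespace InvolutiveQuiver

/-! ### The sign of a self-dual stable representation -/

section Sign

variable {Q₀ Q₁ : Type*} [Fintype Q₀] [DecidableEq Q₀]
  {Q : InvolutiveQuiver Q₀ Q₁} {k : Type*} [Field k] {d : DimVec Q₀}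

/-- The indices of the standard basis of the total space. -/
abbrev BasisIdx (d : DimVec Q₀) := Σ i, Fin (d i)

/-- The pairs of basis vectors in degrees exchanged by `σ`: the matrix entries of a pairing. -/
abbrev FormIdx (Q : InvolutiveQuiver Q₀ Q₁) (d : DimVec Q₀) :=
  {z : BasisIdx d × BasisIdx d // z.2.1 = Q.σ₀ z.1.1}

/-- The indices of the adjunction equations between an arrow and its image under `σ`. -/
abbrev CompatIdx (Q : InvolutiveQuiver Q₀ Q₁) (d : DimVec Q₀) :=
  {z : Q₁ × BasisIdx d × BasisIdx d // z.2.1.1 = Q.src z.1 ∧ z.2.2.1 = Q.src (Q.σ₁ z.1)}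

/-- Exchange of the two arguments of a form. -/
def FormIdx.swap (z : FormIdx Q d) : FormIdx Q d :=
  ⟨(z.1.2, z.1.1), by rw [z.2, Q.σ₀_σ₀]⟩

/-- Exchange of the two arguments in the adjunction equations. -/
def CompatIdx.swap (z : CompatIdx Q d) : CompatIdx Q d :=
  ⟨(Q.σ₁ z.1.1, z.1.2.2, z.1.2.1), z.2.2, by rw [Q.σ₁_σ₁]; exact z.2.1⟩

/-- The standard basis of the total space. -/
noncomputable def totBasis (k : Type*) [Field k] (d : DimVec Q₀) :
    Module.Basis (BasisIdx d) k (Tot k d) := Pi.basis fun i => Pi.basisFun k (Fin (d i))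

theorem totBasis_apply (p : BasisIdx d) :
    totBasis k d p = Pi.single p.1 (Pi.single p.2 1) := by
  rw [totBasis, Pi.basis_apply, Pi.basisFun_apply]

theorem totBasis_apply_apply (p q : BasisIdx d) :
    totBasis k d p q.1 q.2 = if q = p then 1 else 0 := by
  obtain ⟨i, u⟩ := p
  obtain ⟨j, v⟩ := q
  rw [totBasis_apply]
  by_cases h : j = i
  · subst h
    simp [Pi.single_apply]
  · rw [Pi.single_eq_of_ne h, if_neg (fun hh => h (congrArg Sigma.fst hh))]
    rfl

/-- The bilinear form with given matrix entries. -/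
def formOf (Q : InvolutiveQuiver Q₀ Q₁) (k : Type*) [Field k] (d : DimVec Q₀) :
    (FormIdx Q d → k) →ₗ[k] (Tot k d →ₗ[k] Tot k d →ₗ[k] k) where
  toFun c := LinearMap.mk₂ k
    (fun x y => ∑ z : FormIdx Q d, c z * (x z.1.1.1 z.1.1.2 * y z.1.2.1 z.1.2.2))
    (fun x x' y => by simp [add_mul, mul_add, Finset.sum_add_distrib])
    (fun a x y => by
      simp only [Pi.smul_apply, smul_eq_mul, Finset.mul_sum]
      exact Finset.sum_congr rfl fun _ _ => by ring)
    (fun x y y' => by simp [mul_add, Finset.sum_add_distrib])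
    (fun a x y => by
      simp only [Pi.smul_apply, smul_eq_mul, Finset.mul_sum]
      exact Finset.sum_congr rfl fun _ _ => by ring)
  map_add' c c' := by
    refine LinearMap.ext fun x => LinearMap.ext fun y => ?_
    simp [add_mul, Finset.sum_add_distrib]
  map_smul' a c := by
    refine LinearMap.ext fun x => LinearMap.ext fun y => ?_
    simp [Finset.mul_sum, mul_assoc]

theorem formOf_apply (c : FormIdx Q d → k) (x y : Tot k d) :
    formOf Q k d c x y = ∑ z : FormIdx Q d, c z * (x z.1.1.1 z.1.1.2 * y z.1.2.1 z.1.2.2) := rfl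

theorem formOf_basis (c : FormIdx Q d → k) (z : FormIdx Q d) :
    formOf Q k d c (totBasis k d z.1.1) (totBasis k d z.1.2) = c z := by
  rw [formOf_apply, Finset.sum_eq_single z]
  · rw [totBasis_apply_apply, totBasis_apply_apply, if_pos rfl, if_pos rfl, mul_one, mul_one]
  · intro w _ hw
    rw [totBasis_apply_apply, totBasis_apply_apply]
    by_cases h1 : w.1.1 = z.1.1
    · by_cases h2 : w.1.2 = z.1.2
      · exact absurd (Subtype.ext (Prod.ext h1 h2)) hw
      · rw [if_neg h2, mul_zero, mul_zero]
    · rw [if_neg h1, zero_mul, mul_zero]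
  · simp

theorem formOf_orth (c : FormIdx Q d → k) (i : Q₀) (x y : Tot k d) :
    formOf Q k d c (proj k d i x) y = formOf Q k d c x (proj k d (Q.σ₀ i) y) := by
  have key : ∀ (i : Q₀) (x : Tot k d) (p : BasisIdx d),
      proj k d i x p.1 p.2 = if p.1 = i then x p.1 p.2 else 0 := by
    rintro i x ⟨j, u⟩
    rw [proj_apply]
    by_cases h : j = i
    · subst h
      simp
    · rw [Pi.single_eq_of_ne h, if_neg h]
      rfl
  rw [formOf_apply, formOf_apply]
  refine Finset.sum_congr rfl fun z _ => ?_
  rw [key, key]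
  have : z.1.2.1 = Q.σ₀ i ↔ z.1.1.1 = i := by
    rw [z.2]
    exact (Function.Involutive.injective Q.σ₀_σ₀).eq_iff
  simp only [this]
  split_ifs <;> simp

theorem formOf_swap (D : Q.DualityStructure) (c : FormIdx Q d → k) (x y : Tot k d) :
    formOf Q k d c y (sgn D k d x)
      = formOf Q k d (signedPerm FormIdx.swap (fun z => D.s z.1.1.1) k c) x y := by
  rw [formOf_apply, formOf_apply, ← Equiv.sum_comp
    (Function.Involutive.toPerm (FormIdx.swap : FormIdx Q d → FormIdx Q d) (fun _ => rfl))]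
  refine Finset.sum_congr rfl fun z _ => ?_
  show c z.swap * (y z.1.2.1 z.1.2.2 * (((D.s z.1.1.1 : ℤ) : k) * x z.1.1.1 z.1.1.2))
    = ((D.s z.1.1.1 : ℤ) : k) * c z.swap * (x z.1.1.1 z.1.1.2 * y z.1.2.1 z.1.2.2)
  ring

variable {D : Q.DualityStructure} {M : Q.Rep k d}

/-- The defect of a form from satisfying the adjunction equations. -/
noncomputable def formDiff (D : Q.DualityStructure) (M : Q.Rep k d) :
    (FormIdx Q d → k) →ₗ[k] (CompatIdx Q d → k) where
  toFun c z := formOf Q k d c (arrow M z.1.1 (totBasis k d z.1.2.1)) (totBasis k d z.1.2.2)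
    - ((D.τ z.1.1 : ℤ) : k) * formOf Q k d c (totBasis k d z.1.2.1)
      (arrow M (Q.σ₁ z.1.1) (totBasis k d z.1.2.2))
  map_add' c c' := by
    funext z
    simp only [map_add, LinearMap.add_apply, Pi.add_apply]
    ring
  map_smul' a c := by
    funext z
    simp only [map_smul, LinearMap.smul_apply, Pi.smul_apply, smul_eq_mul, RingHom.id_apply]
    ring

theorem formDiff_eq_zero_iff {c : FormIdx Q d → k} :
    formDiff D M c = 0 ↔ IsPairing D M M (formOf Q k d c) := by
  constructor
  · intro h
    refine ⟨formOf_orth c, fun a x y => ?_⟩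
    have key : (formOf Q k d c).compl₁₂ (arrow M a) LinearMap.id
        = ((D.τ a : ℤ) : k) • (formOf Q k d c).compl₁₂ LinearMap.id (arrow M (Q.σ₁ a)) := by
      refine LinearMap.ext_basis (totBasis k d) (totBasis k d) fun p p' => ?_
      simp only [LinearMap.compl₁₂_apply, LinearMap.smul_apply, LinearMap.id_apply, smul_eq_mul]
      by_cases h1 : p.1 = Q.src a
      · by_cases h2 : p'.1 = Q.src (Q.σ₁ a)
        · exact sub_eq_zero.mp (congrFun h ⟨(a, p, p'), h1, h2⟩)
        · have e1 : arrow M (Q.σ₁ a) (totBasis k d p') = 0 := by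
            rw [← arrow_proj, totBasis_apply, proj_single_ne (fun hh => h2 hh.symm), map_zero]
          rw [e1, map_zero, mul_zero, ← proj_arrow, formOf_orth, ← Q.src_σ₁, totBasis_apply p',
            proj_single_ne (fun hh => h2 hh.symm), map_zero]
      · have e1 : arrow M a (totBasis k d p) = 0 := by
          rw [← arrow_proj, totBasis_apply, proj_single_ne (fun hh => h1 hh.symm), map_zero]
        rw [e1, map_zero, LinearMap.zero_apply, ← proj_arrow, Q.tgt_σ₁, ← formOf_orth,
          totBasis_apply p, proj_single_ne (fun hh => h1 hh.symm), map_zero, LinearMap.zero_apply,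
          mul_zero]
    exact LinearMap.congr_fun (LinearMap.congr_fun key x) y
  · intro h
    funext z
    exact sub_eq_zero.mpr (h.compat _ _ _)

omit [Fintype Q₀] in
theorem sgn_arrow (a : Q₁) (x : Tot k d) :
    sgn D k d (arrow M a x) = ((D.s (Q.tgt a) : ℤ) : k) • arrow M a x := by
  rw [arrow_apply, sgn_single]

theorem sgn_totBasis (p : BasisIdx d) :
    sgn D k d (totBasis k d p) = ((D.s p.1 : ℤ) : k) • totBasis k d p := by
  rw [totBasis_apply, sgn_single]

theorem formDiff_signedPerm (c : FormIdx Q d → k) :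
    formDiff D M (signedPerm FormIdx.swap (fun z => D.s z.1.1.1) k c)
      = signedPerm CompatIdx.swap (fun z => -(D.τ z.1.1 * D.s (Q.src z.1.1))) k
        (formDiff D M c) := by
  funext z
  obtain ⟨⟨a, p, p'⟩, h1, h2⟩ := z
  show formOf Q k d _ (arrow M a (totBasis k d p)) (totBasis k d p')
    - ((D.τ a : ℤ) : k) * formOf Q k d _ (totBasis k d p) (arrow M (Q.σ₁ a) (totBasis k d p'))
    = ((-(D.τ a * D.s (Q.src a)) : ℤˣ) : ℤ) * (formOf Q k d c (arrow M (Q.σ₁ a) (totBasis k d p'))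
      (totBasis k d p) - ((D.τ (Q.σ₁ a) : ℤ) : k) * formOf Q k d c (totBasis k d p')
      (arrow M (Q.σ₁ (Q.σ₁ a)) (totBasis k d p)))
  rw [← formOf_swap, ← formOf_swap, sgn_arrow, sgn_totBasis, Q.σ₁_σ₁, map_smul, map_smul]
  change p.1 = Q.src a at h1
  have h3 : ((D.τ a : ℤ) : k) * ((D.τ (Q.σ₁ a) : ℤ) : k)
      = ((D.s (Q.src a) : ℤ) : k) * ((D.s (Q.tgt a) : ℤ) : k) := by
    exact_mod_cast congrArg (fun u : ℤˣ => ((u : ℤ) : k)) (D.τ_mul a)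
  have h4 := units_cast_mul_self (k := k) (D.s (Q.src a))
  rw [h1]
  push_cast
  simp only [smul_eq_mul]
  generalize formOf Q k d c (totBasis k d p') (arrow M a (totBasis k d p)) = u
  linear_combination (-((D.s (Q.src a) : ℤ) : k) * u) * h3 - ((D.s (Q.tgt a) : ℤ) : k) * u * h4

omit [DecidableEq Q₀] in
theorem sum_basisIdx {R : Type*} [Semiring R] (f : Q₀ → R) :
    ∑ p : BasisIdx d, f p.1 = ∑ i, f i * d i := by
  rw [Fintype.sum_sigma]
  simp [Nat.cast_comm]

theorem card_basisIdx (i : Q₀) : (Finset.univ.filter fun p : BasisIdx d => p.1 = i).card = d i := by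
  rw [Finset.card_filter, sum_basisIdx fun j => if j = i then 1 else 0]
  simp

theorem card_formIdx : Fintype.card (FormIdx Q d) = ∑ i, d i * d (Q.σ₀ i) := by
  rw [Fintype.card_subtype, Finset.card_filter, Fintype.sum_prod_type]
  simp only [← Finset.card_filter, card_basisIdx]
  rw [sum_basisIdx fun i => d (Q.σ₀ i)]
  exact Finset.sum_congr rfl fun i _ => mul_comm _ _

variable [Fintype Q₁]

theorem card_compatIdx : Fintype.card (CompatIdx Q d) = ∑ a, d (Q.src a) * d (Q.src (Q.σ₁ a)) := by
  rw [Fintype.card_subtype, Finset.card_filter, Fintype.sum_prod_type]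
  refine Finset.sum_congr rfl fun a _ => ?_
  rw [Fintype.sum_prod_type, ← card_basisIdx (d := d) (Q.src a),
    ← card_basisIdx (d := d) (Q.src (Q.σ₁ a)), Finset.card_filter, Finset.card_filter,
    Finset.sum_mul_sum]
  refine Finset.sum_congr rfl fun p _ => Finset.sum_congr rfl fun p' _ => ?_
  by_cases h : p.1 = Q.src a <;> by_cases h' : p'.1 = Q.src (Q.σ₁ a) <;> simp [h, h']

variable [DecidableEq Q₁]

/-- The signed number of basis vectors at the fixed nodes and fixed arrows. -/
def signSum (D : Q.DualityStructure) (d : DimVec Q₀) : ℤ :=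
  ∑ i with Q.σ₀ i = i, (D.s i : ℤ) * d i
    + ∑ a with Q.σ₁ a = a, ((D.τ a : ℤ) * D.s (Q.tgt a)) * d (Q.tgt a)

omit [Fintype Q₁] [DecidableEq Q₁] in
theorem sum_fixed_formIdx (D : Q.DualityStructure) :
    ∑ z : FormIdx Q d with FormIdx.swap z = z, (D.s z.1.1.1 : ℤ)
      = ∑ i with Q.σ₀ i = i, (D.s i : ℤ) * d i := by
  trans ∑ p : BasisIdx d with Q.σ₀ p.1 = p.1, (D.s p.1 : ℤ)
  · refine Finset.sum_bij' (fun z _ => z.1.1) (fun p hp => ⟨(p, p), ?_⟩) ?_ ?_ ?_ ?_ ?_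
    · exact (Finset.mem_filter.mp hp).2.symm
    · intro z hz
      have h : z.1.2 = z.1.1 := congrArg (fun w => w.1.1) (Finset.mem_filter.mp hz).2
      rw [Finset.mem_filter, ← z.2, h]
      exact ⟨Finset.mem_univ _, rfl⟩
    · intro p _
      exact Finset.mem_filter.mpr ⟨Finset.mem_univ _, rfl⟩
    · intro z hz
      have h : z.1.2 = z.1.1 := congrArg (fun w => w.1.1) (Finset.mem_filter.mp hz).2
      exact Subtype.ext (Prod.ext rfl h.symm)
    · intro p _
      rfl
    · intro z _
      rfl
  · rw [Finset.sum_filter, Finset.sum_filter,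
      sum_basisIdx fun i => if Q.σ₀ i = i then (D.s i : ℤ) else 0]
    exact Finset.sum_congr rfl fun i _ => by split_ifs <;> simp

theorem sum_fixed_compatIdx (D : Q.DualityStructure) (hd : ∀ i, d (Q.σ₀ i) = d i) :
    ∑ z : CompatIdx Q d with CompatIdx.swap z = z, ((-(D.τ z.1.1 * D.s (Q.src z.1.1)) : ℤˣ) : ℤ)
      = -∑ a with Q.σ₁ a = a, ((D.τ a : ℤ) * D.s (Q.tgt a)) * d (Q.tgt a) := by
  rw [← Finset.sum_neg_distrib]
  trans ∑ z ∈ (Finset.univ.filter fun a => Q.σ₁ a = a).sigma fun a =>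
    Finset.univ.filter fun p : BasisIdx d => p.1 = Q.src a,
      ((-(D.τ z.1 * D.s (Q.src z.1)) : ℤˣ) : ℤ)
  · refine Finset.sum_bij' (fun z _ => ⟨z.1.1, z.1.2.1⟩) (fun w hw => ⟨(w.1, w.2, w.2), ?_⟩)
      ?_ ?_ ?_ ?_ ?_
    · simp only [Finset.mem_sigma, Finset.mem_filter, Finset.mem_univ, true_and] at hw
      exact ⟨hw.2, by rw [hw.1, hw.2]⟩
    · intro z hz
      have h : Q.σ₁ z.1.1 = z.1.1 := congrArg (fun w => w.1.1) (Finset.mem_filter.mp hz).2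
      simp only [Finset.mem_sigma, Finset.mem_filter, Finset.mem_univ, true_and]
      exact ⟨h, z.2.1⟩
    · intro w hw
      simp only [Finset.mem_sigma, Finset.mem_filter, Finset.mem_univ, true_and] at hw
      exact Finset.mem_filter.mpr ⟨Finset.mem_univ _, Subtype.ext (Prod.ext hw.1 rfl)⟩
    · intro z hz
      have h : z.1.2.2 = z.1.2.1 := congrArg (fun w => w.1.2.1) (Finset.mem_filter.mp hz).2
      exact Subtype.ext (Prod.ext rfl (Prod.ext rfl h.symm))
    · intro w _
      rfl
    · intro z _
      rfl
  · rw [Finset.sum_sigma]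
    refine Finset.sum_congr rfl fun a ha => ?_
    have h : Q.tgt a = Q.σ₀ (Q.src a) := by
      have := Q.tgt_σ₁ a
      rwa [(Finset.mem_filter.mp ha).2] at this
    show ∑ p : BasisIdx d with p.1 = Q.src a, ((-(D.τ a * D.s (Q.src a)) : ℤˣ) : ℤ) = _
    rw [Finset.sum_const, card_basisIdx, h, hd, D.s_σ₀]
    push_cast
    rw [nsmul_eq_mul]
    ring

/-- A stable representation of slope zero with a one-dimensional endomorphism ring, whose dimension
vector is a `σ`-invariant real root, has an essentially unique non-degenerate pairing with itself,
and this pairing is symmetric or skew-symmetric up to the signs `s_i`. -/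
theorem exists_sign {θ : Q₀ → ℤ} (h2 : (2 : k) ≠ 0) (hθ : ∀ i, θ (Q.σ₀ i) = -θ i)
    (hd : ∀ i, d (Q.σ₀ i) = d i) (hM : Q.IsStable θ 0 M) (hdd : Q.euler d d = 1)
    (hend : ∀ φ : GrHom k d d, IsHom M M φ → ∃ c : k, φ = fun _ => c • LinearMap.id) :
    ∃ (B : LinearMap.BilinForm k (Tot k d)) (ε : ℤˣ), IsPairing D M M B ∧ B.Nondegenerate ∧
      (∀ x y, B y (sgn D k d x) = ((ε : ℤ) : k) * B x y) ∧ (ε : ℤ) = signSum D d ∧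
      ∀ G, IsPairing D M M G → ∃ c : k, G = c • B := by
  have hcard : Fintype.card (FormIdx Q d) = Fintype.card (CompatIdx Q d) + 1 := by
    rw [card_formIdx, card_compatIdx]
    unfold euler at hdd
    zify
    have e1 : ∀ a, d (Q.src (Q.σ₁ a)) = d (Q.tgt a) := fun a => by rw [Q.src_σ₁, hd]
    simp only [e1, hd]
    linarith
  -- There is one more unknown than there are equations, so a non-zero pairing exists.
  obtain ⟨v, hv, hv0⟩ : ∃ v, formDiff D M v = 0 ∧ v ≠ 0 := by
    have h1 := LinearMap.finrank_range_add_finrank_ker (formDiff D M)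
    have h3 := Submodule.finrank_le (LinearMap.range (formDiff D M))
    rw [Module.finrank_fintype_fun_eq_card] at h1 h3
    have h4 : 0 < Module.finrank k (LinearMap.ker (formDiff D M)) := by omega
    obtain ⟨w, hw⟩ := Module.finrank_pos_iff_exists_ne_zero.mp h4
    exact ⟨w.1, w.2, fun h => hw (Subtype.ext h)⟩
  have hpair := formDiff_eq_zero_iff.mp hv
  have hinj : Function.Injective (formOf Q k d) := by
    intro c c' h
    funext z
    rw [← formOf_basis c, h, formOf_basis]
  have hne : formOf Q k d v ≠ 0 := fun h => hv0 (hinj (h.trans (map_zero _).symm))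
  have hnd := hpair.nondegenerate hθ hM hne
  have huniq : ∀ G, IsPairing D M M G → ∃ c : k, G = c • formOf Q k d v := by
    intro G hG
    obtain ⟨φ, hφ, hGφ⟩ := hpair.exists_hom hnd hG
    obtain ⟨c, rfl⟩ := hend φ hφ
    refine ⟨c, LinearMap.ext fun x => LinearMap.ext fun y => ?_⟩
    rw [hGφ, LinearMap.smul_apply, ← map_smul]
    rfl
  -- The sign on the equations is opposite to that of an arrow: exchanging the arguments turns the
  -- equation for `a` into the one for `σ(a)` with its two sides interchanged.
  obtain ⟨ε, hε, hε'⟩ := sign_ker_eq h2 (π := FormIdx.swap) (s := fun z => D.s z.1.1.1)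
    (ρ := CompatIdx.swap) (t := fun z => -(D.τ z.1.1 * D.s (Q.src z.1.1))) (fun _ => rfl)
    (fun z => by
      show D.s z.1.1.1 * D.s z.1.2.1 = 1
      rw [z.2, D.s_σ₀, Int.units_mul_self])
    (fun z => Subtype.ext (Prod.ext (Q.σ₁_σ₁ _) rfl))
    (fun z => by
      show -(D.τ z.1.1 * D.s (Q.src z.1.1)) * -(D.τ (Q.σ₁ z.1.1) * D.s (Q.src (Q.σ₁ z.1.1))) = 1
      rw [neg_mul_neg, mul_mul_mul_comm, D.τ_mul, Q.src_σ₁, D.s_σ₀, Int.units_mul_self])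
    (formDiff D M) formDiff_signedPerm hcard hv0
    (fun f => ⟨fun hf => by
      obtain ⟨c, hc⟩ := huniq _ (formDiff_eq_zero_iff.mp hf)
      exact ⟨c, hinj (by rw [hc, map_smul])⟩, fun ⟨c, hc⟩ => by rw [hc, map_smul, hv, smul_zero]⟩)
  refine ⟨formOf Q k d v, ε, hpair, hnd, fun x y => ?_, ?_, huniq⟩
  · rw [formOf_swap, hε, map_smul]
    rfl
  · rw [hε', sum_fixed_formIdx, sum_fixed_compatIdx D hd, sub_neg_eq_add]
    rfl

end Sign

/-! ### The sign and the quadratic function `𝓔` -/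

section SignSum

variable {Q₀ Q₁ : Type*} [Fintype Q₀] [DecidableEq Q₀] [Fintype Q₁] [DecidableEq Q₁]
  {Q : InvolutiveQuiver Q₀ Q₁} {d : DimVec Q₀}

theorem two_mul_modEuler_eq (D : Q.DualityStructure) (hd : ∀ i, d (Q.σ₀ i) = d i) :
    2 * D.modEuler d = Q.euler d d - signSum D d := by
  have h1 : ∑ i, (d i : ℤ) * d i = ∑ i with Q.σ₀ i = i, (d i : ℤ) * d i
      + ∑ i with Q.σ₀ i ≠ i, (d i : ℤ) * d i := (Finset.sum_filter_add_sum_filter_not _ _ _).symm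
  have h2 : ∑ a, (d (Q.src a) : ℤ) * d (Q.tgt a)
      = ∑ a with Q.σ₁ a = a, (d (Q.src a) : ℤ) * d (Q.tgt a)
      + ∑ a with Q.σ₁ a ≠ a, (d (Q.src a) : ℤ) * d (Q.tgt a) :=
    (Finset.sum_filter_add_sum_filter_not _ _ _).symm
  have h3 : ∑ a with Q.σ₁ a = a, (d (Q.src a) : ℤ) * d (Q.tgt a)
      = ∑ a with Q.σ₁ a = a, (d (Q.tgt a) : ℤ) * d (Q.tgt a) := by
    refine Finset.sum_congr rfl fun a ha => ?_
    have := Q.src_σ₁ a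
    rw [(Finset.mem_filter.mp ha).2] at this
    rw [this, hd]
  rw [D.two_mul_modEuler]
  unfold euler signSum
  rw [h1, h2, h3]
  simp only [hd, mul_sub, mul_add, Finset.sum_add_distrib, Finset.sum_sub_distrib]
  have h4 : ∑ i with Q.σ₀ i = i, (d i : ℤ) * (D.s i : ℤ) = ∑ i with Q.σ₀ i = i, (D.s i : ℤ) * d i :=
    Finset.sum_congr rfl fun _ _ => mul_comm _ _
  have h5 : ∑ a with Q.σ₁ a = a, (d (Q.tgt a) : ℤ) * ((D.τ a : ℤ) * D.s (Q.tgt a))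
      = ∑ a with Q.σ₁ a = a, ((D.τ a : ℤ) * D.s (Q.tgt a)) * d (Q.tgt a) :=
    Finset.sum_congr rfl fun _ _ => mul_comm _ _
  rw [h4, h5]
  ring

theorem signSum_sum {ι : Type*} (D : Q.DualityStructure) (s : Finset ι) (m : ι → ℕ)
    (f : ι → DimVec Q₀) :
    signSum D (∑ j ∈ s, m j • f j) = ∑ j ∈ s, (m j : ℤ) * signSum D (f j) := by
  unfold signSum
  simp only [Finset.sum_apply, Pi.smul_apply, smul_eq_mul, Nat.cast_sum, Nat.cast_mul,
    Finset.mul_sum, mul_add]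
  rw [Finset.sum_comm, Finset.sum_add_distrib]
  congr 1
  · exact Finset.sum_congr rfl fun _ _ => Finset.sum_congr rfl fun _ _ => by ring
  · rw [Finset.sum_comm]
    exact Finset.sum_congr rfl fun _ _ => Finset.sum_congr rfl fun _ _ => by ring

/-- The duality structure with all signs equal to one. -/
def trivialDuality (Q : InvolutiveQuiver Q₀ Q₁) : Q.DualityStructure where
  s _ := 1
  τ _ := 1
  s_σ₀ _ := rfl
  τ_mul _ := rfl

/-- If the multiplicities `n` sum to one, the signed sum is the sign of the only index with non-zero
multiplicity. -/
theorem eq_one_iff_of_sum_eq_one {ι : Type*} {s : Finset ι} {n : ι → ℕ} {c : ι → ℤˣ}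
    (h : ∑ x ∈ s, n x = 1) {ε : ℤˣ} (hε : (ε : ℤ) = ∑ x ∈ s, (c x : ℤ) * n x) :
    ε = 1 ↔ ∃ x ∈ s, c x = 1 ∧ n x ≠ 0 := by
  classical
  obtain ⟨x, hx, hx1, hx0⟩ : ∃ x ∈ s, n x = 1 ∧ ∀ y ∈ s, y ≠ x → n y = 0 := by
    obtain ⟨x, hx, hx'⟩ : ∃ x ∈ s, n x ≠ 0 := by
      by_contra! hh
      rw [Finset.sum_eq_zero hh] at h
      exact zero_ne_one h
    have h1 := Finset.add_sum_erase s n hx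
    have h2 : ∑ y ∈ s.erase x, n y = 0 := by omega
    exact ⟨x, hx, by omega, fun y hy hyx =>
      (Finset.sum_eq_zero_iff.mp h2) y (Finset.mem_erase.mpr ⟨hyx, hy⟩)⟩
  rw [Finset.sum_eq_single_of_mem x hx (fun y hy hyx => by rw [hx0 y hy hyx]; simp), hx1] at hε
  have h3 : ε = c x := Units.ext (by simpa using hε)
  constructor
  · intro h
    exact ⟨x, hx, h3 ▸ h, by omega⟩
  · rintro ⟨y, hy, hy1, hy0⟩
    by_cases hyx : y = x
    · rw [h3, ← hyx, hy1]
    · exact absurd (hx0 y hy hyx) hy0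

theorem signSum_eq_sum (D : Q.DualityStructure) (d : DimVec Q₀) :
    signSum D d = ∑ x ∈ (Finset.univ.filter fun i => Q.σ₀ i = i).disjSum
      (Finset.univ.filter fun a => Q.σ₁ a = a),
      ((Sum.elim D.s (fun a => D.τ a * D.s (Q.tgt a)) x : ℤˣ) : ℤ)
        * (Sum.elim d (fun a => d (Q.tgt a)) x : ℕ) := by
  rw [Finset.sum_disjSum]
  simp [signSum]

/-- If the total number of basis vectors at the fixed nodes and fixed arrows is one, then the sign
is positive exactly when the support meets a non-hyperbolic component. -/
theorem eq_one_iff_meetsNonHyperbolic (D : Q.DualityStructure) {ε₀ ε : ℤˣ}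
    (h0 : (ε₀ : ℤ) = signSum (trivialDuality Q) d) (hε : (ε : ℤ) = signSum D d) :
    (ε = 1 ↔ D.MeetsNonHyperbolic d) ∧
      ∃ x ∈ (Finset.univ.filter fun i => Q.σ₀ i = i).disjSum
      (Finset.univ.filter fun a => Q.σ₁ a = a), Sum.elim d (fun a => d (Q.tgt a)) x ≠ 0 := by
  rw [signSum_eq_sum] at h0 hε
  have h1 : ∑ x ∈ (Finset.univ.filter fun i => Q.σ₀ i = i).disjSum
      (Finset.univ.filter fun a => Q.σ₁ a = a), Sum.elim d (fun a => d (Q.tgt a)) x = 1 := by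
    have h2 : (ε₀ : ℤ) = ((∑ x ∈ (Finset.univ.filter fun i => Q.σ₀ i = i).disjSum
      (Finset.univ.filter fun a => Q.σ₁ a = a), Sum.elim d (fun a => d (Q.tgt a)) x : ℕ) : ℤ) := by
      rw [h0, Nat.cast_sum]
      refine Finset.sum_congr rfl fun x _ => ?_
      rcases x with i | a <;> simp [trivialDuality]
    rcases Int.units_eq_one_or ε₀ with rfl | rfl
    · exact Nat.cast_injective (R := ℤ) (h2.symm.trans (by simp))
    · exfalso
      have : (0 : ℤ) ≤ ((-1 : ℤˣ) : ℤ) := h2 ▸ Int.natCast_nonneg _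
      simp at this
  constructor
  · rw [eq_one_iff_of_sum_eq_one h1 hε]
    unfold DualityStructure.MeetsNonHyperbolic
    constructor
    · rintro ⟨i | a, hx, h2, h3⟩
      · rw [Finset.inl_mem_disjSum, Finset.mem_filter] at hx
        exact Or.inl ⟨i, hx.2, h2, h3⟩
      · rw [Finset.inr_mem_disjSum, Finset.mem_filter] at hx
        exact Or.inr ⟨a, hx.2, h2, h3⟩
    · rintro (⟨i, h2, h3, h4⟩ | ⟨a, h2, h3, h4⟩)
      · exact ⟨Sum.inl i,
          Finset.inl_mem_disjSum.mpr (Finset.mem_filter.mpr ⟨Finset.mem_univ _, h2⟩), h3, h4⟩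
      · exact ⟨Sum.inr a,
          Finset.inr_mem_disjSum.mpr (Finset.mem_filter.mpr ⟨Finset.mem_univ _, h2⟩), h3, h4⟩
  · by_contra! hh
    rw [Finset.sum_eq_zero hh] at h1
    exact zero_ne_one h1

end SignSum

/-! ### Self-dual structures on a semisimple representation -/

section Forms

variable {Q₀ Q₁ : Type*} [Fintype Q₀] [DecidableEq Q₀] [Fintype Q₁] [DecidableEq Q₁]
  {Q : InvolutiveQuiver Q₀ Q₁} {k : Type*} [Field k] {θ : Q₀ → ℤ} {D : Q.DualityStructure}

/-- A choice of a non-degenerate self-pairing `β d` of each stable representation of slope zero,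
which is unique up to scalars, and the sign `ε d` of its symmetry.  Values at `d ∉ J` are
arbitrary. -/
structure DualSystem (sys : StableSystem Q k θ 0) (D : Q.DualityStructure) where
  β : ∀ d, LinearMap.BilinForm k (Tot k d)
  ε : DimVec Q₀ → ℤˣ
  invariant : ∀ d ∈ sys.J, ∀ i, d (Q.σ₀ i) = d i
  pairing : ∀ d ∈ sys.J, IsPairing D (sys.S d) (sys.S d) (β d)
  nondegenerate : ∀ d ∈ sys.J, (β d).Nondegenerate
  symm : ∀ d ∈ sys.J, ∀ x y, β d y (sgn D k d x) = ((ε d : ℤ) : k) * β d x y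
  sign : ∀ d ∈ sys.J, (ε d : ℤ) = signSum D d
  unique : ∀ d ∈ sys.J, ∀ G, IsPairing D (sys.S d) (sys.S d) G → ∃ c : k, G = c • β d
  meets_iff : ∀ d ∈ sys.J, ε d = 1 ↔ D.MeetsNonHyperbolic d
  exists_fixed : ∀ d ∈ sys.J, ∃ x ∈ (Finset.univ.filter fun i => Q.σ₀ i = i).disjSum
      (Finset.univ.filter fun a => Q.σ₁ a = a), Sum.elim d (fun a => d (Q.tgt a)) x ≠ 0

/-- The sign `ε` of a stable representation is the signed number `signSum D d` of basis vectors at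
fixed nodes and arrows.  For the trivial duality structure this says that their unsigned number is
`1`, so there is exactly one such basis vector, and `ε` is its sign. -/
theorem exists_dualSystem (h2 : (2 : k) ≠ 0) (hθ : Q.IsSigmaGeneric k θ)
    (sys : StableSystem Q k θ 0) (D : Q.DualityStructure) : Nonempty (DualSystem sys D) := by
  classical
  have hinv : ∀ d ∈ sys.J, ∀ i, d (Q.σ₀ i) = d i := by
    intro d hd i
    have h := sys.stable d hd
    exact congrFun (hθ.invariant d (h.isSemistableDim h.ne_zero) (h.slope_eq h.ne_zero)) i
  have hdd : ∀ d ∈ sys.J, Q.euler d d = 1 := fun d hd => by rw [sys.euler_eq d hd d hd, if_pos rfl]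
  have key : ∀ d, ∃ (B : LinearMap.BilinForm k (Tot k d)) (ε : ℤˣ), d ∈ sys.J →
      IsPairing D (sys.S d) (sys.S d) B ∧ B.Nondegenerate ∧
      (∀ x y, B y (sgn D k d x) = ((ε : ℤ) : k) * B x y) ∧ (ε : ℤ) = signSum D d ∧
      ∀ G, IsPairing D (sys.S d) (sys.S d) G → ∃ c : k, G = c • B := by
    intro d
    by_cases hd : d ∈ sys.J
    · obtain ⟨B, ε, h⟩ := exists_sign (D := D) h2 hθ.compatible (hinv d hd) (sys.stable d hd)
        (hdd d hd) (sys.endo_scalar d hd)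
      exact ⟨B, ε, fun _ => h⟩
    · exact ⟨0, 1, fun h => absurd h hd⟩
  choose β ε h using key
  have h0 : ∀ d ∈ sys.J, ∃ ε₀ : ℤˣ, (ε₀ : ℤ) = signSum (trivialDuality Q) d := by
    intro d hd
    obtain ⟨B, ε₀, -, -, -, h0, -⟩ := exists_sign (D := trivialDuality Q) h2 hθ.compatible
      (hinv d hd) (sys.stable d hd) (hdd d hd) (sys.endo_scalar d hd)
    exact ⟨ε₀, h0⟩
  have hm := fun d (hd : d ∈ sys.J) =>
    eq_one_iff_meetsNonHyperbolic D (h0 d hd).choose_spec (h d hd).2.2.2.1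
  exact ⟨⟨β, ε, hinv, fun d hd => (h d hd).1, fun d hd => (h d hd).2.1, fun d hd => (h d hd).2.2.1,
    fun d hd => (h d hd).2.2.2.1, fun d hd => (h d hd).2.2.2.2, fun d hd => (hm d hd).1,
    fun d hd => (hm d hd).2⟩⟩

variable {sys : StableSystem Q k θ 0} (DS : DualSystem sys D) {m : DimVec Q₀ → ℕ} {e : DimVec Q₀}
  {U : Q.Rep k e} {ι : ∀ t : sys.Idx m, GrHom k t.1.1 e} {π : ∀ t : sys.Idx m, GrHom k e t.1.1}

/-- The bilinear form on `⨁ S_d^{m_d}` with given matrices of scalars. -/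
def formSum (π : ∀ t : sys.Idx m, GrHom k e t.1.1) (b : sys.Blocks m) :
    LinearMap.BilinForm k (Tot k e) :=
  ∑ d : sys.J, ∑ u, ∑ v, b d u v • (DS.β d.1).compl₁₂ (GrHom.tot (π ⟨d, u⟩)) (GrHom.tot (π ⟨d, v⟩))

theorem formSum_apply (b : sys.Blocks m) (x y : Tot k e) :
    formSum DS π b x y = ∑ d : sys.J, ∑ u, ∑ v,
      b d u v * DS.β d.1 (GrHom.tot (π ⟨d, u⟩) x) (GrHom.tot (π ⟨d, v⟩) y) := by
  simp only [formSum, LinearMap.sum_apply, LinearMap.smul_apply, LinearMap.compl₁₂_apply,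
    smul_eq_mul]

theorem isPairing_formSum (h : IsDecomp sys.S (fun t : sys.Idx m => t.1.1) U ι π)
    (b : sys.Blocks m) : IsPairing D U U (formSum DS π b) := by
  have key : ∀ (d : sys.J) (u v : Fin (m d.1)), IsPairing D U U
      ((DS.β d.1).compl₁₂ (GrHom.tot (π ⟨d, u⟩)) (GrHom.tot (π ⟨d, v⟩))) := fun d u v =>
    (DS.pairing d.1 d.2).comp (h.hom_π ⟨d, u⟩) (h.hom_π ⟨d, v⟩)
  constructor
  · intro i x y
    rw [formSum_apply, formSum_apply]
    exact Finset.sum_congr rfl fun d _ => Finset.sum_congr rfl fun u _ =>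
      Finset.sum_congr rfl fun v _ => congrArg _ ((key d u v).orth i x y)
  · intro a x y
    rw [formSum_apply, formSum_apply, Finset.mul_sum]
    refine Finset.sum_congr rfl fun d _ => ?_
    rw [Finset.mul_sum]
    refine Finset.sum_congr rfl fun u _ => ?_
    rw [Finset.mul_sum]
    refine Finset.sum_congr rfl fun v _ => ?_
    rw [mul_left_comm]
    exact congrArg _ ((key d u v).compat a x y)

omit [DecidableEq Q₀] [DecidableEq Q₁] in
theorem tot_π_ι (h : IsDecomp sys.S (fun t : sys.Idx m => t.1.1) U ι π) (t : sys.Idx m)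
    (x : Tot k t.1.1) : GrHom.tot (π t) (GrHom.tot (ι t) x) = x :=
  funext fun i => h.π_ι t i (x i)

omit [DecidableEq Q₀] [DecidableEq Q₁] in
theorem tot_π_ι_ne (h : IsDecomp sys.S (fun t : sys.Idx m => t.1.1) U ι π) {t t' : sys.Idx m}
    (ht : t ≠ t') (x : Tot k t'.1.1) : GrHom.tot (π t) (GrHom.tot (ι t') x) = 0 :=
  funext fun i => h.π_ι_ne t t' ht i (x i)

omit [DecidableEq Q₀] [DecidableEq Q₁] in
theorem sum_tot_ι_π (h : IsDecomp sys.S (fun t : sys.Idx m => t.1.1) U ι π) (x : Tot k e) :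
    ∑ t, GrHom.tot (ι t) (GrHom.tot (π t) x) = x := by
  funext i
  rw [Finset.sum_apply]
  exact h.sum_ι_π i (x i)

theorem formSum_ι (h : IsDecomp sys.S (fun t : sys.Idx m => t.1.1) U ι π)
    (b : sys.Blocks m) (d : sys.J) (u v : Fin (m d.1)) (x y : Tot k d.1) :
    formSum DS π b (GrHom.tot (ι ⟨d, u⟩) x) (GrHom.tot (ι ⟨d, v⟩) y) = b d u v * DS.β d.1 x y := by
  rw [formSum_apply, Finset.sum_eq_single d, Finset.sum_eq_single u, Finset.sum_eq_single v]
  · rw [tot_π_ι h ⟨d, u⟩, tot_π_ι h ⟨d, v⟩]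
  · intro v' _ hv
    rw [tot_π_ι_ne h (t := ⟨d, v'⟩) (t' := ⟨d, v⟩) (fun hh => hv (by simpa using hh)), map_zero,
      mul_zero]
  · simp
  · intro u' _ hu
    refine Finset.sum_eq_zero fun v' _ => ?_
    rw [tot_π_ι_ne h (t := ⟨d, u'⟩) (t' := ⟨d, u⟩) (fun hh => hu (by simpa using hh)), map_zero,
      LinearMap.zero_apply, mul_zero]
  · simp
  · intro d' _ hd
    refine Finset.sum_eq_zero fun u' _ => Finset.sum_eq_zero fun v' _ => ?_
    rw [tot_π_ι_ne h (t := ⟨d', u'⟩) (t' := ⟨d, u⟩) (fun hh => hd (congrArg Sigma.fst hh)),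
      map_zero, LinearMap.zero_apply, mul_zero]
  · simp

theorem formSum_ι_ne (h : IsDecomp sys.S (fun t : sys.Idx m => t.1.1) U ι π)
    (b : sys.Blocks m) (t t' : sys.Idx m) (ht : t.1 ≠ t'.1) (x : Tot k t.1.1) (y : Tot k t'.1.1) :
    formSum DS π b (GrHom.tot (ι t) x) (GrHom.tot (ι t') y) = 0 := by
  rw [formSum_apply]
  refine Finset.sum_eq_zero fun d _ => Finset.sum_eq_zero fun u _ =>
    Finset.sum_eq_zero fun v _ => ?_
  by_cases hd : d = t.1
  · rw [tot_π_ι_ne h (t := ⟨d, v⟩) (t' := t') (fun hh => ht (by rw [← hd, ← hh])), map_zero,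
      mul_zero]
  · rw [tot_π_ι_ne h (t := ⟨d, u⟩) (t' := t) (fun hh => hd (by rw [← hh])), map_zero,
      LinearMap.zero_apply, mul_zero]

theorem exists_β_ne_zero (d : sys.J) : ∃ x y, DS.β d.1 x y ≠ 0 := by
  by_contra! hh
  obtain ⟨i, x, hx⟩ := StableSystem.exists_vec d
  have := (DS.nondegenerate d.1 d.2).1 (Pi.single i x) (hh _)
  rw [Pi.single_eq_zero_iff] at this
  exact hx this

theorem formSum_injective (h : IsDecomp sys.S (fun t : sys.Idx m => t.1.1) U ι π) :
    Function.Injective (formSum DS π) := by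
  intro b b' hb
  funext d
  ext u v
  obtain ⟨x, y, hxy⟩ := exists_β_ne_zero DS d
  have h1 := formSum_ι DS h b d u v x y
  rw [hb, formSum_ι DS h] at h1
  exact (mul_right_cancel₀ hxy h1).symm

theorem formSum_surjective (h : IsDecomp sys.S (fun t : sys.Idx m => t.1.1) U ι π)
    {B : LinearMap.BilinForm k (Tot k e)} (hB : IsPairing D U U B) : ∃ b, formSum DS π b = B := by
  have h1 : ∀ (d : sys.J) (u v : Fin (m d.1)), ∃ c : k, ∀ x y,
      B (GrHom.tot (ι ⟨d, u⟩) x) (GrHom.tot (ι ⟨d, v⟩) y) = c * DS.β d.1 x y := by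
    intro d u v
    obtain ⟨c, hc⟩ := DS.unique d.1 d.2 _ (hB.comp (h.hom_ι ⟨d, u⟩) (h.hom_ι ⟨d, v⟩))
    exact ⟨c, fun x y => LinearMap.congr_fun (LinearMap.congr_fun hc x) y⟩
  choose c hc using h1
  refine ⟨fun d => Matrix.of (c d), LinearMap.ext fun x => LinearMap.ext fun y => ?_⟩
  rw [← sum_tot_ι_π h x, ← sum_tot_ι_π h y]
  simp only [map_sum, LinearMap.sum_apply]
  refine Finset.sum_congr rfl fun t _ => Finset.sum_congr rfl fun t' _ => ?_
  obtain ⟨d, u⟩ := t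
  obtain ⟨d', u'⟩ := t'
  by_cases hd : d = d'
  · subst hd
    rw [formSum_ι DS h]
    exact (hc _ _ _ _ _).symm
  · rw [formSum_ι_ne DS h _ ⟨d', u'⟩ ⟨d, u⟩ (Ne.symm hd)]
    obtain ⟨φ, hφ, hφ'⟩ := (DS.pairing d.1 d.2).exists_hom (DS.nondegenerate d.1 d.2)
      (hB.comp (h.hom_ι ⟨d', u'⟩) (h.hom_ι ⟨d, u⟩))
    have h0 := (sys.stable d'.1 d'.2).hom_eq_zero (sys.stable d.1 d.2)
      (fun hh => hd (Subtype.ext hh.symm)) hφ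
    have h3 := hφ' (GrHom.tot (π ⟨d', u'⟩) x) (GrHom.tot (π ⟨d, u⟩) y)
    have h4 : ∀ z, φ.tot z = 0 := fun z => funext fun i => by
      rw [GrHom.tot_apply, h0]
      rfl
    rw [h4, map_zero, LinearMap.zero_apply] at h3
    exact h3.symm

theorem formSum_transpose (b : sys.Blocks m) (x y : Tot k e) :
    formSum DS π b y (sgn D k e x)
      = formSum DS π (fun d => ((DS.ε d.1 : ℤ) : k) • (b d).transpose) x y := by
  rw [formSum_apply, formSum_apply]
  refine Finset.sum_congr rfl fun d _ => ?_
  rw [Finset.sum_comm]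
  refine Finset.sum_congr rfl fun u _ => Finset.sum_congr rfl fun v _ => ?_
  rw [GrHom.tot_sgn, DS.symm d.1 d.2, Matrix.smul_apply, Matrix.transpose_apply, smul_eq_mul]
  ring

omit [DecidableEq Q₀] [DecidableEq Q₁] in
theorem tot_π_endo (h : IsDecomp sys.S (fun t : sys.Idx m => t.1.1) U ι π) (c : sys.Blocks m)
    (d : sys.J) (u : Fin (m d.1)) (x : Tot k e) :
    GrHom.tot (π ⟨d, u⟩) (GrHom.tot (sys.endo ι π c) x)
      = ∑ v, c d u v • GrHom.tot (π ⟨d, v⟩) x := by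
  classical
  funext i
  simp only [GrHom.tot_apply, StableSystem.endo, LinearMap.sum_apply, LinearMap.smul_apply,
    LinearMap.comp_apply, map_sum, map_smul]
  rw [Finset.sum_eq_single d, Finset.sum_eq_single u, Finset.sum_apply]
  · refine Finset.sum_congr rfl fun v _ => ?_
    rw [h.π_ι ⟨d, u⟩]
    rfl
  · intro u' _ hu
    refine Finset.sum_eq_zero fun v _ => ?_
    rw [h.π_ι_ne ⟨d, u⟩ ⟨d, u'⟩ (fun hh => hu (by simpa using hh.symm)), smul_zero]
  · simp
  · intro d' _ hd
    refine Finset.sum_eq_zero fun u' _ => Finset.sum_eq_zero fun v _ => ?_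
    rw [h.π_ι_ne ⟨d, u⟩ ⟨d', u'⟩ (fun hh => hd (congrArg Sigma.fst hh).symm), smul_zero]
  · simp

theorem formSum_one_apply (x y : Tot k e) :
    formSum DS π (fun _ => 1) x y
      = ∑ d : sys.J, ∑ u, DS.β d.1 (GrHom.tot (π ⟨d, u⟩) x) (GrHom.tot (π ⟨d, u⟩) y) := by
  rw [formSum_apply]
  refine Finset.sum_congr rfl fun d _ => Finset.sum_congr rfl fun u _ => ?_
  rw [Finset.sum_eq_single u]
  · rw [Matrix.one_apply_eq, one_mul]
  · intro v _ hv
    rw [Matrix.one_apply_ne hv.symm, zero_mul]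
  · simp

/-- Every form is obtained from the standard one by an endomorphism. -/
theorem formSum_eq (h : IsDecomp sys.S (fun t : sys.Idx m => t.1.1) U ι π)
    (b : sys.Blocks m) (x y : Tot k e) :
    formSum DS π b x y
      = formSum DS π (fun _ => 1) (GrHom.tot (sys.endo ι π fun d => (b d).transpose) x) y := by
  rw [formSum_one_apply, formSum_apply]
  refine Finset.sum_congr rfl fun d _ => ?_
  rw [Finset.sum_comm]
  refine Finset.sum_congr rfl fun u _ => ?_
  rw [tot_π_endo h, map_sum, LinearMap.sum_apply]
  refine Finset.sum_congr rfl fun v _ => ?_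
  rw [map_smul, LinearMap.smul_apply, Matrix.transpose_apply, smul_eq_mul]

theorem nondegenerate_formSum_one (h : IsDecomp sys.S (fun t : sys.Idx m => t.1.1) U ι π) :
    (formSum DS π fun _ => 1).Nondegenerate := by
  refine LinearMap.BilinForm.Nondegenerate.ofSeparatingLeft fun x hx => ?_
  rw [← sum_tot_ι_π h x]
  refine Finset.sum_eq_zero fun t _ => ?_
  obtain ⟨d, u⟩ := t
  have : GrHom.tot (π ⟨d, u⟩) x = 0 := by
    refine (DS.nondegenerate d.1 d.2).1 _ fun y => ?_
    have h1 := hx (GrHom.tot (ι ⟨d, u⟩) y)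
    rw [formSum_one_apply, Finset.sum_eq_single d, Finset.sum_eq_single u, tot_π_ι h ⟨d, u⟩] at h1
    · exact h1
    · intro u' _ hu
      rw [tot_π_ι_ne h (t := ⟨d, u'⟩) (t' := ⟨d, u⟩) (fun hh => hu (by simpa using hh)), map_zero]
    · simp
    · intro d' _ hd
      refine Finset.sum_eq_zero fun u' _ => ?_
      rw [tot_π_ι_ne h (t := ⟨d', u'⟩) (t' := ⟨d, u⟩) (fun hh => hd (congrArg Sigma.fst hh)),
        map_zero]
    · simp
  rw [this, map_zero]

theorem nondegenerate_formSum_iff (h : IsDecomp sys.S (fun t : sys.Idx m => t.1.1) U ι π)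
    (b : sys.Blocks m) : (formSum DS π b).Nondegenerate ↔ ∀ d, IsUnit (b d).det := by
  have h1 := nondegenerate_formSum_one DS h
  have htot : ∀ c c' : sys.Blocks m, (fun d => c d * c' d) = (fun _ => 1) → ∀ x,
      GrHom.tot (sys.endo ι π c) (GrHom.tot (sys.endo ι π c') x) = x := by
    intro c c' hc x
    have h2 := StableSystem.endo_mul h c c'
    rw [hc, StableSystem.endo_one h] at h2
    funext i
    exact LinearMap.congr_fun (congrFun h2 i) (x i)
  constructor
  · intro hb
    obtain ⟨φ, hφ, hφ'⟩ := (isPairing_formSum DS h b).exists_hom hb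
      (isPairing_formSum DS h fun _ => 1)
    obtain ⟨c, rfl⟩ := StableSystem.endo_surjective h hφ
    have h2 : ∀ x, GrHom.tot (sys.endo ι π fun d => (b d).transpose)
        (GrHom.tot (sys.endo ι π c) x) = x := by
      intro x
      rw [← sub_eq_zero]
      refine h1.1 _ fun y => ?_
      rw [map_sub, LinearMap.sub_apply, ← formSum_eq DS h, ← hφ', sub_self]
    have h3 : (fun d => (b d).transpose * c d) = fun _ => 1 := by
      apply StableSystem.endo_injective h
      rw [StableSystem.endo_one h, ← StableSystem.endo_mul h]
      funext i
      refine LinearMap.ext fun x => ?_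
      have := congrFun (h2 (Pi.single i x)) i
      rw [GrHom.tot_single, GrHom.tot_single, Pi.single_eq_same, Pi.single_eq_same] at this
      exact this
    intro d
    rw [← Matrix.det_transpose]
    exact Matrix.isUnit_det_of_right_inverse (congrFun h3 d)
  · intro hb
    refine LinearMap.BilinForm.Nondegenerate.ofSeparatingLeft fun x hx => ?_
    have h2 : GrHom.tot (sys.endo ι π fun d => (b d).transpose) x = 0 :=
      h1.1 _ fun y => by rw [← formSum_eq DS h]; exact hx y
    rw [← htot (fun d => (b d).transpose⁻¹) (fun d => (b d).transpose) (funext fun d =>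
      Matrix.nonsing_inv_mul _ (by rw [Matrix.det_transpose]; exact hb d)) x, h2, map_zero]

end Forms

/-! ### The mass of the self-dual representations of given dimension vector -/

section Mass

variable {Q₀ Q₁ : Type*} [Fintype Q₀] [DecidableEq Q₀] [Fintype Q₁] [DecidableEq Q₁]
  {Q : InvolutiveQuiver Q₀ Q₁} {k : Type*} [Field k] {θ : Q₀ → ℤ} {D : Q.DualityStructure}
  {sys : StableSystem Q k θ 0} (DS : DualSystem sys D) {m : DimVec Q₀ → ℕ} {e : DimVec Q₀}
  {U : Q.Rep k e} {ι : ∀ t : sys.Idx m, GrHom k t.1.1 e} {π : ∀ t : sys.Idx m, GrHom k e t.1.1}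

omit [Fintype Q₀] [Fintype Q₁] [DecidableEq Q₁] in
theorem selfDualRep_ext {N N' : D.SelfDualRep k e} (h1 : N.maps = N'.maps) (h2 : N.form = N'.form) :
    N = N' := by
  cases N
  cases N'
  cases h1
  cases h2
  rfl

/-- The self-dual structures on `⨁ S_d^{m_d}` are the families of invertible `ε_d`-symmetric
matrices. -/
theorem card_selfDual (h : IsDecomp sys.S (fun t : sys.Idx m => t.1.1) U ι π) :
    Nat.card {N : D.SelfDualRep k e // N.maps = U}
      = ∏ d ∈ sys.J, numForms ((DS.ε d : ℤ) : k) (Fin (m d)) := by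
  rw [← Finset.prod_coe_sort sys.J (fun d => numForms ((DS.ε d : ℤ) : k) (Fin (m d)))]
  unfold numForms
  rw [← Nat.card_pi]
  have hsymm : ∀ b : sys.Blocks m, (∀ d : sys.J, (b d).transpose = ((DS.ε d.1 : ℤ) : k) • b d) ↔
      (fun d : sys.J => ((DS.ε d.1 : ℤ) : k) • (b d).transpose) = b := by
    intro b
    rw [funext_iff]
    refine forall_congr' fun d => ⟨fun hb => ?_, fun hb => ?_⟩
    · rw [hb, smul_smul, units_cast_mul_self, one_smul]
    · nth_rewrite 2 [← hb]
      rw [smul_smul, units_cast_mul_self, one_smul]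
  refine (Nat.card_eq_of_bijective (fun b : ∀ d : sys.J,
      {b : Matrix (Fin (m d.1)) (Fin (m d.1)) k //
        b.transpose = ((DS.ε d.1 : ℤ) : k) • b ∧ IsUnit b.det} =>
    (⟨DualityStructure.SelfDualRep.ofPairing U (formSum DS π fun d => (b d).1)
      (isPairing_formSum DS h _)
      ((nondegenerate_formSum_iff DS h _).mpr fun d => (b d).2.2)
      (fun x y => by
        rw [formSum_transpose, (hsymm _).mp fun d => (b d).2.1]), rfl⟩ :
      {N : D.SelfDualRep k e // N.maps = U})) ⟨?_, ?_⟩).symm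
  · intro b b' hb
    have h1 : formSum DS π (fun d => (b d).1) = formSum DS π (fun d => (b' d).1) :=
      congrArg (fun N : {N : D.SelfDualRep k e // N.maps = U} => N.1.form) hb
    funext d
    exact Subtype.ext (congrFun (formSum_injective DS h h1) d)
  · rintro ⟨N, rfl⟩
    obtain ⟨b, hb⟩ := formSum_surjective DS h N.isPairing
    have h1 := (hsymm b).mpr (formSum_injective DS h (by
      refine LinearMap.ext fun x => LinearMap.ext fun y => ?_
      rw [← formSum_transpose, hb, N.form_symm]))
    have h2 := (nondegenerate_formSum_iff DS h b).mp (hb ▸ N.nondegenerate)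
    exact ⟨fun d => ⟨b d, h1 d, h2 d⟩, Subtype.ext (selfDualRep_ext rfl hb)⟩

/-- Transport of a self-dual structure along an isomorphism of the underlying representations. -/
def transport (M : D.SelfDualRep k e) {U : Q.Rep k e} (φ : Q.RepIso M.maps U) :
    D.SelfDualRep k e :=
  DualityStructure.SelfDualRep.ofPairing U
    (M.form.compl₁₂ (GrHom.tot fun i => (φ.1 i).symm.toLinearMap)
      (GrHom.tot fun i => (φ.1 i).symm.toLinearMap))
    (M.isPairing.comp (M' := U) (N' := U)
      (fun a x => by
        show (φ.1 _).symm (U a x) = M.maps a ((φ.1 _).symm x)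
        rw [LinearEquiv.symm_apply_eq, φ.2, LinearEquiv.apply_symm_apply])
      (fun a x => by
        show (φ.1 _).symm (U a x) = M.maps a ((φ.1 _).symm x)
        rw [LinearEquiv.symm_apply_eq, φ.2, LinearEquiv.apply_symm_apply]))
    (by
      refine LinearMap.BilinForm.Nondegenerate.ofSeparatingLeft fun x hx => ?_
      have h1 := M.nondegenerate.1 _ fun y => by
        have := hx (fun i => φ.1 i (y i))
        rw [LinearMap.compl₁₂_apply] at this
        have h2 : GrHom.tot (fun i => (φ.1 i).symm.toLinearMap) (fun i => φ.1 i (y i)) = y :=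
          funext fun i => (φ.1 i).symm_apply_apply _
        rwa [h2] at this
      funext i
      have h2 : (φ.1 i).symm (x i) = 0 := congrFun h1 i
      simpa using h2)
    (fun x y => by
      rw [LinearMap.compl₁₂_apply, LinearMap.compl₁₂_apply, GrHom.tot_sgn, M.form_symm])

omit [Fintype Q₁] [DecidableEq Q₁] in
theorem transport_form (M : D.SelfDualRep k e) {U : Q.Rep k e} (φ : Q.RepIso M.maps U)
    (x y : Tot k e) :
    (transport M φ).form (fun i => φ.1 i (x i)) (fun i => φ.1 i (y i)) = M.form x y := by
  have h2 : ∀ y : Tot k e,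
      GrHom.tot (fun i => (φ.1 i).symm.toLinearMap) (fun i => φ.1 i (y i)) = y :=
    fun y => funext fun i => (φ.1 i).symm_apply_apply _
  show M.form (GrHom.tot _ _) (GrHom.tot _ _) = _
  rw [h2, h2]

/-- Giving an isomorphism from `M` to `U` is the same as giving a self-dual structure on `U` and an
isometry to it. -/
noncomputable def sigmaIsometryEquiv (M : D.SelfDualRep k e) (U : Q.Rep k e) :
    (Σ N : {N : D.SelfDualRep k e // N.maps = U}, DualityStructure.Isometry M N.1)
      ≃ Q.RepIso M.maps U := by
  refine Equiv.ofBijective (fun p => ⟨p.2.1, fun a x =>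
    (p.2.2.1 a x).trans (LinearMap.congr_fun (congrFun p.1.2 a) _)⟩) ⟨?_, ?_⟩
  · rintro ⟨⟨N, rfl⟩, ψ, hψ, hψ'⟩ ⟨⟨N', hN'⟩, ψ', hφ, hφ'⟩ h
    obtain rfl : ψ = ψ' := congrArg Subtype.val h
    obtain rfl : N = N' := by
      refine selfDualRep_ext hN'.symm (LinearMap.ext fun x => LinearMap.ext fun y => ?_)
      have h2 : ∀ y : Tot k e, (fun i => ψ i ((ψ i).symm (y i))) = y :=
        fun y => funext fun i => (ψ i).apply_symm_apply _
      have h3 := (hψ' (fun i => (ψ i).symm (x i)) (fun i => (ψ i).symm (y i))).trans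
        (hφ' (fun i => (ψ i).symm (x i)) (fun i => (ψ i).symm (y i))).symm
      rwa [h2, h2] at h3
    rfl
  · intro φ
    exact ⟨⟨⟨transport M φ, rfl⟩, ⟨φ.1, φ.2, transport_form M φ⟩⟩, rfl⟩

omit [Fintype Q₀] [Fintype Q₁] [DecidableEq Q₁] in
theorem card_isometry {M N : D.SelfDualRep k e} (h : Nonempty (DualityStructure.Isometry M N)) :
    Nat.card (DualityStructure.Isometry M N) = Nat.card (DualityStructure.Isometry M M) := by
  obtain ⟨φ, h1, h2⟩ := h
  refine Nat.card_congr
    { toFun := fun ψ => ⟨fun i => (ψ.1 i).trans (φ i).symm, fun a x => ?_, fun x y => ?_⟩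
      invFun := fun ψ => ⟨fun i => (ψ.1 i).trans (φ i), fun a x => ?_, fun x y => ?_⟩
      left_inv := fun ψ => ?_
      right_inv := fun ψ => ?_ }
  · show (φ _).symm (ψ.1 _ (M.maps a x)) = M.maps a ((φ _).symm (ψ.1 _ x))
    rw [LinearEquiv.symm_apply_eq, h1, LinearEquiv.apply_symm_apply, ψ.2.1]
  · rw [← h2, ← ψ.2.2]
    simp
  · show φ _ (ψ.1 _ (M.maps a x)) = N.maps a (φ _ (ψ.1 _ x))
    rw [ψ.2.1, h1]
  · rw [← ψ.2.2, ← h2]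
    rfl
  · refine Subtype.ext (funext fun i => LinearEquiv.ext fun x => ?_)
    simp
  · refine Subtype.ext (funext fun i => LinearEquiv.ext fun x => ?_)
    simp

omit [Fintype Q₀] [DecidableEq Q₀] [Fintype Q₁] [DecidableEq Q₁] in
theorem card_repIso {M U : Q.Rep k e} (h : Nonempty (Q.RepIso M U)) :
    Nat.card (Q.RepIso M U) = Nat.card (Q.RepIso U U) := by
  obtain ⟨φ, h1⟩ := h
  refine Nat.card_congr
    { toFun := fun ψ => ⟨fun i => (φ i).symm.trans (ψ.1 i), fun a x => ?_⟩
      invFun := fun ψ => ⟨fun i => (φ i).trans (ψ.1 i), fun a x => ?_⟩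
      left_inv := fun ψ => ?_
      right_inv := fun ψ => ?_ }
  · show ψ.1 _ ((φ _).symm (U a x)) = U a (ψ.1 _ ((φ _).symm x))
    rw [← ψ.2]
    congr 1
    rw [LinearEquiv.symm_apply_eq, h1, LinearEquiv.apply_symm_apply]
  · show ψ.1 _ (φ _ (M a x)) = U a (ψ.1 _ (φ _ x))
    rw [h1, ψ.2]
  · refine Subtype.ext (funext fun i => LinearEquiv.ext fun x => ?_)
    simp
  · refine Subtype.ext (funext fun i => LinearEquiv.ext fun x => ?_)
    simp

omit [Fintype Q₀] [DecidableEq Q₀] [DecidableEq Q₁] in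
theorem finite_rep [Finite k] : Finite (Q.Rep k e) := by
  have : ∀ a, Finite ((Fin (e (Q.src a)) → k) →ₗ[k] (Fin (e (Q.tgt a)) → k)) :=
    fun a => Finite.of_injective _ DFunLike.coe_injective
  exact Pi.finite

omit [DecidableEq Q₁] in
theorem finite_selfDualRep [Finite k] : Finite (D.SelfDualRep k e) := by
  have h1 : Finite (Q.Rep k e) := finite_rep
  have h2 : Finite (LinearMap.BilinForm k (Tot k e)) := by
    have : Finite (Tot k e →ₗ[k] k) := Finite.of_injective _ DFunLike.coe_injective
    exact Finite.of_injective (fun (B : LinearMap.BilinForm k (Tot k e)) (x : Tot k e) => B x)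
      DFunLike.coe_injective
  exact Finite.of_injective (fun N : D.SelfDualRep k e => (N.maps, N.form)) fun N N' h =>
    selfDualRep_ext (congrArg Prod.fst h) (congrArg Prod.snd h)

omit [Fintype Q₁] [DecidableEq Q₁] in
theorem finite_isometry [Finite k] (M N : D.SelfDualRep k e) :
    Finite (DualityStructure.Isometry M N) := by
  have : ∀ i, Finite ((Fin (e i) → k) ≃ₗ[k] (Fin (e i) → k)) :=
    fun i => Finite.of_injective _ DFunLike.coe_injective
  exact Subtype.finite

omit [DecidableEq Q₁] in
/-- The sum of the inverse orders of the isometry groups is the number of self-dual structures on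
the underlying representation `U`, divided by the order of its automorphism group. -/
theorem finsum_isometry [Finite k] (U : Q.Rep k e) (P : D.SelfDualRep k e → Prop) [DecidablePred P]
    (hP : ∀ N, P N ↔ Nonempty (Q.RepIso N.maps U)) :
    (∑ᶠ M : Quotient (D.isometrySetoid k e),
      if P M.out then 1 / (Nat.card (DualityStructure.Isometry M.out M.out) : ℝ) else 0)
    = Nat.card {N : D.SelfDualRep k e // N.maps = U} / Nat.card (Q.RepIso U U) := by
  classical
  have hfin : Finite (D.SelfDualRep k e) := finite_selfDualRep
  have := Fintype.ofFinite (Quotient (D.isometrySetoid k e))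
  let F := {N : D.SelfDualRep k e // N.maps = U}
  let cls : F → Quotient (D.isometrySetoid k e) := fun N => Quotient.mk _ N.1
  have hcls : ∀ (N : F) (c : Quotient (D.isometrySetoid k e)), cls N = c ↔
      Nonempty (DualityStructure.Isometry c.out N.1) := by
    intro N c
    constructor
    · rintro rfl
      exact Quotient.exact (Quotient.out_eq (cls N))
    · intro h
      rw [← Quotient.out_eq c]
      exact (Quotient.sound h).symm
  have hAut : (Nat.card (Q.RepIso U U) : ℝ) ≠ 0 := by
    have : ∀ i, Finite ((Fin (e i) → k) ≃ₗ[k] (Fin (e i) → k)) :=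
      fun i => Finite.of_injective _ DFunLike.coe_injective
    have : Finite (Q.RepIso U U) := Subtype.finite
    have : Nonempty (Q.RepIso U U) := (Q.repSetoid k e).iseqv.refl U
    exact_mod_cast Nat.card_pos.ne'
  rw [finsum_eq_sum_of_fintype, ← Nat.card_congr (Equiv.sigmaFiberEquiv cls), Nat.card_sigma,
    Nat.cast_sum, Finset.sum_div]
  refine Finset.sum_congr rfl fun c _ => ?_
  have hI : ∀ N : F, Nat.card (DualityStructure.Isometry c.out N.1)
      = if cls N = c then Nat.card (DualityStructure.Isometry c.out c.out) else 0 := by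
    intro N
    split_ifs with h
    · exact card_isometry ((hcls N c).mp h)
    · rw [Nat.card_eq_zero]
      exact Or.inl (not_nonempty_iff.mp fun hh => h ((hcls N c).mpr hh))
  have hcount : Nat.card (Q.RepIso c.out.maps U)
      = Nat.card {N : F // cls N = c} * Nat.card (DualityStructure.Isometry c.out c.out) := by
    have hfi := fun N : F => finite_isometry c.out N.1
    have := Fintype.ofFinite F
    rw [← Nat.card_congr (sigmaIsometryEquiv c.out U), Nat.card_sigma, Finset.sum_congr rfl
      fun N _ => hI N, ← Finset.sum_filter, Finset.sum_const, smul_eq_mul,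
      Nat.card_eq_fintype_card (α := {N : F // cls N = c}), Fintype.card_subtype]
  have hIso : (Nat.card (DualityStructure.Isometry c.out c.out) : ℝ) ≠ 0 := by
    have := finite_isometry c.out c.out
    have : Nonempty (DualityStructure.Isometry c.out c.out) := (D.isometrySetoid k e).iseqv.refl _
    exact_mod_cast Nat.card_pos.ne'
  split_ifs with h
  · rw [card_repIso ((hP _).mp h)] at hcount
    rw [div_eq_div_iff hIso hAut, one_mul, hcount]
    push_cast
    rfl
  · rw [hP, not_nonempty_iff] at h
    rw [Nat.card_eq_zero.mpr (Or.inl h)] at hcount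
    have : Nat.card {N : F // cls N = c} = 0 := by
      rcases Nat.mul_eq_zero.mp hcount.symm with h1 | h1
      · exact h1
      · exact absurd (by exact_mod_cast h1) hIso
    rw [this]
    simp

/-- The coefficients of the orientifold series in terms of multiplicities of stable summands. -/
theorem orientifoldSeries_eq [Finite k] (hθ : ∀ i, θ (Q.σ₀ i) = -θ i) (e : Q.SDimVec) :
    D.orientifoldSeries k θ e = √(Nat.card k : ℝ) ^ D.modEuler e.1 *
      if e.1 = ∑ d ∈ sys.J, StableSystem.mult Q e.1 d • d then
        ∏ d ∈ sys.J, formMass ((DS.ε d : ℤ) : k) (StableSystem.mult Q e.1 d) else 0 := by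
  classical
  unfold DualityStructure.orientifoldSeries
  congr 1
  split_ifs with he
  · obtain ⟨U, hU⟩ : ∃ U : Q.Rep k e.1, Q.IsSS θ 0 U := by
      rw [he]
      exact sys.exists_isSS _
    obtain ⟨-, ι, π, h⟩ := sys.hasDecomp U hU
    rw [finsum_isometry U, card_selfDual DS h, StableSystem.card_aut h]
    · push_cast
      rw [← Finset.prod_div_distrib]
      rfl
    · intro N
      rw [isSigmaSemistable_iff hθ e.2]
      constructor
      · intro hN
        obtain ⟨-, ι', π', h'⟩ := sys.hasDecomp N.maps hN
        exact h'.exists_iso h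
      · intro hN
        exact hU.of_iso ((Q.repSetoid k e.1).iseqv.symm hN)
  · refine (finsum_congr fun c => if_neg fun hc => he ?_).trans finsum_zero
    exact (sys.hasDecomp _ ((isSigmaSemistable_iff hθ e.2 _).mp hc)).1

end Mass

/-! ### The factorization of the orientifold series -/

section Factorization

variable {Q₀ Q₁ : Type*} [Fintype Q₀] [DecidableEq Q₀] [Fintype Q₁] [DecidableEq Q₁]
  {Q : InvolutiveQuiver Q₀ Q₁} {k : Type*} [Field k] {θ : Q₀ → ℤ} {D : Q.DualityStructure}

omit [Fintype Q₁] [DecidableEq Q₀] [DecidableEq Q₁] [Fintype Q₀] in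
theorem subHyp_eq_iff {f e : Q.SDimVec} {v : DimVec Q₀} (h : Q.hyp v ≤ f.1) :
    Q.subHyp f v = e ↔ f.1 = e.1 + Q.hyp v := by
  rw [Subtype.ext_iff, funext_iff, funext_iff]
  refine forall_congr' fun i => ?_
  have : Q.hyp v i ≤ f.1 i := h i
  show f.1 i - Q.hyp v i = e.1 i ↔ f.1 i = e.1 i + Q.hyp v i
  omega

theorem torusAct_single (r : ℝ) (P : DimVec Q₀ → ℝ) (e f : Q.SDimVec) (c : ℝ) :
    D.torusAct r P (Pi.single e c) f = ∑ v ∈ Finset.Iic f.1, if f.1 = e.1 + Q.hyp v then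
      P v * c * r ^ (Q.skew v e.1 + D.modEuler (Q.sigmaDim v) - D.modEuler v) else 0 := by
  classical
  unfold DualityStructure.torusAct
  refine Finset.sum_congr rfl fun v _ => ?_
  by_cases h : f.1 = e.1 + Q.hyp v
  · have hle : Q.hyp v ≤ f.1 := by
      rw [h]
      exact fun i => Nat.le_add_left _ _
    have he := (subHyp_eq_iff hle).mpr h
    rw [if_pos h, if_pos hle, he, Pi.single_eq_same]
  · rw [if_neg h]
    split_ifs with hle
    · rw [Pi.single_eq_of_ne fun he => h ((subHyp_eq_iff hle).mp he), mul_zero, zero_mul]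
    · rfl

/-- The coefficient at `f` of `P ⋆ c ξ_e` vanishes unless `e` is smaller than `f` or equal to it. -/
theorem torusAct_single_eq_zero (r : ℝ) (P : DimVec Q₀ → ℝ) {e f : Q.SDimVec} (c : ℝ) (hef : e ≠ f)
    (hdeg : deg f.1 ≤ deg e.1) : D.torusAct r P (Pi.single e c) f = 0 := by
  rw [torusAct_single]
  refine Finset.sum_eq_zero fun v _ => if_neg fun h => hef (Subtype.ext ?_)
  have h1 := congrArg deg h
  rw [deg_add] at h1
  have h2 : Q.hyp v = 0 := deg_eq_zero.mp (by omega)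
  rw [h, h2, add_zero]

theorem torusAct_single_self (r : ℝ) (P : DimVec Q₀ → ℝ) (f : Q.SDimVec) (c : ℝ) :
    D.torusAct r P (Pi.single f c) f = P 0 * c := by
  rw [torusAct_single, Finset.sum_eq_single 0]
  · have h1 : Q.hyp 0 = 0 := rfl
    have h2 : Q.sigmaDim 0 = 0 := rfl
    rw [if_pos (by rw [h1, add_zero]), skew_zero_left, h2, zero_add, sub_self, zpow_zero, mul_one]
  · intro v _ hv
    refine if_neg fun h => hv (funext fun i => ?_)
    have h1 : f.1 i = f.1 i + (v i + v (Q.σ₀ i)) := congrFun h i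
    show v i = 0
    omega
  · intro h
    exact absurd (Finset.mem_Iic.mpr fun i => Nat.zero_le _) h

/-- The orientifold invariants are determined by the factorization, by induction on the total
dimension: `ω_f` is the contribution of `e = f` to the coefficient of `ξ_f`. -/
theorem isOrientifoldFactorization_unique {Ω : DimVec Q₀ → ℤ} (hΩ : Ω 0 = 0)
    (hfin : {d | Ω d ≠ 0}.Finite) {ω ω' : Q.SDimVec → ℝ}
    (h : D.IsOrientifoldFactorization k θ Ω ω) (h' : D.IsOrientifoldFactorization k θ Ω ω') :
    ω' = ω := by
  have hfin' : {d | Ω d ≠ 0 ∧ slope θ d = 0}.Finite := hfin.subset fun d hd => hd.1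
  have hmem : ∀ d, d ∈ hfin'.toFinset.toList ↔ Ω d ≠ 0 ∧ slope θ d = 0 := fun d => by
    simp only [Finset.mem_toList, Set.Finite.mem_toFinset]
    rfl
  have s1 := h _ (Finset.nodup_toList _) hmem
  have s2 := h' _ (Finset.nodup_toList _) hmem
  have hP : ∀ c : DimVec Q₀ → ℝ, ∀ r : ℝ,
      Q.torusProd r (hfin'.toFinset.toList.map fun d => evalAt (seriesZPow
        (PowerSeries.rescale (c d) (qDilog (Nat.card k : ℝ))) (Ω d)) d) 0 = 1 := by
    intro c r
    have h0 : ∀ d ∈ hfin'.toFinset.toList, evalAt (seriesZPow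
        (PowerSeries.rescale (c d) (qDilog (Nat.card k : ℝ))) (Ω d)) d 0 = 1 := by
      intro d hd
      have hd0 : d ≠ 0 := by
        rintro rfl
        exact ((hmem 0).mp hd).1 hΩ
      rw [evalAt_zero _ hd0, constantCoeff_seriesZPow]
      rw [← PowerSeries.coeff_zero_eq_constantCoeff_apply, PowerSeries.coeff_rescale, pow_zero,
        one_mul, PowerSeries.coeff_zero_eq_constantCoeff_apply, constantCoeff_qDilog]
    exact (torusProd_triangular r hfin'.toFinset.toList _ _ 0 h0 h0 (fun _ _ _ _ => rfl)).1
  -- The contribution of `ξ_e` to the coefficient of `ξ_f` vanishes unless `e = f` or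
  -- `deg e < deg f`, and for `e = f` it is `ω_f` itself.
  funext f
  induction hN : deg f.1 using Nat.strong_induction_on generalizing f with
  | _ N ih =>
    have t1 := Pi.hasSum.mp s1 f
    have t2 := Pi.hasSum.mp s2 f
    have t3 := t2.sub t1
    rw [sub_self] at t3
    have t4 := t3.unique (hasSum_single f fun e he => ?_)
    · rw [torusAct_single_self, torusAct_single_self, hP, one_mul, one_mul] at t4
      linarith
    · by_cases hdeg : deg e.1 < N
      · rw [ih _ hdeg e rfl, sub_self]
      · rw [torusAct_single_eq_zero _ _ _ he (by omega),
          torusAct_single_eq_zero _ _ _ he (by omega), sub_self]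

/-- The exponent of `q^{1/2}` contributed by `n` copies of a stable representation of sign `ε`. -/
def localExp (ε : ℤˣ) (n : ℕ) : ℤ := ((n : ℤ) ^ 2 - ε * n) / 2

theorem two_mul_localExp (ε : ℤˣ) (n : ℕ) : 2 * localExp ε n = (n : ℤ) ^ 2 - ε * n := by
  refine Int.mul_ediv_cancel' ?_
  rcases Int.units_eq_one_or ε with rfl | rfl
  · rw [show (n : ℤ) ^ 2 - ((1 : ℤˣ) : ℤ) * n = n * (n - 1) by push_cast; ring]
    exact (Int.even_mul_pred_self (n : ℤ)).two_dvd
  · rw [show (n : ℤ) ^ 2 - ((-1 : ℤˣ) : ℤ) * n = n * (n + 1) by push_cast; ring]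
    exact (Int.even_mul_succ_self (n : ℤ)).two_dvd

/-- The coefficient identity for a single stable representation: the mass of the `ε`-symmetric forms
of rank `n` is a coefficient of the rescaled dilogarithm `𝔼_{q²}`. -/
theorem localExp_mul_formMass [Finite k] (h2 : (2 : k) ≠ 0) (ε : ℤˣ) (n : ℕ)
    (h : ε = 1 ∨ n % 2 = 0) :
    √(Nat.card k : ℝ) ^ localExp ε n * formMass ((ε : ℤ) : k) n
      = PowerSeries.coeff (n / 2) (PowerSeries.rescale
          (√(Nat.card k : ℝ) ^ ((ε : ℤ) - 2 * (n % 2 : ℕ))) (qDilog (Nat.card k : ℝ))) := by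
  have hq : (1 : ℝ) < Nat.card k := by exact_mod_cast Finite.one_lt_card
  obtain ⟨r, hr, hr2⟩ : ∃ r : ℝ, √(Nat.card k : ℝ) = r ∧ r ^ (2 : ℤ) = Nat.card k :=
    ⟨_, rfl, by exact_mod_cast Real.sq_sqrt (by linarith)⟩
  have hr0 : r ≠ 0 := by
    rintro rfl
    rw [zero_zpow _ (by norm_num)] at hr2
    linarith
  have hqr : ∀ j : ℕ, (Nat.card k : ℝ) ^ j = r ^ (2 * j : ℤ) := fun j => by
    rw [← hr2, zpow_mul, zpow_natCast]
  have hcoeff : ∀ (m : ℕ) (c : ℤ), PowerSeries.coeff m (PowerSeries.rescale (r ^ c)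
      (qDilog (Nat.card k : ℝ))) = r ^ (c * m + 2 * (m : ℤ) ^ 2) / dilogDenom (Nat.card k) m := by
    intro m c
    rw [PowerSeries.coeff_rescale, qDilog, PowerSeries.coeff_mk, dilogDenom, hqr, zpow_add₀ hr0,
      mul_div_assoc, zpow_mul r c m, zpow_natCast]
    push_cast
    rfl
  have hexp := two_mul_localExp ε n
  rw [hr, hcoeff]
  obtain ⟨m, hm | hm⟩ : ∃ m, n = 2 * m ∨ n = 2 * m + 1 := ⟨n / 2, by omega⟩
  · subst hm
    rw [show 2 * m % 2 = 0 by omega, show 2 * m / 2 = m by omega]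
    rcases Int.units_eq_one_or ε with rfl | rfl
    · have h3 : localExp 1 (2 * m) = 2 * (m : ℤ) ^ 2 - m := by
        push_cast at hexp
        linarith
      rw [h3, Units.val_one, Int.cast_one, (formMass_symm m).1, hqr, ← mul_div_assoc,
        ← zpow_add₀ hr0]
      congr 2
      push_cast
      ring
    · have h3 : localExp (-1) (2 * m) = 2 * (m : ℤ) ^ 2 + m := by
        push_cast at hexp
        linarith
      rw [h3, Units.val_neg, Units.val_one, Int.cast_neg, Int.cast_one, (formMass_alt h2 m).1, hqr,
        ← div_div, ← mul_div_assoc, mul_one_div, ← zpow_sub₀ hr0]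
      congr 2
      push_cast
      ring
  · subst hm
    obtain rfl : ε = 1 := h.resolve_right (by omega)
    have h3 : localExp 1 (2 * m + 1) = 2 * (m : ℤ) ^ 2 + m := by
      push_cast at hexp
      linarith
    rw [show (2 * m + 1) % 2 = 1 by omega, show (2 * m + 1) / 2 = m by omega, h3, Units.val_one,
      Int.cast_one, (formMass_symm m).2, hqr, ← div_div, ← mul_div_assoc, mul_one_div,
      ← zpow_sub₀ hr0]
    congr 2
    push_cast
    ring

end Factorization

section Orientifold

variable {Q₀ Q₁ : Type*} [Fintype Q₀] [DecidableEq Q₀] [Fintype Q₁] [DecidableEq Q₁]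
  {Q : InvolutiveQuiver Q₀ Q₁} {k : Type*} [Field k] {θ : Q₀ → ℤ} {D : Q.DualityStructure}
  {sys : StableSystem Q k θ 0} (DS : DualSystem sys D)

include DS in
/-- A linear combination of the dimension vectors in `J`, as a `σ`-invariant dimension vector. -/
theorem sum_invariant (m : DimVec Q₀ → ℕ) (i : Q₀) :
    (∑ d ∈ sys.J, m d • d) (Q.σ₀ i) = (∑ d ∈ sys.J, m d • d) i := by
  rw [Finset.sum_apply, Finset.sum_apply]
  refine Finset.sum_congr rfl fun d hd => ?_
  rw [Pi.smul_apply, Pi.smul_apply, DS.invariant d hd]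

include DS in
theorem hyp_sum (m : DimVec Q₀ → ℕ) :
    Q.hyp (∑ d ∈ sys.J, m d • d) = ∑ d ∈ sys.J, (2 * m d) • d := by
  have h : Q.sigmaDim (∑ d ∈ sys.J, m d • d) = ∑ d ∈ sys.J, m d • d := funext (sum_invariant DS m)
  rw [hyp, h, ← Finset.sum_add_distrib]
  exact Finset.sum_congr rfl fun d _ => by rw [two_mul, add_smul]

include DS in
/-- Sums of distinct stable dimension vectors, as linear combinations over `J` with coefficients
`0` and `1`. -/
theorem isDistinctSum_iff (R : DimVec Q₀ → Prop) (hθ : ∀ i, θ (Q.σ₀ i) = -θ i) (e : Q.SDimVec) :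
    Q.IsDistinctSum (fun f => Q.stableInvariant k θ f = 1 ∧ R f) e ↔
      ∃ T ⊆ sys.J, (∀ d ∈ T, R d) ∧ e.1 = ∑ d ∈ sys.J, (if d ∈ T then 1 else 0) • d := by
  have hsum : ∀ T ⊆ sys.J, ∑ d ∈ sys.J, (if d ∈ T then 1 else 0) • d = ∑ d ∈ T, d := by
    intro T hT
    rw [← Finset.sum_subset hT]
    · exact Finset.sum_congr rfl fun d hd => by rw [if_pos hd, one_smul]
    · intro d _ hd
      rw [if_neg hd, zero_smul]
  constructor
  · rintro ⟨S, hS, hSe⟩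
    have hT : S.map ⟨Subtype.val, Subtype.val_injective⟩ ⊆ sys.J := by
      intro d hd
      obtain ⟨f, hf, rfl⟩ := Finset.mem_map.mp hd
      exact sys.mem_J_iff.mpr ⟨stableInvariant_eq_one_iff.mp (hS f hf).1, slope_eq_zero hθ f.2⟩
    refine ⟨_, hT, ?_, ?_⟩
    · intro d hd
      obtain ⟨f, hf, rfl⟩ := Finset.mem_map.mp hd
      exact (hS f hf).2
    · rw [hsum _ hT, Finset.sum_map, ← hSe]
      rfl
  · rintro ⟨T, hT, hR, he⟩
    let φ : T ↪ Q.SDimVec := ⟨fun d => ⟨d.1, DS.invariant d.1 (hT d.2)⟩, fun d d' h =>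
      Subtype.ext (congrArg (fun f : Q.SDimVec => f.1) h)⟩
    refine ⟨T.attach.map φ, ?_, ?_⟩
    · intro f hf
      obtain ⟨d, -, rfl⟩ := Finset.mem_map.mp hf
      exact ⟨stableInvariant_eq_one_iff.mpr (sys.mem_J_iff.mp (hT d.2)).1, hR d.1 d.2⟩
    · rw [Finset.sum_map, he, hsum T hT, ← Finset.sum_attach T]
      rfl

theorem two_mul_modEuler_sum (m : DimVec Q₀ → ℕ) :
    2 * D.modEuler (∑ d ∈ sys.J, m d • d) = ∑ d ∈ sys.J, ((m d : ℤ) ^ 2 - DS.ε d * m d) := by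
  rw [two_mul_modEuler_eq D (sum_invariant DS m), sys.euler_self, signSum_sum,
    ← Finset.sum_sub_distrib]
  refine Finset.sum_congr rfl fun d hd => ?_
  rw [DS.sign d hd, mul_comm]

theorem modEuler_sum (m : DimVec Q₀ → ℕ) :
    D.modEuler (∑ d ∈ sys.J, m d • d) = ∑ d ∈ sys.J, localExp (DS.ε d) (m d) := by
  have h := two_mul_modEuler_sum DS m
  rw [Finset.sum_congr rfl fun d _ => (two_mul_localExp (DS.ε d) (m d)).symm, ← Finset.mul_sum] at h
  omega

theorem two_mul_modEuler_stable {d : DimVec Q₀} (hd : d ∈ sys.J) :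
    2 * D.modEuler d = 1 - DS.ε d := by
  rw [two_mul_modEuler_eq D (DS.invariant d hd), DS.sign d hd, sys.euler_eq d hd d hd, if_pos rfl]

/-- The orientifold invariants: the indicator function of the sums of distinct dimension vectors of
stable representations of positive sign. -/
noncomputable def orientifoldInvariant (D : Q.DualityStructure) (k : Type*) [Field k] (θ : Q₀ → ℤ)
    (e : Q.SDimVec) : ℕ :=
  open Classical in
  if Q.IsDistinctSum (fun f => Q.stableInvariant k θ f = 1 ∧ D.MeetsNonHyperbolic f) e then 1 else 0

include DS in
/-- The existence of the orientifold factorization.  In the coefficient of `ξ_f`, `f = ∑ n_d d`, a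
single term survives on the right, with `e = ∑ (n_d mod 2) d` and `x`-exponent `∑ ⌊n_d / 2⌋ d`; both
sides then are products over `d`, compared by `localExp_mul_formMass`. -/
theorem isOrientifoldFactorization_orientifoldInvariant [Finite k] (h2 : (2 : k) ≠ 0)
    (hθ : ∀ i, θ (Q.σ₀ i) = -θ i) :
    D.IsOrientifoldFactorization k θ (Q.stableInvariant k θ)
      (fun e => (orientifoldInvariant D k θ e : ℝ)) := by
  classical
  intro l hl hmem
  have hlJ : l.toFinset = sys.J := by
    ext d
    rw [List.mem_toFinset, hmem, sys.mem_J_iff]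
  set r := √(Nat.card k : ℝ) with hr
  refine Pi.hasSum.mpr fun f => ?_
  set n : DimVec Q₀ → ℕ := StableSystem.mult Q f.1 with hn
  have hω : ∀ e : Q.SDimVec, orientifoldInvariant D k θ e
      = if ∃ T ⊆ sys.J, (∀ d ∈ T, D.MeetsNonHyperbolic d) ∧
        e.1 = ∑ d ∈ sys.J, (if d ∈ T then 1 else 0) • d then 1 else 0 := by
    intro e
    unfold orientifoldInvariant
    simp only [isDistinctSum_iff DS D.MeetsNonHyperbolic hθ e]
  have hP : ∀ (e : Q.SDimVec) (v : DimVec Q₀), Q.torusProd r (l.map fun d => evalAt (seriesZPow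
        (PowerSeries.rescale (r ^ (1 - 2 * Q.euler e.1 d - 2 * D.modEuler d))
          (qDilog (Nat.card k : ℝ))) (Q.stableInvariant k θ d)) d) v
      = if v = ∑ d ∈ sys.J, StableSystem.mult Q v d • d then
        ∏ d ∈ sys.J, PowerSeries.coeff (StableSystem.mult Q v d) (PowerSeries.rescale
          (r ^ (1 - 2 * Q.euler e.1 d - 2 * D.modEuler d)) (qDilog (Nat.card k : ℝ))) else 0 := by
    intro e v
    rw [sys.torusProd_eq _ _ l hl hlJ.subset, hlJ]
    congr 1
    refine Finset.prod_congr rfl fun d hd => ?_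
    rw [stableInvariant_eq_one_iff.mpr (sys.mem_J_iff.mp hd).1]
    simp [seriesZPow]
  -- Only sums of stable dimension vectors with positive signs at the odd multiplicities occur, and
  -- then `e` and `v` are determined by the parities and the halves of the multiplicities.
  have hterm : ∀ (e : Q.SDimVec) (v : DimVec Q₀), f.1 = e.1 + Q.hyp v →
      v = ∑ d ∈ sys.J, StableSystem.mult Q v d • d → orientifoldInvariant D k θ e ≠ 0 →
      f.1 = ∑ d ∈ sys.J, n d • d ∧ (∀ d ∈ sys.J, n d % 2 = 1 → DS.ε d = 1) ∧
        e.1 = ∑ d ∈ sys.J, (n d % 2) • d ∧ v = ∑ d ∈ sys.J, (n d / 2) • d := by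
    intro e v hf hv he
    rw [hω] at he
    obtain ⟨T, hT, hTm, heT⟩ : ∃ T ⊆ sys.J, (∀ d ∈ T, D.MeetsNonHyperbolic d) ∧
        e.1 = ∑ d ∈ sys.J, (if d ∈ T then 1 else 0) • d := by
      by_contra hc
      exact he (if_neg hc)
    have hf' : f.1 = ∑ d ∈ sys.J, ((if d ∈ T then 1 else 0) + 2 * StableSystem.mult Q v d) • d := by
      rw [hf, hv, hyp_sum DS, heT, ← hv, ← Finset.sum_add_distrib]
      exact Finset.sum_congr rfl fun d _ => by rw [add_smul]
    have hnd : ∀ d ∈ sys.J, n d = (if d ∈ T then 1 else 0) + 2 * StableSystem.mult Q v d := by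
      intro d hd
      rw [hn]
      conv_lhs => rw [hf']
      exact sys.mult_sum _ hd
    refine ⟨?_, ?_, ?_, ?_⟩
    · rw [hf']
      exact Finset.sum_congr rfl fun d hd => by rw [hnd d hd]
    · intro d hd hodd
      rw [hnd d hd] at hodd
      have hdT : d ∈ T := by
        by_contra hc
        rw [if_neg hc] at hodd
        omega
      exact (DS.meets_iff d hd).mpr (hTm d hdT)
    · rw [heT]
      refine Finset.sum_congr rfl fun d hd => ?_
      rw [hnd d hd]
      congr 1
      split_ifs <;> omega
    · conv_lhs => rw [hv]
      refine Finset.sum_congr rfl fun d hd => ?_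
      rw [hnd d hd]
      congr 1
      split_ifs <;> omega
  have hA := orientifoldSeries_eq DS hθ f
  by_cases hcase : f.1 = ∑ d ∈ sys.J, n d • d ∧ ∀ d ∈ sys.J, n d % 2 = 1 → DS.ε d = 1
  · obtain ⟨hf, hodd⟩ := hcase
    let e₀ : Q.SDimVec := ⟨∑ d ∈ sys.J, (n d % 2) • d, sum_invariant DS _⟩
    set v₀ : DimVec Q₀ := ∑ d ∈ sys.J, (n d / 2) • d with hv₀
    have hfe : f.1 = e₀.1 + Q.hyp v₀ := by
      rw [hf, hyp_sum DS, ← Finset.sum_add_distrib]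
      refine Finset.sum_congr rfl fun d _ => ?_
      rw [← add_smul, Nat.mod_add_div]
    have hmv : ∀ d ∈ sys.J, StableSystem.mult Q v₀ d = n d / 2 := fun d hd => sys.mult_sum _ hd
    have hv₀' : v₀ = ∑ d ∈ sys.J, StableSystem.mult Q v₀ d • d :=
      Finset.sum_congr rfl fun d hd => by rw [hmv d hd]
    have hω₀ : orientifoldInvariant D k θ e₀ = 1 := by
      rw [hω, if_pos]
      refine ⟨sys.J.filter fun d => n d % 2 = 1, Finset.filter_subset _ _, ?_, ?_⟩
      · intro d hd
        rw [Finset.mem_filter] at hd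
        exact (DS.meets_iff d hd.1).mp (hodd d hd.1 hd.2)
      · refine Finset.sum_congr rfl fun d hd => ?_
        simp only [Finset.mem_filter, hd, true_and]
        congr 1
        split_ifs <;> omega
    have hval : D.orientifoldSeries k θ f = D.torusAct r (Q.torusProd r (l.map fun d => evalAt
        (seriesZPow (PowerSeries.rescale (r ^ (1 - 2 * Q.euler e₀.1 d - 2 * D.modEuler d))
          (qDilog (Nat.card k : ℝ))) (Q.stableInvariant k θ d)) d))
        (Pi.single e₀ (orientifoldInvariant D k θ e₀ : ℝ)) f := by
      rw [torusAct_single, Finset.sum_eq_single v₀]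
      · rw [if_pos hfe, hP, if_pos hv₀', hω₀, Nat.cast_one, mul_one]
        have hs : Q.sigmaDim v₀ = v₀ := funext (sum_invariant DS _)
        have hsk : Q.skew v₀ e₀.1 = 0 := sys.skew_sum subset_rfl subset_rfl _ _
        rw [hs, hsk, zero_add, sub_self, zpow_zero, mul_one, hA, if_pos hf]
        conv_lhs => rw [hf, modEuler_sum DS]
        have hr0 : r ≠ 0 := by
          rw [hr, Real.sqrt_ne_zero']
          exact_mod_cast Nat.card_pos
        have hprod : r ^ (∑ d ∈ sys.J, localExp (DS.ε d) (n d))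
            = ∏ d ∈ sys.J, r ^ localExp (DS.ε d) (n d) := by
          induction sys.J using Finset.induction_on with
          | empty => simp
          | insert d T hd ih => rw [Finset.sum_insert hd, Finset.prod_insert hd, zpow_add₀ hr0, ih]
        rw [hprod, ← hf, ← Finset.prod_mul_distrib]
        refine Finset.prod_congr rfl fun d hd => ?_
        have hexp : 1 - 2 * Q.euler e₀.1 d - 2 * D.modEuler d
            = (DS.ε d : ℤ) - 2 * (n d % 2 : ℕ) := by
          have h3 : Q.euler e₀.1 d = (n d % 2 : ℕ) := by
            have h4 := sys.euler_sum (fun d => n d % 2) hd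
            have h5 := sys.skew_sum (L := sys.J) (L' := {d}) subset_rfl
              (Finset.singleton_subset_iff.mpr hd) (fun d => n d % 2) (fun _ => 1)
            rw [Finset.sum_singleton, one_smul, skew, h4] at h5
            exact sub_eq_zero.mp h5
          rw [h3, two_mul_modEuler_stable DS hd]
          ring
        rw [hexp, hmv d hd]
        refine localExp_mul_formMass h2 _ _ ?_
        by_cases hpar : n d % 2 = 1
        · exact Or.inl (hodd d hd hpar)
        · exact Or.inr (by omega)
      · intro v _ hv
        split_ifs with hfv
        · rw [hP]
          split_ifs with hv'
          · exact absurd (hterm e₀ v hfv hv' (by rw [hω₀]; exact one_ne_zero)).2.2.2 hv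
          · rw [zero_mul, zero_mul]
        · rfl
      · intro h
        refine absurd (Finset.mem_Iic.mpr ?_) h
        rw [hfe]
        exact fun i => (Nat.le_add_right (v₀ i) _).trans (Nat.le_add_left _ (e₀.1 i))
    rw [hval]
    refine hasSum_single e₀ fun e he => ?_
    rw [torusAct_single]
    refine Finset.sum_eq_zero fun v _ => ?_
    split_ifs with hfv
    · rw [hP]
      split_ifs with hv'
      · have : orientifoldInvariant D k θ e = 0 := by
          by_contra hc
          exact he (Subtype.ext (hterm e v hfv hv' hc).2.2.1)
        show _ * (orientifoldInvariant D k θ e : ℝ) * _ = 0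
        rw [this, Nat.cast_zero, mul_zero, zero_mul]
      · rw [zero_mul, zero_mul]
    · rfl
  · have hA0 : D.orientifoldSeries k θ f = 0 := by
      rw [hA]
      split_ifs with hf
      · push Not at hcase
        obtain ⟨d, hd, hpar, hε⟩ := hcase hf
        rw [Finset.prod_eq_zero hd, mul_zero]
        have hε' : DS.ε d = -1 := (Int.units_eq_one_or _).resolve_left hε
        obtain ⟨m, hm⟩ : ∃ m, n d = 2 * m + 1 := ⟨n d / 2, by omega⟩
        rw [hε', ← hn, hm, Units.val_neg, Units.val_one, Int.cast_neg, Int.cast_one]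
        exact (formMass_alt h2 m).2
      · rw [mul_zero]
    rw [hA0]
    convert hasSum_zero using 1
    funext e
    rw [torusAct_single]
    refine Finset.sum_eq_zero fun v _ => ?_
    split_ifs with hfv
    · rw [hP]
      split_ifs with hv'
      · have : orientifoldInvariant D k θ e = 0 := by
          by_contra hc
          have := hterm e v hfv hv' hc
          exact hcase ⟨this.1, this.2.1⟩
        show _ * (orientifoldInvariant D k θ e : ℝ) * _ = 0
        rw [this, Nat.cast_zero, mul_zero, zero_mul]
      · rw [zero_mul, zero_mul]
    · rfl

end Orientifold

end InvolutiveQuiver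

end Orientifold

theorem mainTheorem6 {Q₀ Q₁ k : Type*} [Fintype Q₀] [DecidableEq Q₀] [Fintype Q₁] [DecidableEq Q₁]
    [Field k] [Finite k] (hk : ringChar k ≠ 2)
    (Q : Orientifold.InvolutiveQuiver Q₀ Q₁) (hQ : Q.IsFiniteType) (D : Q.DualityStructure)
    (θ : Q₀ → ℤ) (hθ : Q.IsSigmaGeneric k θ) :
    ∃ Ω : Orientifold.DimVec Q₀ → ℤ,
      Q.IsDTInvariant k θ Ω ∧
      (∀ Ω' : Orientifold.DimVec Q₀ → ℤ, Q.IsDTInvariant k θ Ω' → Ω' = Ω) ∧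
      ∃ ω : Q.SDimVec → ℕ,
        D.IsOrientifoldFactorization k θ Ω (fun e => (ω e : ℝ)) ∧
        (∀ ω' : Q.SDimVec → ℝ, D.IsOrientifoldFactorization k θ Ω ω' →
          ω' = fun e => (ω e : ℝ)) ∧
        (D.IsHyperbolic → ∀ e, ω e = if e = Q.zeroDim then 1 else 0) ∧
        (D.IsNonHyperbolic → ∀ e : Q.SDimVec,
          (Q.IsDistinctSum (fun f => Ω f = 1) e → ω e = 1) ∧
          (¬ Q.IsDistinctSum (fun f => Ω f = 1) e → ω e = 0)) ∧
        ∀ e : Q.SDimVec,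
          (Q.IsDistinctSum (fun f => Ω f = 1 ∧ D.MeetsNonHyperbolic f) e → ω e = 1) ∧
          (¬ Q.IsDistinctSum (fun f => Ω f = 1 ∧ D.MeetsNonHyperbolic f) e → ω e = 0) := by
  open Orientifold InvolutiveQuiver in
  have h2 : (2 : k) ≠ 0 := Ring.two_ne_zero hk
  have hDT := isDTInvariant_stableInvariant hQ hθ
  obtain ⟨sys⟩ := exists_stableSystem hQ hθ 0
  obtain ⟨DS⟩ := exists_dualSystem h2 hθ sys D
  have hfac := isOrientifoldFactorization_orientifoldInvariant DS h2 hθ.compatible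
  refine ⟨Q.stableInvariant k θ, hDT, fun Ω' h => hDT.unique h, orientifoldInvariant D k θ, hfac,
    fun ω' h => isOrientifoldFactorization_unique hDT.zero hDT.finite hfac h, ?_, ?_,
    fun e => ⟨fun h => if_pos h, fun h => if_neg h⟩⟩
  · intro hyp e
    have hnot : ∀ f, ¬ D.MeetsNonHyperbolic f := by
      rintro f (⟨i, hi, hs, -⟩ | ⟨a, ha, hs, -⟩)
      · rw [hyp.1 i hi] at hs
        exact absurd hs (by decide)
      · rw [hyp.2 a ha] at hs
        exact absurd hs (by decide)
    unfold orientifoldInvariant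
    congr 1
    refine propext ⟨?_, ?_⟩
    · rintro ⟨S, hS, hSe⟩
      have hS0 : S = ∅ := Finset.eq_empty_of_forall_notMem fun f hf => hnot _ (hS f hf).2
      rw [hS0, Finset.sum_empty] at hSe
      exact Subtype.ext hSe.symm
    · rintro rfl
      exact ⟨∅, by simp, by simp [zeroDim]⟩
  · intro hnon e
    have hiff : Q.IsDistinctSum (fun f => Q.stableInvariant k θ f = 1) e ↔
        Q.IsDistinctSum (fun f => Q.stableInvariant k θ f = 1 ∧ D.MeetsNonHyperbolic f) e := by
      constructor
      · rintro ⟨S, hS, hSe⟩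
        refine ⟨S, fun f hf => ⟨hS f hf, ?_⟩, hSe⟩
        have hfJ : f.1 ∈ sys.J := sys.mem_J_iff.mpr
          ⟨stableInvariant_eq_one_iff.mp (hS f hf), slope_eq_zero hθ.compatible f.2⟩
        obtain ⟨i | a, hx, hx0⟩ := DS.exists_fixed f.1 hfJ
        · rw [Finset.inl_mem_disjSum, Finset.mem_filter] at hx
          exact Or.inl ⟨i, hx.2, hnon.1 i hx.2, hx0⟩
        · rw [Finset.inr_mem_disjSum, Finset.mem_filter] at hx
          exact Or.inr ⟨a, hx.2, hnon.2 a hx.2, hx0⟩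
      · rintro ⟨S, hS, hSe⟩
        exact ⟨S, fun f hf => (hS f hf).1, hSe⟩
    rw [hiff]
    exact ⟨fun h => if_pos h, fun h => if_neg h⟩
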